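/- **Model.** A *program* runs on a randomized real RAM with a distance oracle. The machine has finitely many unbounded, indexable arrays of natural numbers and of real numbers, all initially zero; one time step performs one operation $+,\dot-,\times$ on naturals, one operation $+,-,\times,/,\log$ on reals, one comparison, one conversion of a natural number to a real (there is no floor and no real constant), one oracle call returning the distance between two input points, or the drawing of one fresh independent uniform random real in $[0,1]$. Its control structures are sequencing, branching and counting loops. The input consists of $n$, $k$, the real parameters $\varepsilon,\delta,\beta,\Delta$, and (through the oracle) a database $D=(x_1,\dots,x_n)\in X^n$ and queries $Q=(y_1,\dots,y_k)\in X^k$ of a metric space $(X,d)$. The output $M(D,Q)\in\mathbb R^k$ is a random vector, computed in one shot from $D$ and all the queries (a non-interactive mechanism); $M(D,Q)_j$ is the answer to $y_j$, and the exact answer is $D(y_j)=\frac1n\sum_{i=1}^n d(x_i,y_j)$. The mechanism is $(\varepsilon,\delta)$-differentially private if for all $D,D'\in X^n$ that differ in at most one position, all $Q\in X^k$ and all measurable $S\subseteq\mathbb R^k$, $\Pr[M(D,Q)\in S]\le e^{\varepsilon}\Pr[M(D',Q)\in S]+\delta$; it is $\varepsilon$-differentially private if this holds with $\delta=0$. **Theorem.**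 1. There are a single program and constants $c,C>0$, $p,A\in\mathbb N$ such that for every metric space $(X,d)$ all of whose distances are at most $\Delta$, where $\Delta>0$, and for all $n,k\ge1$, $\varepsilon>0$ and $\delta,\beta\in(0,1)$, the program computes an $(\varepsilon,\delta)$-differentially private mechanism $M$, always halts within $A(n+k)^A$ steps, and for all $D\in X^n$ and $Q\in X^k$, with probability at least $1-\beta$, simultaneously for all $j\le k$, $$\frac{c}{\log(k+1)}\,D(y_j)-\alpha\;\le\;M(D,Q)_j\;\le\;D(y_j)+\alpha,\qquad \alpha=\frac{C\,\Delta\,\log^{p}\!\big(\tfrac{4nk}{\beta\delta}\big)}{(n\varepsilon)^{4/5}} .$$ 2. There are a single program and constants $c,C>0$, $p,A\in\mathbb N$ such that for every metric space $(X,d)$ all of whose distances are at most $\Delta$, where $\Delta>0$, and for all $n,k\ge1$, $\varepsilon>0$ and $\beta\in(0,1)$, the program (run with $0$ in place of $\delta$) computes an $\varepsilon$-differentially private mechanism $M$, always halts within $A(n+k)^A$ steps, and for all $D\in X^n$ and $Q\in X^k$, with probability at least $1-\beta$, simultaneously for all $j\le k$, $$\frac{c}{\log(k+1)}\,D(y_j)-\alpha\;\le\;M(D,Q)_j\;\le\;D(y_j)+\alpha,\qquad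 \alpha=\frac{C\,\Delta\,\log^{p}\!\big(\tfrac{4nk}{\beta}\big)}{(n\varepsilon)^{2/3}} .$$ -/

import Mathlib

open MeasureTheory

universe u

/-! ## A randomized real RAM with a distance oracle

The machine has finitely many named, unbounded, dynamically indexed arrays of natural numbers and of
real numbers.  In unit time it performs `+`, truncated `-` and `*` on naturals; `+`, `-`, `*`, `/`
and `log` on reals; comparisons; the conversion of a natural to a real (but no conversion back: no
floor); a call to the distance oracle; and the drawing of one fresh uniform random real in `[0, 1]`.
Control flow is sequencing, branching and counting loops, so every program halts, and the number of
steps is counted explicitly.  No real constants can be stored in a program. -/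

/-- The read-only input of the machine: the number of data points, the number of query points, the
parameters `ε`, `δ`, `β`, an upper bound on the diameter, and the oracle for the metric, which is
indexed by the positions of the points in the input. -/
structure Input where
  numData : ℕ
  numQueries : ℕ
  eps : ℝ
  delta : ℝ
  beta : ℝ
  diam : ℝ
  oracle : ℕ → ℕ → ℝ

/-- The memory: `nats a i` and `reals a i` are the `i`-th cells of the arrays named `a`, and `pos`
is the number of random reals drawn so far. -/
structure State where
  nats : ℕ → ℕ → ℕ
  reals : ℕ → ℕ → ℝ
  pos : ℕ

namespace State

/-- All cells hold zero and no random real has been drawn. -/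
def init : State where
  nats := fun _ _ => 0
  reals := fun _ _ => 0
  pos := 0

def setNat (s : State) (a i v : ℕ) : State :=
  { s with nats := fun b j => if b = a ∧ j = i then v else s.nats b j }

noncomputable def setReal (s : State) (a i : ℕ) (v : ℝ) : State :=
  { s with reals := fun b j => if b = a ∧ j = i then v else s.reals b j }

end State

/-- Expressions with a natural number as value. -/
inductive NExp where
  | const (m : ℕ)
  | numData
  | numQueries
  | load (a : ℕ) (i : NExp)
  | add (e f : NExp)
  | sub (e f : NExp)
  | mul (e f : NExp)

namespace NExp

def eval (I : Input) (s : State) : NExp → ℕ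
  | const m => m
  | numData => I.numData
  | numQueries => I.numQueries
  | load a i => s.nats a (i.eval I s)
  | add e f => e.eval I s + f.eval I s
  | sub e f => e.eval I s - f.eval I s
  | mul e f => e.eval I s * f.eval I s

/-- The number of steps taken by the evaluation. -/
def size : NExp → ℕ
  | const _ => 1
  | numData => 1
  | numQueries => 1
  | load _ i => 1 + i.size
  | add e f => 1 + e.size + f.size
  | sub e f => 1 + e.size + f.size
  | mul e f => 1 + e.size + f.size

end NExp

/-- Expressions with a real number as value. -/
inductive RExp where
  | ofNat (e : NExp)
  | eps
  | delta
  | beta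
  | diam
  | oracle (i j : NExp)
  | load (a : ℕ) (i : NExp)
  | add (e f : RExp)
  | sub (e f : RExp)
  | mul (e f : RExp)
  | div (e f : RExp)
  | log (e : RExp)

namespace RExp

noncomputable def eval (I : Input) (s : State) : RExp → ℝ
  | ofNat e => (e.eval I s : ℝ)
  | eps => I.eps
  | delta => I.delta
  | beta => I.beta
  | diam => I.diam
  | oracle i j => I.oracle (i.eval I s) (j.eval I s)
  | load a i => s.reals a (i.eval I s)
  | add e f => e.eval I s + f.eval I s
  | sub e f => e.eval I s - f.eval I s
  | mul e f => e.eval I s * f.eval I s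
  | div e f => e.eval I s / f.eval I s
  | log e => Real.log (e.eval I s)

/-- The number of steps taken by the evaluation. -/
def size : RExp → ℕ
  | ofNat e => 1 + e.size
  | eps => 1
  | delta => 1
  | beta => 1
  | diam => 1
  | oracle i j => 1 + i.size + j.size
  | load _ i => 1 + i.size
  | add e f => 1 + e.size + f.size
  | sub e f => 1 + e.size + f.size
  | mul e f => 1 + e.size + f.size
  | div e f => 1 + e.size + f.size
  | log e => 1 + e.size

end RExp

/-- Tests. -/
inductive BExp where
  | natLt (e f : NExp)
  | realLt (e f : RExp)
  | neg (b : BExp)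
  | conj (b c : BExp)

namespace BExp

def holds (I : Input) (s : State) : BExp → Prop
  | natLt e f => e.eval I s < f.eval I s
  | realLt e f => e.eval I s < f.eval I s
  | neg b => ¬ b.holds I s
  | conj b c => b.holds I s ∧ c.holds I s

/-- The number of steps taken by the test. -/
def size : BExp → ℕ
  | natLt e f => 1 + e.size + f.size
  | realLt e f => 1 + e.size + f.size
  | neg b => 1 + b.size
  | conj b c => 1 + b.size + c.size

end BExp

/-- Programs.  `draw a i` stores the next random real in cell `i` of the real array `a`;
`loop v e p` evaluates the bound `m` of `e` once and then runs `p` with cell `0` of the natural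
array `v` set to `0, 1, …, m - 1` in turn. -/
inductive Prog where
  | skip
  | setNat (a : ℕ) (i : NExp) (e : NExp)
  | setReal (a : ℕ) (i : NExp) (e : RExp)
  | draw (a : ℕ) (i : NExp)
  | seq (p q : Prog)
  | ite (b : BExp) (p q : Prog)
  | loop (v : ℕ) (e : NExp) (p : Prog)

/-- `iterateSteps f m s` is the result of applying `f 0`, then `f 1`, …, then `f (m - 1)` to `s`. -/
def iterateSteps {S : Type} (f : ℕ → S → S) : ℕ → S → S
  | 0, s => s
  | m + 1, s => f m (iterateSteps f m s)

namespace Prog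

open Classical in
/-- The memory after running a program, when the random reals are those listed on `ω`. -/
noncomputable def exec (I : Input) (ω : ℕ → unitInterval) : Prog → State → State
  | skip, s => s
  | setNat a i e, s => s.setNat a (i.eval I s) (e.eval I s)
  | setReal a i e, s => s.setReal a (i.eval I s) (e.eval I s)
  | draw a i, s => { s.setReal a (i.eval I s) (ω s.pos) with pos := s.pos + 1 }
  | seq p q, s => q.exec I ω (p.exec I ω s)
  | ite b p q, s => if b.holds I s then p.exec I ω s else q.exec I ω s
  | loop v e p, s =>
      iterateSteps (fun i t => p.exec I ω (t.setNat v 0 i)) (e.eval I s) s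

open Classical in
/-- The number of steps taken by a program, when the random reals are those listed on `ω`. -/
noncomputable def cost (I : Input) (ω : ℕ → unitInterval) : Prog → State → ℕ
  | skip, _ => 1
  | setNat _ i e, _ => 1 + i.size + e.size
  | setReal _ i e, _ => 1 + i.size + e.size
  | draw _ i, _ => 1 + i.size
  | seq p q, s => p.cost I ω s + q.cost I ω (p.exec I ω s)
  | ite b p q, s => 1 + b.size + (if b.holds I s then p.cost I ω s else q.cost I ω s)
  | loop v e p, s =>
      1 + e.size + ∑ m ∈ Finset.range (e.eval I s),
        (1 + p.cost I ω
          ((iterateSteps (fun i t => p.exec I ω (t.setNat v 0 i)) m s).setNat v 0 m))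

end Prog

/-- The law of the sequence of random reals: independent and uniform on `[0, 1]`. -/
noncomputable def tapeLaw : Measure (ℕ → unitInterval) :=
  Measure.infinitePi fun _ => (volume : Measure unitInterval)

section Mechanisms

variable {X : Type u} [MetricSpace X] {n k : ℕ}

/-- The distance oracle for the points of `D` (positions `0, …, n - 1`) followed by those of `Q`
(positions `n, …, n + k - 1`). -/
noncomputable def distOracle (D : Fin n → X) (Q : Fin k → X) (i j : ℕ) : ℝ :=
  if h : i < n + k ∧ j < n + k then
    dist (Fin.append D Q ⟨i, h.1⟩) (Fin.append D Q ⟨j, h.2⟩)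
  else 0

noncomputable def mkInput (ε δ β Δ : ℝ) (D : Fin n → X) (Q : Fin k → X) : Input where
  numData := n
  numQueries := k
  eps := ε
  delta := δ
  beta := β
  diam := Δ
  oracle := distOracle D Q

/-- A randomized non-interactive mechanism: from the whole database and all the queries it
computes, in one shot, the list of all answers, using the random reals on `ω`. -/
abbrev Mechanism (X : Type u) (n k : ℕ) : Type u :=
  (Fin n → X) → (Fin k → X) → (ℕ → unitInterval) → (Fin k → ℝ)

/-- The mechanism computed by a program; the answers are found in the real array named `0`. -/
noncomputable def Prog.mechanism (P : Prog) (ε δ β Δ : ℝ) : Mechanism X n k :=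
  fun D Q ω j => (P.exec (mkInput ε δ β Δ D Q) ω State.init).reals 0 j

/-- Databases at Hamming distance at most one. -/
def Adjacent (D D' : Fin n → X) : Prop := {i | D i ≠ D' i}.ncard ≤ 1

/-- `(ε, δ)`-differential privacy. -/
def IsDP (M : Mechanism X n k) (ε δ : ℝ) : Prop :=
  ∀ D D' : Fin n → X, Adjacent D D' → ∀ Q : Fin k → X, ∀ S : Set (Fin k → ℝ), MeasurableSet S →
    tapeLaw {ω | M D Q ω ∈ S} ≤
      ENNReal.ofReal (Real.exp ε) * tapeLaw {ω | M D' Q ω ∈ S} + ENNReal.ofReal δ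

/-- The exact answer to the distance query `y`. -/
noncomputable def avgDist (D : Fin n → X) (y : X) : ℝ := (1 / (n : ℝ)) * ∑ i, dist (D i) y

/-- On every input, with probability at least `1 - β`, all answers simultaneously lie between
`γ` times the exact answer minus `α` and the exact answer plus `α`. -/
def IsAccurate (M : Mechanism X n k) (γ α β : ℝ) : Prop :=
  ∀ (D : Fin n → X) (Q : Fin k → X),
    ENNReal.ofReal (1 - β) ≤ tapeLaw {ω | ∀ j : Fin k,
      γ * avgDist D (Q j) - α ≤ M D Q ω j ∧ M D Q ω j ≤ avgDist D (Q j) + α}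

/-- On every input and for all outcomes of the random choices, `P` takes at most `T` steps. -/
def Prog.RunsWithin (P : Prog) (X : Type u) [MetricSpace X] (n k : ℕ) (ε δ β Δ : ℝ) (T : ℕ) :
    Prop :=
  ∀ (D : Fin n → X) (Q : Fin k → X) (ω : ℕ → unitInterval),
    P.cost (mkInput ε δ β Δ D Q) ω State.init ≤ T

end Mechanisms

/-! ## Resampling coordinates of the tape -/

/-! The case distinction is on the size of `n * ε`. If `n * ε < 1`, the permitted error exceeds `Δ`
and the answer `0` is good enough. If `n * ε ≥ k ^ 5`, or if `β` is so small that `log (1 / β) ≥ k`,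
noise of scale `k * Δ / ε` is added to each sum of distances. The error is then about `k * Δ / (n *
ε)`, and either `k ≤ (n * ε) ^ (1/5)` or `k` is below the logarithm in the error term.

The remaining case uses random hierarchical partitions whose centers are the query points. On scale
`s = Δ / 2 ^ i` a point joins the center of least random priority within the random radius `(1 + v)
* s`. A query always captures itself, so a point sharing its cluster is within `4 * s` of it;
summing `s` over the levels that separate `x` from the query `y` therefore gives at least `dist x y
/ 8`, up to truncation (`dist_div_le_sepCost`). In expectation this sum is at most `(1 + log k) *
dist x y` (`lintegral_sepBound_le`). Each separation has a witness center `w` capturing only one of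
the two points and having least priority among the centers at least as close to the pair
(`exists_witness_of_center_ne`). The priority condition has probability one over the rank of `w`.
The radius condition, weighted by `s` and summed over all scales, costs at most `dist x y`, because
the intervals `[s, 2 * s]` do not overlap. The reciprocal ranks sum to a harmonic number.

By Markov's inequality one trial overestimates a query by more than a factor `3` (plus slack) with
probability at most `1/3`. The lower bound is deterministic, so the minimum over about `log (2 * k /
β)` independent trials is accurate for all queries at once. Dividing by `9 * log (k + 1)` turns the
overestimate into the required two-sided bound.

For privacy, the partitions depend only on the queries and on the randomness. The data enter through
cluster sizes alone, and changing one point alters these by at most `2` per trial and level. With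
`T` trials and `8 * T` levels the sensitivity is `16 * T ^ 2`, so noise of that scale over `ε`
suffices and the additive error is polylogarithmic times `Δ / (n * ε)`. Logistic noise is used
because its quantile function needs only division and a logarithm, and its translates have density
ratio at most `exp |shift|` (`volume_logit_shift_le`). A hybrid argument (`tapeLaw_noisyOutput_le`)
extends this to vectors. All branches are purely `ε`-private, so one program proves both parts. -/

instance isProbabilityMeasure_tapeLaw : IsProbabilityMeasure tapeLaw := by
  unfold tapeLaw; infer_instance

open Classical in
-- Both laws agree on finite boxes, where the product over cells splits into the cells inside and
-- outside `S`. Resampling and independence are both read off from this gluing of two tapes.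
theorem measurePreserving_piecewise_tapeLaw (S : Set ℕ) :
    MeasurePreserving
      (fun p : (ℕ → unitInterval) × (ℕ → unitInterval) => S.piecewise p.1 p.2)
      (tapeLaw.prod tapeLaw) tapeLaw := by
  have hm : Measurable
      (fun p : (ℕ → unitInterval) × (ℕ → unitInterval) => S.piecewise p.1 p.2) := by
    refine measurable_pi_lambda _ fun i => ?_
    by_cases hi : i ∈ S
    · simp only [Set.piecewise, hi, if_true]; fun_prop
    · simp only [Set.piecewise, hi, if_false]; fun_prop
  refine ⟨hm, ?_⟩
  unfold tapeLaw
  refine Measure.eq_infinitePi _ fun s t ht => ?_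
  rw [Measure.map_apply hm (MeasurableSet.pi s.countable_toSet fun i _ => ht i)]
  have : (fun p : (ℕ → unitInterval) × (ℕ → unitInterval) => S.piecewise p.1 p.2) ⁻¹'
      (Set.pi s t) = (Set.pi (s.filter (· ∈ S) : Finset ℕ) t) ×ˢ
        (Set.pi (s.filter (· ∉ S) : Finset ℕ) t) := by
    ext p
    simp only [Set.mem_preimage, Set.mem_pi, Set.mem_prod, Finset.coe_filter, Set.mem_ofPred_eq,
      Set.piecewise, Finset.mem_coe]
    constructor
    · intro h
      exact ⟨fun i hi => by simpa [hi.2] using h i hi.1, fun i hi => by simpa [hi.2] using h i hi.1⟩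
    · rintro ⟨h1, h2⟩ i hi
      by_cases hS : i ∈ S
      · simpa [hS] using h1 i ⟨hi, hS⟩
      · simpa [hS] using h2 i ⟨hi, hS⟩
  rw [this, Measure.prod_prod, Measure.infinitePi_pi _ fun i _ => ht i,
    Measure.infinitePi_pi _ fun i _ => ht i, Finset.prod_filter_mul_prod_filter_not]

/-- The integral over the tape may be computed by first resampling one coordinate. -/
theorem lintegral_tapeLaw_update (i : ℕ) {F : (ℕ → unitInterval) → ENNReal} (hF : Measurable F) :
    ∫⁻ ω, F ω ∂tapeLaw = ∫⁻ ω, ∫⁻ v, F (Function.update ω i v) ∂volume ∂tapeLaw := by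
  classical
  have h := (measurePreserving_piecewise_tapeLaw {i}).lintegral_comp hF
  have hm := hF.comp (measurePreserving_piecewise_tapeLaw {i}).measurable
  rw [← h]
  refine (lintegral_prod_symm _ hm.aemeasurable).trans (lintegral_congr fun ω => ?_)
  refine Eq.trans (lintegral_congr fun ω' => congrArg F
    (show _ = Function.update ω i (ω' i) from ?_))
    ((measurePreserving_eval_infinitePi (fun _ : ℕ => (volume : Measure unitInterval)) i
      ).lintegral_comp (f := fun v => F (Function.update ω i v)) (hF.comp (measurable_update ω)))
  funext j
  by_cases hj : j = i
  · subst hj; simp [Set.piecewise]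
  · simp [Set.piecewise, hj]

theorem lintegral_tapeLaw_le_of_update (i : ℕ) {F G : (ℕ → unitInterval) → ENNReal}
    (hF : Measurable F) (hG : Measurable G)
    (h : ∀ ω, ∫⁻ v, F (Function.update ω i v) ∂volume ≤ ∫⁻ v, G (Function.update ω i v) ∂volume) :
    ∫⁻ ω, F ω ∂tapeLaw ≤ ∫⁻ ω, G ω ∂tapeLaw := by
  rw [lintegral_tapeLaw_update i hF, lintegral_tapeLaw_update i hG]
  exact lintegral_mono h

/-- Events determined by complementary sets of coordinates are independent. -/
theorem tapeLaw_inter_eq_mul (S : Set ℕ) {A B : Set (ℕ → unitInterval)}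
    (hA : MeasurableSet A) (hB : MeasurableSet B)
    (hAS : ∀ ω ω', (∀ i ∈ S, ω i = ω' i) → ω ∈ A → ω' ∈ A)
    (hBS : ∀ ω ω', (∀ i ∉ S, ω i = ω' i) → ω ∈ B → ω' ∈ B) :
    tapeLaw (A ∩ B) = tapeLaw A * tapeLaw B := by
  classical
  have h := measurePreserving_piecewise_tapeLaw S
  -- After gluing two independent tapes along `S`, `A` sees only the first tape and `B` only the
  -- second.
  rw [← h.measure_preimage (hA.inter hB).nullMeasurableSet, ← Measure.prod_prod]
  congr 1
  ext ⟨ω, ω'⟩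
  simp only [Set.mem_preimage, Set.mem_inter_iff, Set.mem_prod]
  refine and_congr ⟨fun h => hAS _ _ (fun i hi => ?_) h, fun h => hAS _ _ (fun i hi => ?_) h⟩
    ⟨fun h => hBS _ _ (fun i hi => ?_) h, fun h => hBS _ _ (fun i hi => ?_) h⟩ <;>
  simp [Set.piecewise, hi]

theorem tapeLaw_coord_mem (i : ℕ) {U : Set unitInterval} (hU : MeasurableSet U) :
    tapeLaw {ω | ω i ∈ U} = volume U :=
  (measurePreserving_eval_infinitePi (fun _ : ℕ => (volume : Measure unitInterval)) i
    ).measure_preimage hU.nullMeasurableSet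

theorem measurableSet_forall_coord_le (a : ℕ) (s : Finset ℕ) :
    MeasurableSet {ω : ℕ → unitInterval | ∀ q ∈ s, ω a ≤ ω q} := by
  have : {ω : ℕ → unitInterval | ∀ q ∈ s, ω a ≤ ω q} = ⋂ q ∈ s, {ω | ω a ≤ ω q} := by
    ext; simp
  rw [this]
  exact Finset.measurableSet_biInter s fun i _ =>
    measurableSet_le (measurable_pi_apply a) (measurable_pi_apply i)

/-- Coordinate `a` is minimal among `a` and the coordinates in `s` with probability
`1 / (#s + 1)`. -/
theorem tapeLaw_coord_le_forall (a : ℕ) (s : Finset ℕ) (ha : a ∉ s) :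
    tapeLaw {ω | ∀ i ∈ s, ω a ≤ ω i} ≤ ENNReal.ofReal (1 / ((s.card : ℝ) + 1)) := by
  have hm := measurableSet_forall_coord_le a s
  have hU : ∀ v : unitInterval, volume (Set.Ici v) = ENNReal.ofReal (1 - v) := by
    intro v; simp
  -- Conditioned on the value `v` of cell `a`, the other cells all lie above it with probability `(1
  -- - v) ^ s.card`; integrating over `v` gives the claim.
  rw [← lintegral_indicator_one hm, lintegral_tapeLaw_update a (measurable_one.indicator hm),
    lintegral_lintegral_swap]
  · have h1 : ∀ v : unitInterval, ∫⁻ ω, Set.indicator {ω : ℕ → unitInterval | ∀ i ∈ s, ω a ≤ ω i} 1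
        (Function.update ω a v) ∂tapeLaw = ENNReal.ofReal ((1 - v) ^ s.card) := by
      intro v
      have h2 : (fun ω => Set.indicator {ω : ℕ → unitInterval | ∀ i ∈ s, ω a ≤ ω i} 1
          (Function.update ω a v)) = Set.indicator (Set.pi s fun _ => Set.Ici v)
            (1 : (ℕ → unitInterval) → ENNReal) := by
        ext ω
        simp only [Set.indicator, Set.mem_ofPred_eq, Set.mem_pi, Finset.mem_coe, Set.mem_Ici,
          Function.update_self, Pi.one_apply]
        congr 1
        refine propext (forall₂_congr fun i hi => ?_)
        rw [Function.update_of_ne (ne_of_mem_of_not_mem hi ha)]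
      rw [h2, lintegral_indicator_one
        (MeasurableSet.pi s.countable_toSet fun i _ => measurableSet_Ici)]
      unfold tapeLaw
      rw [Measure.infinitePi_pi _ fun i _ => measurableSet_Ici]
      simp only [hU, Finset.prod_const]
      rw [ENNReal.ofReal_pow (by linarith [v.2.2])]
    simp only [h1]
    have h3 := unitInterval.measurePreserving_coe.lintegral_comp
      (f := fun x : ℝ => ENNReal.ofReal ((1 - x) ^ s.card)) (by fun_prop)
    rw [h3, ← ofReal_integral_eq_lintegral_ofReal]
    · apply le_of_eq
      congr 1
      rw [unitInterval, integral_Icc_eq_integral_Ioc, ← intervalIntegral.integral_of_le zero_le_one,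
        intervalIntegral.integral_comp_sub_left (fun x => x ^ s.card) 1]
      simp
    · exact (Continuous.continuousOn (by fun_prop)).integrableOn_compact isCompact_Icc
    · filter_upwards [ae_restrict_mem measurableSet_Icc] with x hx
      exact pow_nonneg (by linarith [hx.2]) _
  · refine Measurable.aemeasurable ?_
    refine (measurable_one.indicator hm).comp ?_
    refine measurable_pi_lambda _ fun i => ?_
    by_cases hi : i = a
    · subst hi; simp only [Function.update_self]; fun_prop
    · simp only [Function.update_of_ne hi]; fun_prop

/-! ## Logistic noise -/

/-- The quantile function of the logistic distribution. -/
noncomputable def logit (x : ℝ) : ℝ := Real.log (x / (1 - x))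

theorem measurable_logit : Measurable logit := by unfold logit; fun_prop

/-- This Möbius map is translation by `v` in the logit coordinate. The difference quotient is
explicit, and both of its denominators are at least `1` for `v ≥ 0` and at least `exp v` for `v ≤
0`. -/
theorem abs_moebius_sub_le (v : ℝ) {x y : ℝ} (hx : x ∈ Set.Ioo (0 : ℝ) 1)
    (hy : y ∈ Set.Ioo (0 : ℝ) 1) :
    |x * Real.exp v / (1 - x + x * Real.exp v) - y * Real.exp v / (1 - y + y * Real.exp v)|
      ≤ Real.exp |v| * |x - y| := by
  have he := Real.exp_pos v
  have hx0 := hx.1; have hx1 := hx.2; have hy0 := hy.1; have hy1 := hy.2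
  have hX : 0 < 1 - x + x * Real.exp v := by nlinarith [mul_pos hx0 he]
  have hY : 0 < 1 - y + y * Real.exp v := by nlinarith [mul_pos hy0 he]
  have e1 : x * Real.exp v / (1 - x + x * Real.exp v) - y * Real.exp v / (1 - y + y * Real.exp v)
      = Real.exp v / ((1 - x + x * Real.exp v) * (1 - y + y * Real.exp v)) * (x - y) := by
    field_simp
    ring
  rw [e1, abs_mul]
  refine mul_le_mul_of_nonneg_right ?_ (abs_nonneg _)
  rw [abs_of_pos (by positivity), div_le_iff₀ (by positivity)]
  rcases le_total 0 v with hv | hv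
  · rw [abs_of_nonneg hv]
    have h1 : 1 ≤ Real.exp v := Real.one_le_exp hv
    have : 1 ≤ 1 - x + x * Real.exp v := by nlinarith
    have : 1 ≤ 1 - y + y * Real.exp v := by nlinarith
    exact le_mul_of_one_le_right he.le (one_le_mul_of_one_le_of_one_le ‹_› ‹_›)
  · rw [abs_of_nonpos hv, Real.exp_neg]
    have h1 : Real.exp v ≤ 1 := Real.exp_le_one_iff.2 hv
    have a1 : Real.exp v ≤ 1 - x + x * Real.exp v := by nlinarith
    have a2 : Real.exp v ≤ 1 - y + y * Real.exp v := by nlinarith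
    calc Real.exp v = (Real.exp v)⁻¹ * (Real.exp v * Real.exp v) := by field_simp
      _ ≤ _ := by gcongr

/-- The odds `x / (1 - x)` are multiplied by `exp v`. -/
theorem logit_moebius (v : ℝ) {x : ℝ} (hx : x ∈ Set.Ioo (0 : ℝ) 1) :
    logit (x * Real.exp v / (1 - x + x * Real.exp v)) = logit x + v := by
  have he := Real.exp_pos v
  have hx0 := hx.1
  have hx1 : 0 < 1 - x := by linarith [hx.2]
  have hX : 0 < 1 - x + x * Real.exp v := by positivity
  have : x * Real.exp v / (1 - x + x * Real.exp v) /
      (1 - x * Real.exp v / (1 - x + x * Real.exp v)) = x / (1 - x) * Real.exp v := by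
    have h2 : 1 - x * Real.exp v / (1 - x + x * Real.exp v)
        = (1 - x) / (1 - x + x * Real.exp v) := by
      field_simp; ring
    rw [h2]; field_simp
  unfold logit
  rw [this, Real.log_mul (by positivity) he.ne', Real.log_exp]

theorem moebius_mem_Ioo (v : ℝ) {x : ℝ} (hx : x ∈ Set.Ioo (0 : ℝ) 1) :
    x * Real.exp v / (1 - x + x * Real.exp v) ∈ Set.Ioo (0 : ℝ) 1 := by
  have he := Real.exp_pos v
  have hx0 := hx.1
  have hx1 : 0 < 1 - x := by linarith [hx.2]
  refine ⟨by positivity, ?_⟩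
  rw [div_lt_one (by positivity)]
  linarith

theorem moebius_moebius_neg (v : ℝ) {x : ℝ} (hx : x ∈ Set.Ioo (0 : ℝ) 1) :
    (x * Real.exp v / (1 - x + x * Real.exp v)) * Real.exp (-v) /
      (1 - (x * Real.exp v / (1 - x + x * Real.exp v)) +
        (x * Real.exp v / (1 - x + x * Real.exp v)) * Real.exp (-v)) = x := by
  have he := Real.exp_pos v
  have hx0 := hx.1
  have hx1 : 0 < 1 - x := by linarith [hx.2]
  have hX : 0 < 1 - x + x * Real.exp v := by positivity
  rw [Real.exp_neg]
  have h2 : 1 - x * Real.exp v / (1 - x + x * Real.exp v) +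
      x * Real.exp v / (1 - x + x * Real.exp v) * (Real.exp v)⁻¹
        = 1 / (1 - x + x * Real.exp v) := by
    field_simp; ring
  rw [h2]; field_simp

/-- Translating logistic noise by `v` scales changes probabilities by at most `exp |v|`. -/
theorem volume_logit_shift_le (c c' : ℝ) {b : ℝ} (hb : 0 < b) (A : Set ℝ) :
    (volume : Measure unitInterval) {x | c + b * logit x ∈ A} ≤
      ENNReal.ofReal (Real.exp (|c - c'| / b)) *
        (volume : Measure unitInterval) {x | c' + b * logit x ∈ A} := by
  set v : ℝ := (c - c') / b with hv
  have hv' : |c - c'| / b = |-v| := by rw [hv, abs_neg, abs_div, abs_of_pos hb]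
  have hcc : c = c' + b * v := by rw [hv]; field_simp; ring
  rw [unitInterval.volume_apply, unitInterval.volume_apply, hv']
  set B : Set ℝ := {x | x ∈ Set.Ioo (0 : ℝ) 1 ∧ c' + b * logit x ∈ A} with hB
  -- The endpoints, where the logit is not meaningful, form a null set. Every other point of the
  -- event is the image under the Möbius map for `-v` of a point of the shifted event.
  have hsub : Subtype.val '' {x : unitInterval | c + b * logit x ∈ A} ⊆
      {0, 1} ∪ (fun x => x * Real.exp (-v) / (1 - x + x * Real.exp (-v))) '' B := by
    rintro _ ⟨x, hx, rfl⟩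
    by_cases h0 : (x : ℝ) = 0
    · simp [h0]
    by_cases h1 : (x : ℝ) = 1
    · simp [h1]
    have hx' : (x : ℝ) ∈ Set.Ioo (0 : ℝ) 1 :=
      ⟨lt_of_le_of_ne x.2.1 (Ne.symm h0), lt_of_le_of_ne x.2.2 h1⟩
    refine Or.inr ⟨x * Real.exp v / (1 - x + x * Real.exp v), ⟨moebius_mem_Ioo v hx', ?_⟩,
      moebius_moebius_neg v hx'⟩
    rw [logit_moebius v hx', mul_add, add_comm (b * logit x), ← add_assoc, ← hcc]
    exact hx
  have hlip : LipschitzOnWith (Real.toNNReal (Real.exp |-v|))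
      (fun x => x * Real.exp (-v) / (1 - x + x * Real.exp (-v))) B := by
    refine LipschitzOnWith.of_dist_le_mul fun x hx y hy => ?_
    rw [Real.dist_eq, Real.dist_eq, Real.coe_toNNReal _ (Real.exp_pos _).le]
    exact abs_moebius_sub_le (-v) hx.1 hy.1
  -- One-dimensional Hausdorff measure is Lebesgue measure, so the Lipschitz bound replaces a change
  -- of variables.
  have himg := hlip.hausdorffMeasure_image_le (d := 1) zero_le_one
  rw [hausdorffMeasure_real, ENNReal.rpow_one] at himg
  refine (measure_mono hsub).trans ((measure_union_le _ _).trans ?_)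
  rw [Set.Finite.measure_zero (by simp) volume, zero_add]
  refine himg.trans ?_
  refine mul_le_mul' le_rfl (measure_mono ?_)
  rintro x ⟨hx, hxA⟩
  exact ⟨⟨x, hx.1.le, hx.2.le⟩, hxA, rfl⟩

theorem volume_logit_tail (τ : ℝ) :
    (volume : Measure unitInterval) {x | τ < |logit x|} ≤
      ENNReal.ofReal (2 * Real.exp (-τ)) := by
  have hsub : Subtype.val '' {x : unitInterval | τ < |logit x|} ⊆
      Set.Icc 0 (Real.exp (-τ)) ∪ Set.Icc (1 - Real.exp (-τ)) 1 := by
    rintro _ ⟨x, hx, rfl⟩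
    -- At `0` and `1` division by zero and `log 0 = 0` make the logit `0`; the two closed intervals
    -- cover these points for every `τ`.
    by_cases h0 : (x : ℝ) = 0
    · left; rw [h0]; exact ⟨le_rfl, (Real.exp_pos _).le⟩
    by_cases h1 : (x : ℝ) = 1
    · right; rw [h1]; exact ⟨by linarith [Real.exp_pos (-τ)], le_rfl⟩
    have hx0 : 0 < (x : ℝ) := lt_of_le_of_ne x.2.1 (Ne.symm h0)
    have hx1 : 0 < 1 - (x : ℝ) := by
      have := lt_of_le_of_ne x.2.2 h1; linarith
    rcases lt_abs.1 (show τ < |logit x| from hx) with h | h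
    · right
      unfold logit at h
      rw [Real.lt_log_iff_exp_lt (by positivity), lt_div_iff₀ hx1] at h
      refine ⟨?_, x.2.2⟩
      have h3 : 1 - (x : ℝ) < Real.exp (-τ) := by
        rw [Real.exp_neg, lt_inv_comm₀ hx1 (Real.exp_pos _), ← one_div, lt_div_iff₀ hx1]
        linarith [x.2.2]
      linarith
    · left
      unfold logit at h
      refine ⟨x.2.1, ?_⟩
      have h2 : Real.log (x / (1 - x)) < -τ := by linarith
      rw [Real.log_lt_iff_lt_exp (by positivity), div_lt_iff₀ hx1] at h2
      nlinarith [Real.exp_pos (-τ)]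
  rw [unitInterval.volume_apply]
  refine (measure_mono hsub).trans ((measure_union_le _ _).trans ?_)
  rw [Real.volume_Icc, Real.volume_Icc, ← ENNReal.ofReal_add (by simp [Real.exp_nonneg])
    (by simp [Real.exp_nonneg])]
  refine ENNReal.ofReal_le_ofReal ?_
  linarith

theorem tapeLaw_logit_tail (i : ℕ) (τ : ℝ) :
    tapeLaw {ω | τ < |logit (ω i)|} ≤ ENNReal.ofReal (2 * Real.exp (-τ)) := by
  have hU : MeasurableSet {x : unitInterval | τ < |logit x|} :=
    measurableSet_lt measurable_const
      ((measurable_logit.comp measurable_subtype_coe).abs)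
  exact (tapeLaw_coord_mem i hU).trans_le (volume_logit_tail τ)

/-! ## Privacy of additive logistic noise -/

section NoisyStatistics

variable {Y : Type*} [MeasurableSpace Y]

/-- Post-processing of statistics perturbed by logistic noise of scale `b`, drawn from the tape
cells `N, N + 1, …`. -/
noncomputable def noisyOutput (N : ℕ) (b : ℝ) (post : (ℕ → unitInterval) → (ℕ → ℝ) → Y)
    (a : (ℕ → unitInterval) → ℕ → ℝ) (ω : ℕ → unitInterval) : Y :=
  post ω fun q => a ω q + b * logit (ω (N + q))

theorem measurable_noisyOutput (N : ℕ) (b : ℝ) {post : (ℕ → unitInterval) → (ℕ → ℝ) → Y}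
    {a : (ℕ → unitInterval) → ℕ → ℝ} (hpost : Measurable fun p : _ × _ => post p.1 p.2)
    (ha : Measurable a) : Measurable (noisyOutput N b post a) := by
  refine hpost.comp (measurable_id.prodMk (measurable_pi_lambda _ fun q => ?_))
  exact (measurable_pi_iff.1 ha q).add
    (measurable_const.mul (measurable_logit.comp (measurable_subtype_coe.comp
      (measurable_pi_apply _))))

variable {N : ℕ} {b : ℝ} {post : (ℕ → unitInterval) → (ℕ → ℝ) → Y}

/-- Replacing one statistic by another one. -/
theorem lintegral_noisyOutput_replace_le (hb : 0 < b) (j : ℕ)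
    {a a' : (ℕ → unitInterval) → ℕ → ℝ} {W : (ℕ → unitInterval) → ENNReal}
    (hpost : Measurable fun p : _ × _ => post p.1 p.2) (ha : Measurable a) (ha' : Measurable a')
    (hW : Measurable W)
    (hpu : ∀ ω v, post (Function.update ω (N + j) v) = post ω)
    (hau : ∀ ω v, a (Function.update ω (N + j) v) = a ω)
    (hau' : ∀ ω v, a' (Function.update ω (N + j) v) = a' ω)
    (hWu : ∀ ω v, W (Function.update ω (N + j) v) = W ω)
    (haa : ∀ ω q, q ≠ j → a ω q = a' ω q) {S : Set Y} (hS : MeasurableSet S) :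
    ∫⁻ ω, (noisyOutput N b post a ⁻¹' S).indicator W ω ∂tapeLaw ≤
      ∫⁻ ω, (noisyOutput N b post a' ⁻¹' S).indicator
        (fun ω => ENNReal.ofReal (Real.exp (|a ω j - a' ω j| / b)) * W ω) ω ∂tapeLaw := by
  classical
  have hD : Measurable fun ω => ENNReal.ofReal (Real.exp (|a ω j - a' ω j| / b)) := by
    have h1 := measurable_pi_iff.1 ha j
    have h2 := measurable_pi_iff.1 ha' j
    fun_prop
  have m1 := measurable_noisyOutput N b hpost ha hS
  have m2 := measurable_noisyOutput N b hpost ha' hS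
  refine lintegral_tapeLaw_le_of_update (N + j) (hW.indicator m1) ((hD.mul hW).indicator m2)
    fun ω => ?_
  -- With all other cells frozen, the event says that the `j`-th noisy statistic lies in `A`, which
  -- reduces the claim to one-dimensional translation.
  set A : Set ℝ := {y | post ω (fun q => if q = j then y else
    a ω q + b * logit (ω (N + q))) ∈ S} with hA
  have hAm : MeasurableSet A := by
    have hf : Measurable fun (y : ℝ) (q : ℕ) =>
        if q = j then y else a ω q + b * logit (ω (N + q)) := by
      refine measurable_pi_lambda _ fun q => ?_
      by_cases hq : q = j
      · simpa only [hq, if_true] using measurable_id'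
      · simpa only [hq, if_false] using measurable_const
    exact hpost.comp (measurable_const.prodMk hf) hS
  have hZA : ∀ c : ℝ, MeasurableSet {x : unitInterval | c + b * logit x ∈ A} := fun c =>
    (measurable_const.add (measurable_const.mul (measurable_logit.comp measurable_subtype_coe))) hAm
  have key : ∀ (d : (ℕ → unitInterval) → ℕ → ℝ), (∀ ω v, d (Function.update ω (N + j) v) = d ω) →
      (∀ q, q ≠ j → a ω q = d ω q) → ∀ v : unitInterval,
      noisyOutput N b post d (Function.update ω (N + j) v) ∈ S ↔ d ω j + b * logit v ∈ A := by
    intro d hd had v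
    unfold noisyOutput
    rw [hpu, hd, hA, Set.mem_ofPred_eq]
    refine Eq.to_iff (congrArg (fun z => post ω z ∈ S) (funext fun q => ?_))
    by_cases hq : q = j
    · subst hq; simp
    · simp [hq, had q hq]
  have e1 : ∀ v, (noisyOutput N b post a ⁻¹' S).indicator W (Function.update ω (N + j) v) =
      {x : unitInterval | a ω j + b * logit x ∈ A}.indicator (fun _ => W ω) v := by
    intro v
    simp only [Set.indicator, Set.mem_preimage, key a hau (fun _ _ => rfl), hWu, Set.mem_ofPred_eq]
  have e2 : ∀ v, (noisyOutput N b post a' ⁻¹' S).indicator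
      (fun ω => ENNReal.ofReal (Real.exp (|a ω j - a' ω j| / b)) * W ω)
        (Function.update ω (N + j) v) =
      {x : unitInterval | a' ω j + b * logit x ∈ A}.indicator
        (fun _ => ENNReal.ofReal (Real.exp (|a ω j - a' ω j| / b)) * W ω) v := by
    intro v
    simp only [Set.indicator, Set.mem_preimage, key a' hau' (haa ω), hWu, hau, hau',
      Set.mem_ofPred_eq]
  simp only [e1, e2]
  rw [lintegral_indicator_const (hZA _), lintegral_indicator_const (hZA _),
    mul_comm _ (W ω), mul_assoc]
  exact mul_le_mul' le_rfl (volume_logit_shift_le _ _ hb A)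

/-- A hybrid argument: the statistics are exchanged one at a time, and step `j` costs `exp (|a ω j -
a' ω j| / b)`. This factor depends on the tape, so it is carried as a weight under the integral;
only the accumulated product is bounded uniformly, by the total sensitivity. The statistics may
depend on random cells other than the noise cells. -/
theorem tapeLaw_noisyOutput_le (hb : 0 < b) (m : ℕ) {ε : ℝ}
    {a a' : (ℕ → unitInterval) → ℕ → ℝ}
    (hpost : Measurable fun p : _ × _ => post p.1 p.2) (ha : Measurable a) (ha' : Measurable a')
    (hpu : ∀ ω q v, post (Function.update ω (N + q) v) = post ω)
    (hau : ∀ ω q v, a (Function.update ω (N + q) v) = a ω)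
    (hau' : ∀ ω q v, a' (Function.update ω (N + q) v) = a' ω)
    (hoff : ∀ ω q, m ≤ q → a ω q = a' ω q)
    (hsens : ∀ ω, ∑ q ∈ Finset.range m, |a ω q - a' ω q| ≤ ε * b)
    {S : Set Y} (hS : MeasurableSet S) :
    tapeLaw (noisyOutput N b post a ⁻¹' S) ≤
      ENNReal.ofReal (Real.exp ε) * tapeLaw (noisyOutput N b post a' ⁻¹' S) := by
  classical
  set h : ℕ → (ℕ → unitInterval) → ℕ → ℝ := fun j ω q => if q < j then a' ω q else a ω q with hh
  set W : ℕ → (ℕ → unitInterval) → ENNReal := fun j ω =>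
    ENNReal.ofReal (Real.exp (∑ q ∈ Finset.range j, |a ω q - a' ω q| / b)) with hWdef
  have hm : ∀ j, Measurable (h j) := fun j => measurable_pi_lambda _ fun q => by
    by_cases hq : q < j
    · simpa only [hh, hq, if_true] using measurable_pi_iff.1 ha' q
    · simpa only [hh, hq, if_false] using measurable_pi_iff.1 ha q
  have hWm : ∀ j, Measurable (W j) := fun j => by
    have h1 := measurable_pi_iff.1 ha
    have h2 := measurable_pi_iff.1 ha'
    refine ENNReal.measurable_ofReal.comp (Real.measurable_exp.comp ?_)
    refine Finset.measurable_fun_sum _ fun q _ => ?_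
    exact (((h1 q).sub (h2 q)).abs).div_const b
  have hind : ∀ j, tapeLaw (noisyOutput N b post a ⁻¹' S) ≤
      ∫⁻ ω, (noisyOutput N b post (h j) ⁻¹' S).indicator (W j) ω ∂tapeLaw := by
    intro j
    induction j with
    | zero =>
      have h0 : h 0 = a := by funext ω q; simp [hh]
      have hW0 : W 0 = 1 := by funext ω; simp [hWdef]
      rw [h0, hW0, lintegral_indicator_one (measurable_noisyOutput N b hpost ha hS)]
    | succ j ih =>
      refine ih.trans ?_
      have := lintegral_noisyOutput_replace_le (N := N) (post := post) hb j
        hpost (hm j) (hm (j + 1)) (hWm j) (fun ω v => hpu ω j v)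
        (fun ω v => by funext q; simp only [hh, hau, hau'])
        (fun ω v => by funext q; simp only [hh, hau, hau'])
        (fun ω v => by simp only [hWdef, hau, hau'])
        (fun ω q hq => by
          have : q < j + 1 ↔ q < j := by omega
          simp only [hh, this]) hS
      refine this.trans (le_of_eq (lintegral_congr fun ω => ?_))
      have e : ENNReal.ofReal (Real.exp (|h j ω j - h (j + 1) ω j| / b)) * W j ω
          = W (j + 1) ω := by
        simp only [hh, hWdef, lt_irrefl, if_false, Nat.lt_succ_self, if_true]
        rw [← ENNReal.ofReal_mul (Real.exp_pos _).le, ← Real.exp_add, Finset.sum_range_succ,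
          add_comm]
      simp only [Set.indicator, e]
  have hlast : h m = a' := by
    funext ω q
    by_cases hq : q < m
    · simp [hh, hq]
    · simp [hh, hq, hoff ω q (not_lt.1 hq)]
  refine (hind m).trans ?_
  rw [hlast, ← lintegral_indicator_const (measurable_noisyOutput N b hpost ha' hS)]
  refine lintegral_mono fun ω => Set.indicator_le_indicator ?_
  refine ENNReal.ofReal_le_ofReal (Real.exp_le_exp.2 ?_)
  rw [← Finset.sum_div, div_le_iff₀ hb]
  exact hsens ω

end NoisyStatistics

/-! ## Random partitions -/

section Center

variable (g pri : ℕ → ℝ) (r : ℝ) (k : ℕ)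

open Classical in
/-- Among the first `m` candidates `w` with `g w ≤ r`, the first one of least priority; `k` if there
is none. -/
noncomputable def centerUpTo : ℕ → ℕ
  | 0 => k
  | w + 1 =>
    if g w ≤ r ∧ ¬ (centerUpTo w < k ∧ ¬ pri w < pri (centerUpTo w)) then w else centerUpTo w

/-- The cluster of a point whose distances from the `k` candidates are given by `g`. -/
noncomputable def center : ℕ := centerUpTo g pri r k k

theorem centerUpTo_spec {m : ℕ} (hm : m ≤ k) :
    (centerUpTo g pri r k m = k ∧ ∀ w < m, r < g w) ∨
    (centerUpTo g pri r k m < m ∧ g (centerUpTo g pri r k m) ≤ r ∧ ∀ w < m, g w ≤ r →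
      pri (centerUpTo g pri r k m) < pri w ∨
      pri (centerUpTo g pri r k m) = pri w ∧ centerUpTo g pri r k m ≤ w) := by
  induction m with
  | zero => left; simp [centerUpTo]
  | succ m ih =>
    have ih := ih (by omega)
    unfold centerUpTo
    set c := centerUpTo g pri r k m
    split_ifs with h
    · right
      refine ⟨by omega, h.1, fun w hw hwr => ?_⟩
      rcases Nat.lt_succ_iff_lt_or_eq.1 hw with hlt | rfl
      · rcases ih with ⟨-, h2⟩ | ⟨h1, -, h3⟩
        · exact absurd hwr (not_le.2 (h2 w hlt))
        · have h5 : pri m < pri c := by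
            by_contra h6; exact h.2 ⟨by omega, h6⟩
          rcases h3 w hlt hwr with h4 | ⟨h4, -⟩
          · exact Or.inl (h5.trans h4)
          · exact Or.inl (h4 ▸ h5)
      · exact Or.inr ⟨rfl, le_rfl⟩
    · rcases ih with ⟨h1, h2⟩ | ⟨h1, h2, h3⟩
      · left
        refine ⟨h1, fun w hw => ?_⟩
        rcases Nat.lt_succ_iff_lt_or_eq.1 hw with hlt | rfl
        · exact h2 w hlt
        · by_contra h4
          exact h ⟨not_lt.1 h4, fun h5 => by omega⟩
      · right
        refine ⟨by omega, h2, fun w hw hwr => ?_⟩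
        rcases Nat.lt_succ_iff_lt_or_eq.1 hw with hlt | rfl
        · exact h3 w hlt hwr
        · have h4 : ¬ pri w < pri c := fun h5 => h ⟨hwr, fun h6 => h6.2 h5⟩
          rcases lt_or_eq_of_le (not_lt.1 h4) with h5 | h5
          · exact Or.inl h5
          · exact Or.inr ⟨h5, h1.le⟩

theorem center_spec :
    (center g pri r k = k ∧ ∀ w < k, r < g w) ∨
    (center g pri r k < k ∧ g (center g pri r k) ≤ r ∧ ∀ w < k, g w ≤ r →
      pri (center g pri r k) < pri w ∨
      pri (center g pri r k) = pri w ∧ center g pri r k ≤ w) :=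
  centerUpTo_spec g pri r k le_rfl

theorem center_le : center g pri r k ≤ k := by
  rcases center_spec g pri r k with h | h <;> omega

variable {g pri r k}

theorem center_lt_of_le {w : ℕ} (hw : w < k) (h : g w ≤ r) : center g pri r k < k := by
  rcases center_spec g pri r k with h' | h'
  · exact absurd h (not_le.2 (h'.2 w hw))
  · exact h'.1

theorem apply_center_le (h : center g pri r k < k) : g (center g pri r k) ≤ r := by
  rcases center_spec g pri r k with h' | h'
  · omega
  · exact h'.2.1

/-- Two separated points have a witness: a candidate that captures only one of them, and that has
the least priority among all candidates that are at least as close to the pair. -/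
theorem exists_witness_of_center_ne {g' : ℕ → ℝ}
    (hne : center g pri r k ≠ center g' pri r k) :
    ∃ w < k, min (g w) (g' w) ≤ r ∧ r < max (g w) (g' w) ∧
      ∀ w' < k, min (g w') (g' w') ≤ min (g w) (g' w) → pri w ≤ pri w' := by
  -- The center of `f` is a witness once it misses `f'` and beats every candidate that captures
  -- `f'`: anything at least as close to the pair captures one of the two points.
  have aux : ∀ f f' : ℕ → ℝ, center f pri r k < k → r < f' (center f pri r k) →
      (∀ w' < k, f' w' ≤ r → pri (center f pri r k) ≤ pri w') →
      ∃ w < k, min (f w) (f' w) ≤ r ∧ r < max (f w) (f' w) ∧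
      ∀ w' < k, min (f w') (f' w') ≤ min (f w) (f' w) → pri w ≤ pri w' := by
    intro f f' hk h1 h2
    have hs := center_spec f pri r k
    rcases hs with hs | ⟨-, hs1, hs2⟩
    · omega
    refine ⟨_, hk, (min_le_left _ _).trans hs1, lt_max_of_lt_right h1, fun w' hw' hm => ?_⟩
    have hm' := hm.trans ((min_le_left _ _).trans hs1)
    rcases min_le_iff.1 hm' with h3 | h3
    · rcases hs2 w' hw' h3 with h4 | h4
      · exact h4.le
      · exact h4.1.le
    · exact h2 w' hw' h3
  rcases center_spec g pri r k with ⟨h1, h2⟩ | ⟨h1, h2, h3⟩ <;>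
  rcases center_spec g' pri r k with ⟨h1', h2'⟩ | ⟨h1', h2', h3'⟩
  · exact absurd (h1.trans h1'.symm) hne
  · obtain ⟨w, hw⟩ := aux g' g h1' (h2 _ h1') fun w hw hwr => absurd hwr (not_le.2 (h2 w hw))
    exact ⟨w, by simpa only [min_comm, max_comm] using hw⟩
  · exact aux g g' h1 (h2' _ h1) fun w hw hwr => absurd hwr (not_le.2 (h2' w hw))
  · have hle : ∀ {p q : ℝ} {P : Prop}, p < q ∨ p = q ∧ P → p ≤ q := by
      rintro p q P (h | h)
      exacts [h.le, h.1.le]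
    by_cases hA : r < g' (center g pri r k) ∧
        pri (center g pri r k) ≤ pri (center g' pri r k)
    · exact aux g g' h1 hA.1 fun w hw hwr => hA.2.trans (hle (h3' w hw hwr))
    by_cases hB : r < g (center g' pri r k) ∧
        pri (center g' pri r k) ≤ pri (center g pri r k)
    · obtain ⟨w, hw⟩ := aux g' g h1' hB.1 fun w hw hwr => hB.2.trans (hle (h3 w hw hwr))
      exact ⟨w, by simpa only [min_comm, max_comm] using hw⟩
    -- Neither center is a witness, so the one of smaller priority captures both points. Then the
    -- priorities are equal, and the tie-break by index makes the centers coincide.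
    exfalso
    have h4 := h3' _ h1
    have h5 := h3 _ h1'
    generalize center g pri r k = c at *
    generalize center g' pri r k = c' at *
    rcases lt_trichotomy (pri c) (pri c') with h | h | h
    · have := hle (h4 (not_lt.1 fun h6 => hA ⟨h6, h.le⟩)); linarith
    · have h6 := h4 (not_lt.1 fun h6 => hA ⟨h6, h.le⟩)
      have h7 := h5 (not_lt.1 fun h6 => hB ⟨h6, h.ge⟩)
      rcases h6 with h6 | h6
      · linarith
      rcases h7 with h7 | h7
      · linarith
      omega
    · have := hle (h5 (not_lt.1 fun h6 => hB ⟨h6, h.le⟩)); linarith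

end Center

/-! ## Elementary estimates -/

/-- Induction by adding an element of largest value: its rank is the full cardinality, and the ranks
of the others cannot decrease. Ties only increase ranks, hence the inequality. -/
theorem sum_inv_card_filter_le_harmonic {ι : Type*} (f : ι → ℝ) (s : Finset ι) :
    ∑ w ∈ s, (1 : ℝ) / (s.filter fun w' => f w' ≤ f w).card ≤
      ∑ i ∈ Finset.range s.card, (1 : ℝ) / (i + 1) := by
  classical
  refine Finset.induction_on_max_value f s ?_ ?_
  · simp
  · intro a s ha hmax ih
    rw [Finset.sum_insert ha, Finset.card_insert_of_notMem ha, Finset.sum_range_succ, add_comm]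
    have h1 : ((insert a s).filter fun w' => f w' ≤ f a) = insert a s := by
      refine Finset.filter_true_of_mem fun x hx => ?_
      rcases Finset.mem_insert.1 hx with rfl | hx
      exacts [le_rfl, hmax x hx]
    rw [h1, Finset.card_insert_of_notMem ha]
    push_cast
    refine add_le_add_left ((Finset.sum_le_sum fun w hw => ?_).trans ih) _
    refine one_div_le_one_div_of_le ?_ ?_
    · have : 0 < (s.filter fun w' => f w' ≤ f w).card :=
        Finset.card_pos.2 ⟨w, Finset.mem_filter.2 ⟨hw, le_refl (f w)⟩⟩
      exact_mod_cast this
    · exact_mod_cast Finset.card_le_card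
        (Finset.filter_subset_filter _ (Finset.subset_insert a s))

theorem sum_one_div_succ_le (k : ℕ) :
    ∑ i ∈ Finset.range k, (1 : ℝ) / (i + 1) ≤ 1 + Real.log k := by
  have := harmonic_le_one_add_log k
  simpa [harmonic, one_div] using this

/-- A uniformly random dilation of the scale `s` by a factor in `[1, 2]` rarely falls into
`[a, b)`. -/
theorem volume_dilation_mem_Ico_le {a b s : ℝ} (hs : 0 < s) (hab : a ≤ b) :
    ENNReal.ofReal s * (volume : Measure unitInterval) {v | a ≤ (1 + v) * s ∧ (1 + v) * s < b} ≤
      ENNReal.ofReal ((min b (2 * s) - min b s) - (min a (2 * s) - min a s)) := by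
  have hsub : Subtype.val '' {v : unitInterval | a ≤ (1 + v) * s ∧ (1 + v) * s < b} ⊆
      Set.Icc (max 0 (a / s - 1)) (min 1 (b / s - 1)) := by
    rintro _ ⟨v, ⟨h1, h2⟩, rfl⟩
    refine ⟨max_le v.2.1 ?_, le_min v.2.2 ?_⟩
    · rw [sub_le_iff_le_add, div_le_iff₀ hs]; linarith
    · rw [le_sub_iff_add_le, le_div_iff₀ hs]; linarith
  rw [unitInterval.volume_apply]
  refine (mul_le_mul' le_rfl (measure_mono hsub)).trans ?_
  rw [Real.volume_Icc, ← ENNReal.ofReal_mul hs.le]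
  refine ENNReal.ofReal_le_ofReal ?_
  -- The function `x ↦ min x (2 * s) - min x s` measures the part of `[s, 2 * s]` below `x`, so the
  -- target is the length of `[a, b] ∩ [s, 2 * s]`.
  rw [mul_sub, mul_min_of_nonneg _ _ hs.le, mul_max_of_nonneg _ _ hs.le, mul_sub, mul_sub,
    mul_div_cancel₀ _ hs.ne', mul_div_cancel₀ _ hs.ne']
  rcases le_total (s * 1) (b - s * 1) with h1 | h1 <;>
  rcases le_total (s * 0) (a - s * 1) with h2 | h2 <;>
  rcases le_total b (2 * s) with h3 | h3 <;> rcases le_total b s with h4 | h4 <;>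
  rcases le_total a (2 * s) with h5 | h5 <;> rcases le_total a s with h6 | h6 <;>
  simp only [min_eq_left, min_eq_right, max_eq_left, max_eq_right, h1, h2, h3, h4, h5, h6] <;>
  linarith

/-- Twice each scale is the preceding one, so the sum telescopes. -/
theorem sum_min_two_mul_sub_min (t Δ : ℝ) (L : ℕ) :
    ∑ i ∈ Finset.range L, (min t (2 * (Δ / 2 ^ i)) - min t (Δ / 2 ^ i)) =
      min t (2 * Δ) - min t (2 * (Δ / 2 ^ L)) := by
  induction L with
  | zero => simp
  | succ L ih =>
    have : 2 * (Δ / 2 ^ (L + 1)) = Δ / 2 ^ L := by rw [pow_succ]; field_simp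
    rw [Finset.sum_range_succ, ih, this]
    ring

/-- The radius intervals of different dyadic scales do not overlap, so together they see each part
of `[a, b)` at most once. This keeps the number of levels out of the final distortion. -/
theorem sum_dilation_le {a b Δ : ℝ} (hΔ : 0 < Δ) (hab : a ≤ b) (L : ℕ) :
    ∑ i ∈ Finset.range L, ENNReal.ofReal (Δ / 2 ^ i) * (volume : Measure unitInterval)
      {v | a ≤ (1 + v) * (Δ / 2 ^ i) ∧ (1 + v) * (Δ / 2 ^ i) < b} ≤ ENNReal.ofReal (b - a) := by
  have hnn : ∀ s : ℝ, 0 < s → 0 ≤ (min b (2 * s) - min b s) - (min a (2 * s) - min a s) := by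
    intro s hs
    rcases le_total b (2 * s) with h3 | h3 <;> rcases le_total b s with h4 | h4 <;>
    rcases le_total a (2 * s) with h5 | h5 <;> rcases le_total a s with h6 | h6 <;>
    simp only [min_eq_left, min_eq_right, h3, h4, h5, h6] <;> linarith
  refine (Finset.sum_le_sum fun i _ => volume_dilation_mem_Ico_le (by positivity) hab).trans ?_
  rw [← ENNReal.ofReal_sum_of_nonneg fun i _ => hnn _ (by positivity)]
  refine ENNReal.ofReal_le_ofReal ?_
  rw [Finset.sum_sub_distrib, sum_min_two_mul_sub_min, sum_min_two_mul_sub_min]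
  have h1 : min b (2 * Δ) - min a (2 * Δ) ≤ b - a := by
    rcases le_total b (2 * Δ) with h | h <;> rcases le_total a (2 * Δ) with h' | h' <;>
    simp only [min_eq_left, min_eq_right, h, h'] <;> linarith
  have h2 : min a (2 * (Δ / 2 ^ L)) ≤ min b (2 * (Δ / 2 ^ L)) := min_le_min_right _ hab
  linarith

/-- If `P` is forced on the last level, its term makes up for the halving of the remainder.
Otherwise `d` is already at most `4` times that scale and the remainder alone suffices. -/
theorem le_sum_scales {d Δ : ℝ} (hd : d ≤ Δ) (hΔ : 0 ≤ Δ) (P : ℕ → Prop) [DecidablePred P]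
    (L : ℕ) (hP : ∀ i < L, 4 * (Δ / 2 ^ i) < d → P i) :
    d / 8 ≤ ∑ i ∈ Finset.range L, (Δ / 2 ^ i) * (if P i then 1 else 0) + Δ / 2 ^ L := by
  induction L with
  | zero => simp; linarith
  | succ L ih =>
    have ih := ih fun i hi => hP i (by omega)
    have e : 2 * (Δ / 2 ^ (L + 1)) = Δ / 2 ^ L := by rw [pow_succ]; field_simp
    have hn : 0 ≤ Δ / 2 ^ L := by positivity
    rw [Finset.sum_range_succ]
    by_cases h : 4 * (Δ / 2 ^ L) < d
    · rw [if_pos (hP L (by omega) h)]; linarith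
    · have : 0 ≤ ∑ i ∈ Finset.range L, (Δ / 2 ^ i) * (if P i then (1 : ℝ) else 0) :=
        Finset.sum_nonneg fun i _ => by positivity
      have h2 : 0 ≤ Δ / 2 ^ L * (if P L then (1 : ℝ) else 0) := by positivity
      linarith

theorem sum_scales_le {Δ : ℝ} (hΔ : 0 ≤ Δ) (L : ℕ) :
    ∑ i ∈ Finset.range L, Δ / 2 ^ i ≤ 2 * Δ := by
  have : ∑ i ∈ Finset.range L, Δ / 2 ^ i = 2 * Δ - 2 * (Δ / 2 ^ L) := by
    induction L with
    | zero => simp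
    | succ L ih =>
      have e : 2 * (Δ / 2 ^ (L + 1)) = Δ / 2 ^ L := by rw [pow_succ]; field_simp
      rw [Finset.sum_range_succ, ih]; linarith
  have h2 : 0 ≤ Δ / 2 ^ L := by positivity
  linarith

/-! ## Reasoning about programs -/

namespace Prog

/-- The natural number arrays written by a program. -/
def natWrites : Prog → List ℕ
  | skip => []
  | setNat a _ _ => [a]
  | setReal _ _ _ => []
  | draw _ _ => []
  | seq p q => p.natWrites ++ q.natWrites
  | ite _ p q => p.natWrites ++ q.natWrites
  | loop v _ p => v :: p.natWrites

/-- The real arrays written by a program. -/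
def realWrites : Prog → List ℕ
  | skip => []
  | setNat _ _ _ => []
  | setReal a _ _ => [a]
  | draw a _ => [a]
  | seq p q => p.realWrites ++ q.realWrites
  | ite _ p q => p.realWrites ++ q.realWrites
  | loop _ _ p => p.realWrites

end Prog

theorem iterateSteps_induction {S : Type} {f : ℕ → S → S} (P : ℕ → S → Prop) {m : ℕ} {s : S}
    (h0 : P 0 s) (hs : ∀ i < m, ∀ t, P i t → P (i + 1) (f i t)) : P m (iterateSteps f m s) := by
  induction m with
  | zero => exact h0
  | succ m ih => exact hs m (by omega) _ (ih fun i hi => hs i (by omega))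

namespace Prog

variable (I : Input) (ω : ℕ → unitInterval)

theorem exec_nats_of_notMem {a : ℕ} (p : Prog) (ha : a ∉ p.natWrites) (s : State) :
    (p.exec I ω s).nats a = s.nats a := by
  induction p generalizing s with
  | skip => rfl
  | setNat b i e =>
    have : a ≠ b := by simpa [natWrites] using ha
    simp [exec, State.setNat, this]
  | setReal b i e => rfl
  | draw b i => rfl
  | seq p q ihp ihq =>
    simp only [natWrites, List.mem_append, not_or] at ha
    rw [exec, ihq ha.2, ihp ha.1]
  | ite b p q ihp ihq =>
    simp only [natWrites, List.mem_append, not_or] at ha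
    rw [exec]; split_ifs
    exacts [ihp ha.1 s, ihq ha.2 s]
  | loop v e p ih =>
    simp only [natWrites, List.mem_cons, not_or] at ha
    rw [exec]
    refine iterateSteps_induction (fun _ (t : State) => t.nats a = s.nats a) rfl fun i _ t ht => ?_
    rw [ih ha.2]
    simp [State.setNat, ha.1, ht]

theorem exec_reals_of_notMem {a : ℕ} (p : Prog) (ha : a ∉ p.realWrites) (s : State) :
    (p.exec I ω s).reals a = s.reals a := by
  induction p generalizing s with
  | skip => rfl
  | setNat b i e => rfl
  | setReal b i e =>
    have : a ≠ b := by simpa [realWrites] using ha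
    simp [exec, State.setReal, this]
  | draw b i =>
    have : a ≠ b := by simpa [realWrites] using ha
    simp [exec, State.setReal, this]
  | seq p q ihp ihq =>
    simp only [realWrites, List.mem_append, not_or] at ha
    rw [exec, ihq ha.2, ihp ha.1]
  | ite b p q ihp ihq =>
    simp only [realWrites, List.mem_append, not_or] at ha
    rw [exec]; split_ifs
    exacts [ihp ha.1 s, ihq ha.2 s]
  | loop v e p ih =>
    simp only [realWrites] at ha
    rw [exec]
    refine iterateSteps_induction (fun _ (t : State) => t.reals a = s.reals a) rfl fun i _ t ht => ?_
    rw [ih ha]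
    exact ht

/-- Loop invariants; the arrays that are not written keep their contents. -/
theorem exec_loop_induction (v : ℕ) (e : NExp) (p : Prog) (s : State) (Q : ℕ → State → Prop)
    (h0 : Q 0 s)
    (hstep : ∀ i < e.eval I s, ∀ t : State, (∀ a, a ∉ v :: p.natWrites → t.nats a = s.nats a) →
      (∀ a, a ∉ p.realWrites → t.reals a = s.reals a) → Q i t →
      Q (i + 1) (p.exec I ω (t.setNat v 0 i))) :
    Q (e.eval I s) ((loop v e p).exec I ω s) := by
  rw [exec]
  refine (iterateSteps_induction (fun i t => (∀ a, a ∉ v :: p.natWrites → t.nats a = s.nats a) ∧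
    (∀ a, a ∉ p.realWrites → t.reals a = s.reals a) ∧ Q i t) ⟨fun _ _ => rfl, fun _ _ => rfl, h0⟩
    fun i hi t ht => ⟨fun a ha => ?_, fun a ha => ?_, hstep i hi t ht.1 ht.2.1 ht.2.2⟩).2.2
  · have ha' := ha
    simp only [List.mem_cons, not_or] at ha
    rw [exec_nats_of_notMem I ω p ha.2, ← ht.1 a ha']
    simp [State.setNat, ha.1]
  · rw [exec_reals_of_notMem I ω p ha, ← ht.2.1 a ha]
    rfl

end Prog

/-! ## Polynomial running time -/

/-- Expressions whose values are bounded by a polynomial in the sizes of the input. -/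
def NExp.Poly : NExp → Prop
  | const _ => True
  | numData => True
  | numQueries => True
  | load _ _ => False
  | add e f => e.Poly ∧ f.Poly
  | sub e _ => e.Poly
  | mul e f => e.Poly ∧ f.Poly

/-- Programs all of whose loops have polynomially many rounds. -/
def Prog.Poly : Prog → Prop
  | skip => True
  | setNat _ _ _ => True
  | setReal _ _ _ => True
  | draw _ _ => True
  | seq p q => p.Poly ∧ q.Poly
  | ite _ p q => p.Poly ∧ q.Poly
  | loop _ e p => e.Poly ∧ p.Poly

theorem mul_pow_le_mul_pow {A B N : ℕ} (h : A ≤ B) (hN : 1 ≤ N) : A * N ^ A ≤ B * N ^ B :=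
  Nat.mul_le_mul h (Nat.pow_le_pow_right hN h)

theorem add_le_mul_pow {a b A B N : ℕ} (ha : a ≤ A * N ^ A) (hb : b ≤ B * N ^ B) (hN : 1 ≤ N) :
    a + b ≤ (A + B) * N ^ (A + B) := by
  calc a + b ≤ A * N ^ (A + B) + B * N ^ (A + B) :=
        add_le_add (ha.trans (Nat.mul_le_mul_left _ (Nat.pow_le_pow_right hN (by omega))))
          (hb.trans (Nat.mul_le_mul_left _ (Nat.pow_le_pow_right hN (by omega))))
    _ = _ := by ring

theorem mul_le_mul_pow {a b A B N : ℕ} (ha : a ≤ A * N ^ A) (hb : b ≤ B * N ^ B) (hN : 1 ≤ N) :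
    a * b ≤ (A * B + A + B) * N ^ (A * B + A + B) := by
  calc a * b ≤ (A * N ^ A) * (B * N ^ B) := Nat.mul_le_mul ha hb
    _ = (A * B) * N ^ (A + B) := by ring
    _ ≤ _ := Nat.mul_le_mul (by omega) (Nat.pow_le_pow_right hN (by nlinarith [Nat.zero_le (A * B)]))

theorem le_mul_pow_self (a : ℕ) {N : ℕ} (hN : 1 ≤ N) : a ≤ a * N ^ a :=
  Nat.le_mul_of_pos_right _ (Nat.pow_pos hN)

/-- Memory loads are excluded because cells can hold arbitrary numbers; truncated subtraction is
harmless since it is bounded by its first argument. -/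
theorem NExp.exists_eval_le (e : NExp) (he : e.Poly) : ∃ A : ℕ, ∀ (I : Input) (s : State),
    1 ≤ I.numData + I.numQueries →
      e.eval I s ≤ A * (I.numData + I.numQueries) ^ A := by
  induction e with
  | const m => exact ⟨m, fun I s h => le_mul_pow_self m h⟩
  | numData => exact ⟨1, fun I s h => by simp [eval]⟩
  | numQueries => exact ⟨1, fun I s h => by simp [eval]⟩
  | load a i => exact he.elim
  | add e f ihe ihf =>
    obtain ⟨A, hA⟩ := ihe he.1
    obtain ⟨B, hB⟩ := ihf he.2
    exact ⟨_, fun I s h => add_le_mul_pow (hA I s h) (hB I s h) h⟩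
  | sub e f ihe =>
    obtain ⟨A, hA⟩ := ihe he
    exact ⟨A, fun I s h => (Nat.sub_le _ _).trans (hA I s h)⟩
  | mul e f ihe ihf =>
    obtain ⟨A, hA⟩ := ihe he.1
    obtain ⟨B, hB⟩ := ihf he.2
    exact ⟨_, fun I s h => mul_le_mul_pow (hA I s h) (hB I s h) h⟩

theorem Prog.exists_cost_le (p : Prog) (hp : p.Poly) :
    ∃ A : ℕ, ∀ (I : Input) (ω : ℕ → unitInterval) (s : State),
      1 ≤ I.numData + I.numQueries →
        p.cost I ω s ≤ A * (I.numData + I.numQueries) ^ A := by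
  induction p with
  | skip => exact ⟨1, fun I ω s h => le_mul_pow_self 1 h⟩
  | setNat a i e => exact ⟨_, fun I ω s h => le_mul_pow_self (1 + i.size + e.size) h⟩
  | setReal a i e => exact ⟨_, fun I ω s h => le_mul_pow_self (1 + i.size + e.size) h⟩
  | draw a i => exact ⟨_, fun I ω s h => le_mul_pow_self (1 + i.size) h⟩
  | seq p q ihp ihq =>
    obtain ⟨A, hA⟩ := ihp hp.1
    obtain ⟨B, hB⟩ := ihq hp.2
    exact ⟨_, fun I ω s h => add_le_mul_pow (hA I ω s h) (hB I ω _ h) h⟩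
  | ite b p q ihp ihq =>
    obtain ⟨A, hA⟩ := ihp hp.1
    obtain ⟨B, hB⟩ := ihq hp.2
    refine ⟨_, fun I ω s h => add_le_mul_pow (le_mul_pow_self (1 + b.size) h) (B := A + B) ?_ h⟩
    split_ifs
    · exact (hA I ω s h).trans (mul_pow_le_mul_pow (by omega) h)
    · exact (hB I ω s h).trans (mul_pow_le_mul_pow (by omega) h)
  | loop v e p ih =>
    obtain ⟨A, hA⟩ := e.exists_eval_le hp.1
    obtain ⟨B, hB⟩ := ih hp.2
    refine ⟨(1 + e.size) + (A * (1 + B) + A + (1 + B)), fun I ω s h => ?_⟩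
    have h1 : ∑ m ∈ Finset.range (e.eval I s), (1 + p.cost I ω
        ((iterateSteps (fun i t => p.exec I ω (t.setNat v 0 i)) m s).setNat v 0 m)) ≤
        e.eval I s * ((1 + B) * (I.numData + I.numQueries) ^ (1 + B)) := by
      refine (Finset.sum_le_card_nsmul _ _ _ fun m _ =>
        add_le_mul_pow (le_mul_pow_self 1 h) (hB I ω _ h) h).trans (le_of_eq ?_)
      rw [Finset.card_range, smul_eq_mul]
    exact add_le_mul_pow (le_mul_pow_self (1 + e.size) h)
      (h1.trans (mul_le_mul_pow (hA I s h) le_rfl h)) h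

/-! ## The program -/

namespace DistanceProgram

/-- The first cell of a natural number array. -/
abbrev var (a : ℕ) : NExp := .load a (.const 0)

/-- The first cell of a real array. -/
abbrev rvar (a : ℕ) : RExp := .load a (.const 0)

abbrev nat (m : ℕ) : RExp := .ofNat (.const m)

/-- Tape position of the priority of candidate `w` in the trial stored in variable `5`. -/
abbrev priorityPos (w : NExp) : NExp :=
  .add (.mul (var 5) (.add .numQueries (.const 1))) w

/-- Stores the cluster of the point with index `pt` in variable `c`. -/
def centerProg (c : ℕ) (pt : NExp) : Prog :=
  .seq (.setNat c (.const 0) .numQueries)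
    (.loop 10 .numQueries
      (.ite (.conj
          (.neg (.realLt
            (.mul (.add (nat 1) (.load 1 (priorityPos .numQueries))) (rvar 2))
            (.oracle pt (.add .numData (var 10)))))
          (.neg (.conj (.natLt (var c) .numQueries)
            (.neg (.realLt (.load 1 (priorityPos (var 10))) (.load 1 (priorityPos (var c))))))))
        (.setNat c (.const 0) (var 10)) .skip))

/-- The number of trials, in a form that makes it polynomially bounded. -/
abbrev trialsExp : NExp :=
  .sub (.mul (.const 3) .numQueries) (.sub (.mul (.const 3) .numQueries) (var 1))

/-- Logistic noise from the tape cell `i`. -/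
abbrev noiseExp (i : NExp) : RExp :=
  .log (.div (.load 1 i) (.sub (nat 1) (.load 1 i)))

/-- Tape position of the noise for the cluster in variable `8`. -/
abbrev noisePos : NExp :=
  .add (.mul (.mul (.const 3) .numQueries) (.add .numQueries (.const 1)))
    (.add (.mul (.add (.mul (var 5) (.mul (.const 8) (var 1))) (var 6))
      (.add .numQueries (.const 1))) (var 8))

/-- Adds to the real variable `3` the number of data points in the cluster in variable `8`. -/
def countProg : Prog :=
  .loop 7 .numData
    (.seq (centerProg 9 (var 7))
      (.ite (.conj (.neg (.natLt (var 8) (var 9))) (.neg (.natLt (var 9) (var 8))))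
        (.setReal 3 (.const 0) (.add (rvar 3) (nat 1))) .skip))

/-- The contribution of one level to the estimate in the real variable `4`. -/
def levelProg : Prog :=
  .seq (centerProg 8 (.add .numData (var 4)))
  (.seq (.setReal 3 (.const 0) (nat 0))
  (.seq countProg
  (.seq (.setReal 4 (.const 0) (.add (rvar 4) (.mul (rvar 2) (.sub (nat 1)
      (.div (.add (rvar 3) (.mul (.div (.ofNat (.mul (.const 16) (.mul (var 1) (var 1)))) .eps)
        (noiseExp noisePos))) (.ofNat .numData))))))
    (.setReal 2 (.const 0) (.div (rvar 2) (nat 2))))))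

/-- One trial for the query in variable `4`; the least estimate is kept in the real variable `5`. -/
def trialProg : Prog :=
  .seq (.setReal 4 (.const 0) (nat 0))
  (.seq (.setReal 2 (.const 0) .diam)
  (.seq (.loop 6 (.mul (.const 8) trialsExp) levelProg)
    (.ite (.conj (.natLt (.const 0) (var 5)) (.neg (.realLt (rvar 4) (rvar 5)))) .skip
      (.setReal 5 (.const 0) (rvar 4)))))

/-- The divisor `9` is `3` from Markov's inequality times `3` from `1 + log k ≤ 3 * log (k + 1)`;
after dividing, the upper bound has leading factor `1`. -/
def treeProg : Prog :=
  .loop 4 .numQueries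
    (.seq (.setReal 5 (.const 0) (nat 0))
    (.seq (.loop 5 trialsExp trialProg)
      (.setReal 0 (var 4) (.div (rvar 5)
        (.mul (nat 9) (.log (.ofNat (.add .numQueries (.const 1)))))))))

/-- One data point moves each of the `k` sums by at most `Δ`, hence the noise scale `k * Δ / ε`
before dividing by `n`. -/
def naiveProg : Prog :=
  .loop 4 .numQueries
    (.seq (.setReal 3 (.const 0) (nat 0))
    (.seq (.loop 7 .numData (.setReal 3 (.const 0)
        (.add (rvar 3) (.oracle (var 7) (.add .numData (var 4))))))
      (.setReal 0 (var 4) (.div (.add (rvar 3)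
        (.mul (.div (.mul (.ofNat .numQueries) .diam) .eps) (noiseExp (var 4))))
        (.ofNat .numData)))))

/-- The number of random reals needed. -/
abbrev drawsExp : NExp :=
  .add (.mul (.mul (.const 3) .numQueries) (.add .numQueries (.const 1)))
    (.mul (.mul (.const 72) (.mul .numQueries .numQueries)) (.add .numQueries (.const 1)))

def drawProg : Prog := .loop 2 drawsExp (.draw 1 (var 2))

/-- A ceiling computed without a floor operation: the last counter value `i` below the logarithm
leaves `i + 1` in variable `1`. The bound `3 * k` keeps the loop polynomial. -/
def trialsProg : Prog :=
  .loop 3 (.mul (.const 3) .numQueries)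
    (.ite (.realLt (.ofNat (var 3)) (.log (.div (.mul (nat 2) (.ofNat .numQueries)) .beta)))
      (.setNat 1 (.const 0) (.add (var 3) (.const 1))) .skip)

/-- The tests involve only `n`, `k`, `ε` and `β`, so the choice of branch reveals nothing about the
data. The fifth power is the point where `k / (n * ε)` reaches `(n * ε) ^ (-4/5)`. -/
def prog : Prog :=
  .seq drawProg
  (.seq trialsProg
    (.ite (.realLt (.mul (.ofNat .numData) .eps) (nat 1)) .skip
    (.ite (.conj
        (.realLt (.mul (.ofNat .numData) .eps) (.ofNat (.mul (.mul .numQueries .numQueries)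
          (.mul .numQueries (.mul .numQueries .numQueries)))))
        (.realLt (.log (.div (nat 1) .beta)) (.ofNat .numQueries)))
      treeProg naiveProg)))

theorem prog_poly : prog.Poly := by
  simp [prog, drawProg, trialsProg, treeProg, naiveProg, trialProg, levelProg, countProg,
    centerProg, Prog.Poly, NExp.Poly]

end DistanceProgram

/-! ## What the program computes -/

namespace DistanceProgram

section Semantics

variable (I : Input) (u : ℕ → ℝ)

/-- The cluster of the point with index `p` in trial `t` at scale `s`. -/
noncomputable def cluster (t : ℕ) (s : ℝ) (p : ℕ) : ℕ :=
  center (fun w => I.oracle p (I.numData + w)) (fun w => u (t * (I.numQueries + 1) + w))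
    ((1 + u (t * (I.numQueries + 1) + I.numQueries)) * s) I.numQueries

/-- The number of data points in the cluster `c`. -/
noncomputable def clusterCount (t : ℕ) (s : ℝ) (c : ℕ) : ℝ :=
  ∑ x ∈ Finset.range I.numData, if cluster I u t s x = c then 1 else 0

/-- Tape position of the first noise cell. -/
def noiseStart : ℕ := 3 * I.numQueries * (I.numQueries + 1)

/-- The estimate of one level, with noise `z`. -/
noncomputable def levelEstimate (T t : ℕ) (z : ℕ → ℝ) (j i : ℕ) : ℝ :=
  I.diam / 2 ^ i * (1 - (clusterCount I u t (I.diam / 2 ^ i)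
    (cluster I u t (I.diam / 2 ^ i) (I.numData + j)) +
    ((16 * (T * T) : ℕ) : ℝ) / I.eps * z ((t * (8 * T) + i) * (I.numQueries + 1) +
      cluster I u t (I.diam / 2 ^ i) (I.numData + j))) / I.numData)

noncomputable def trialEstimate (T : ℕ) (z : ℕ → ℝ) (j t : ℕ) : ℝ :=
  ∑ i ∈ Finset.range (8 * T), levelEstimate I u T t z j i

/-- The least of the values `f 0, …, f (m - 1)`. -/
noncomputable def minUpTo (f : ℕ → ℝ) : ℕ → ℝ
  | 0 => 0
  | m + 1 => if 0 < m then min (minUpTo f m) (f m) else f m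

noncomputable def numTrials : ℕ :=
  min (3 * I.numQueries) ⌈Real.log (2 * I.numQueries / I.beta)⌉₊

noncomputable def treeAnswer (z : ℕ → ℝ) (j : ℕ) : ℝ :=
  minUpTo (trialEstimate I u (numTrials I) z j) (numTrials I) /
    (9 * Real.log ((I.numQueries + 1 : ℕ) : ℝ))

noncomputable def naiveAnswer (z : ℕ → ℝ) (j : ℕ) : ℝ :=
  (∑ x ∈ Finset.range I.numData, I.oracle x (I.numData + j) +
    I.numQueries * I.diam / I.eps * z j) / I.numData

variable {I} {ω : ℕ → unitInterval}

theorem centerProg_spec {c P : ℕ} {pt : NExp} {s : State} (hc : c = 8 ∨ c = 9)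
    (hpt : ∀ t : State, (∀ a, a ∉ [10, c] → t.nats a = s.nats a) → pt.eval I t = P) :
    ((centerProg c pt).exec I ω s).nats c 0 =
      cluster I (s.reals 1) (s.nats 5 0) (s.reals 2 0) P := by
  have h5 : (5 : ℕ) ≠ c := by omega
  have hc10 : c ≠ 10 := by omega
  rw [centerProg, Prog.exec, Prog.exec]
  refine Prog.exec_loop_induction I ω _ _ _ _ (fun i t => t.nats c 0 = centerUpTo
    (fun w => I.oracle P (I.numData + w)) (fun w => s.reals 1 (s.nats 5 0 * (I.numQueries + 1) + w))
    ((1 + s.reals 1 (s.nats 5 0 * (I.numQueries + 1) + I.numQueries)) * s.reals 2 0)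
    I.numQueries i) ?_ ?_
  · simp [State.setNat, NExp.eval, centerUpTo]
  · intro i _ t ht1 ht2 hq
    have hn : ∀ a, a ≠ c → a ≠ 10 → t.nats a = s.nats a := by
      intro a hac ha10
      rw [ht1 a (by simp [Prog.natWrites, hac, ha10])]
      simp [State.setNat, hac]
    have hr : ∀ a, t.reals a = s.reals a := fun a => ht2 a (by simp [Prog.realWrites])
    have hP : pt.eval I (t.setNat 10 0 i) = P := by
      refine hpt _ fun a ha => ?_
      simp only [List.mem_cons, List.not_mem_nil, or_false, not_or] at ha
      rw [← hn a ha.2 ha.1]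
      simp [State.setNat, ha.1]
    rw [Prog.exec, centerUpTo, ← hq]
    have e5 : (t.setNat 10 0 i).nats 5 0 = s.nats 5 0 := by
      rw [← hn 5 h5 (by omega)]; simp [State.setNat]
    have e10 : (t.setNat 10 0 i).nats 10 0 = i := by simp [State.setNat]
    have ec : (t.setNat 10 0 i).nats c 0 = t.nats c 0 := by simp [State.setNat, hc10]
    have er : ∀ a, (t.setNat 10 0 i).reals a = s.reals a := hr
    simp only [BExp.holds, RExp.eval, NExp.eval, e5, e10, ec, er, hP, Nat.cast_one, not_lt,
      Prog.exec]
    split_ifs with h1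
    · simp [State.setNat]
    · exact ec

theorem countProg_spec (s : State) :
    ((countProg).exec I ω s).reals 3 0 = s.reals 3 0 +
      clusterCount I (s.reals 1) (s.nats 5 0) (s.reals 2 0) (s.nats 8 0) := by
  rw [countProg]
  refine Prog.exec_loop_induction I ω _ _ _ _ (fun i t => t.reals 3 0 = s.reals 3 0 +
    ∑ x ∈ Finset.range i, if cluster I (s.reals 1) (s.nats 5 0) (s.reals 2 0) x = s.nats 8 0
      then 1 else 0) (by simp) ?_
  intro i _ t ht1 ht2 hq
  have hc := centerProg_spec (I := I) (ω := ω) (c := 9) (P := i) (pt := var 7)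
    (s := t.setNat 7 0 i) (Or.inr rfl) (fun t' ht' => by
      simp only [NExp.eval]
      rw [ht' 7 (by simp)]; simp [State.setNat])
  have e5 : (t.setNat 7 0 i).nats 5 0 = s.nats 5 0 := by
    rw [← ht1 5 (by simp [Prog.natWrites, centerProg])]; simp [State.setNat]
  have e1 : (t.setNat 7 0 i).reals 1 = s.reals 1 := ht2 1 (by simp [Prog.realWrites, centerProg])
  have e2 : (t.setNat 7 0 i).reals 2 = s.reals 2 := ht2 2 (by simp [Prog.realWrites, centerProg])
  rw [e5, e1, e2] at hc
  have h8 : ((centerProg 9 (var 7)).exec I ω (t.setNat 7 0 i)).nats 8 = s.nats 8 := by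
    rw [Prog.exec_nats_of_notMem I ω _ (by simp [Prog.natWrites, centerProg]),
      ← ht1 8 (by simp [Prog.natWrites, centerProg])]
    simp [State.setNat]
  have h3 : ((centerProg 9 (var 7)).exec I ω (t.setNat 7 0 i)).reals 3 = t.reals 3 := by
    rw [Prog.exec_reals_of_notMem I ω _ (by simp [Prog.realWrites, centerProg])]; rfl
  rw [Prog.exec, Prog.exec, Finset.sum_range_succ, ← add_assoc, ← hq]
  simp only [BExp.holds, NExp.eval, hc, h8, not_lt]
  split_ifs with ha hb hb
  · simp [Prog.exec, State.setReal, NExp.eval, RExp.eval, h3]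
  · exact absurd (le_antisymm ha.1 ha.2) hb
  · exact absurd ⟨hb.le, hb.ge⟩ ha
  · simp [Prog.exec, h3]

theorem levelProg_spec (s : State) {i T t j : ℕ} {Δ : ℝ} (hT : s.nats 1 0 = T)
    (ht : s.nats 5 0 = t) (hj : s.nats 4 0 = j) (hi : s.nats 6 0 = i) (hΔ : I.diam = Δ)
    (hs : s.reals 2 0 = Δ / 2 ^ i) :
    ((levelProg).exec I ω s).reals 2 0 = Δ / 2 ^ (i + 1) ∧
    ((levelProg).exec I ω s).reals 4 0 = s.reals 4 0 + levelEstimate I (s.reals 1) T t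
      (fun q => logit (s.reals 1 (noiseStart I + q))) j i := by
  subst hΔ
  have hc := centerProg_spec (I := I) (ω := ω) (c := 8) (P := I.numData + j)
    (pt := .add .numData (var 4)) (s := s) (Or.inl rfl) (fun t' ht' => by
      simp only [NExp.eval]
      rw [ht' 4 (by simp), hj])
  set s1 := (centerProg 8 (.add .numData (var 4))).exec I ω s with hs1
  have n1 : ∀ a, a ∉ [8, 10] → s1.nats a = s.nats a := fun a ha =>
    Prog.exec_nats_of_notMem I ω _ (by
      simp only [List.mem_cons, List.not_mem_nil, or_false, not_or] at ha
      simp [Prog.natWrites, centerProg, ha.1, ha.2]) s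
  have r1 : ∀ a, s1.reals a = s.reals a := fun a =>
    Prog.exec_reals_of_notMem I ω _ (by simp [Prog.realWrites, centerProg]) s
  set s2 := s1.setReal 3 0 0 with hs2
  have n2 : s2.nats = s1.nats := rfl
  have r2 : ∀ a, a ≠ 3 → s2.reals a = s.reals a := fun a ha => by
    rw [← r1 a]; simp [hs2, State.setReal, ha]
  have r23 : s2.reals 3 0 = 0 := by simp [hs2, State.setReal]
  have hcount := countProg_spec (I := I) (ω := ω) s2
  set s3 := countProg.exec I ω s2 with hs3
  have n3 : ∀ a, a ∉ [7, 9, 10] → s3.nats a = s1.nats a := fun a ha => by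
    rw [← n2]
    refine Prog.exec_nats_of_notMem I ω _ ?_ s2
    simp only [List.mem_cons, List.not_mem_nil, or_false, not_or] at ha
    simp [Prog.natWrites, countProg, centerProg, ha.1, ha.2]
  have r3 : ∀ a, a ≠ 3 → s3.reals a = s.reals a := fun a ha => by
    rw [← r2 a ha]
    exact Prog.exec_reals_of_notMem I ω _
      (by simp [Prog.realWrites, countProg, centerProg, ha]) s2
  rw [r2 1 (by simp), r2 2 (by simp), r23, zero_add, n2, n1 5 (by simp), hc, hs, ht] at hcount
  rw [hs, ht] at hc
  have e8 : s3.nats 8 0 = cluster I (s.reals 1) t (I.diam / 2 ^ i) (I.numData + j) := by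
    rw [n3 8 (by simp), hc]
  have e5 : s3.nats 5 0 = t := by rw [n3 5 (by simp), n1 5 (by simp), ht]
  have e1 : s3.nats 1 0 = T := by rw [n3 1 (by simp), n1 1 (by simp), hT]
  have e6 : s3.nats 6 0 = i := by rw [n3 6 (by simp), n1 6 (by simp), hi]
  have hex : levelProg.exec I ω s = (Prog.setReal 2 (.const 0) (.div (rvar 2) (nat 2))).exec I ω
      ((Prog.setReal 4 (.const 0) (.add (rvar 4) (.mul (rvar 2) (.sub (nat 1)
      (.div (.add (rvar 3) (.mul (.div (.ofNat (.mul (.const 16) (.mul (var 1) (var 1)))) .eps)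
        (noiseExp noisePos))) (.ofNat .numData)))))).exec I ω s3) := by
    have : (Prog.setReal 3 (.const 0) (nat 0)).exec I ω s1 = s2 := by
      simp [Prog.exec, hs2, RExp.eval, NExp.eval]
    simp only [levelProg, Prog.exec] at this ⊢
    rw [← hs1, this, ← hs3]
  rw [hex]
  constructor
  · simp only [Prog.exec, State.setReal, NExp.eval, RExp.eval]
    simp [r3 2, hs, pow_succ]
    ring
  · simp only [Prog.exec, State.setReal, NExp.eval, RExp.eval, e8, e5, e1, e6, hcount,
      r3 4 (by simp), r3 2 (by simp), r3 1 (by simp), hs]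
    simp [levelEstimate, logit, noiseStart]

end Semantics

end DistanceProgram

/-! ### Correctness of the trial, query and sampling loops, and of the whole program -/

namespace DistanceProgram

section Semantics

variable {I : Input} {ω : ℕ → unitInterval}

theorem eval_trialsExp {s : State} {T : ℕ} (hT : s.nats 1 0 = T) (hle : T ≤ 3 * I.numQueries) :
    trialsExp.eval I s = T := by
  simp only [NExp.eval, hT]; omega

theorem trialProg_spec (s : State) {T t j : ℕ} (hT : s.nats 1 0 = T) (hle : T ≤ 3 * I.numQueries)
    (ht : s.nats 5 0 = t) (hj : s.nats 4 0 = j) :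
    (trialProg.exec I ω s).reals 5 0 = if 0 < t then
        min (s.reals 5 0) (trialEstimate I (s.reals 1) T
          (fun q => logit (s.reals 1 (noiseStart I + q))) j t)
      else trialEstimate I (s.reals 1) T
        (fun q => logit (s.reals 1 (noiseStart I + q))) j t := by
  set s1 := (s.setReal 4 0 0).setReal 2 0 I.diam with hs1
  have hex : trialProg.exec I ω s = (Prog.ite
      (.conj (.natLt (.const 0) (var 5)) (.neg (.realLt (rvar 4) (rvar 5)))) .skip
      (.setReal 5 (.const 0) (rvar 4))).exec I ω
      ((Prog.loop 6 (.mul (.const 8) trialsExp) levelProg).exec I ω s1) := by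
    have : (Prog.setReal 2 (.const 0) .diam).exec I ω
        ((Prog.setReal 4 (.const 0) (nat 0)).exec I ω s) = s1 := by
      simp [Prog.exec, RExp.eval, NExp.eval, hs1]
    rw [← this]; rfl
  have r1 : s1.reals 1 = s.reals 1 := by funext q; simp [hs1, State.setReal]
  have hloop := Prog.exec_loop_induction I ω 6 (.mul (.const 8) trialsExp) levelProg s1
    (fun i t' => t'.reals 2 0 = I.diam / 2 ^ i ∧
      t'.reals 4 0 = ∑ i ∈ Finset.range i, levelEstimate I (s.reals 1) T t
        (fun q => logit (s.reals 1 (noiseStart I + q))) j i)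
    ⟨by simp [hs1, State.setReal], by simp [hs1, State.setReal]⟩ (by
      intro i _ t' h1 h2 hq
      have hn : ∀ a, a ∉ [6, 7, 8, 9, 10] → t'.nats a = s.nats a := fun a ha => by
        refine h1 a ?_
        simp only [List.mem_cons, List.not_mem_nil, or_false, not_or] at ha
        simp [Prog.natWrites, levelProg, countProg, centerProg, ha]
      have hn' : ∀ a, a ∉ [6, 7, 8, 9, 10] → (t'.setNat 6 0 i).nats a = s.nats a := fun a ha => by
        rw [← hn a ha]
        simp only [List.mem_cons, List.not_mem_nil, or_false, not_or] at ha
        simp [State.setNat, ha]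
      have hr : (t'.setNat 6 0 i).reals 1 = s.reals 1 := by
        rw [← r1]
        exact h2 1 (by simp [Prog.realWrites, levelProg, countProg, centerProg])
      have := levelProg_spec (I := I) (ω := ω) (t'.setNat 6 0 i) (i := i) (T := T) (t := t) (j := j)
        (by rw [hn' 1 (by simp), hT]) (by rw [hn' 5 (by simp), ht]) (by rw [hn' 4 (by simp), hj])
        (by simp [State.setNat]) rfl hq.1
      refine ⟨this.1, ?_⟩
      rw [this.2, hr, Finset.sum_range_succ, ← hq.2]
      rfl)
  have he : (NExp.mul (.const 8) trialsExp).eval I s1 = 8 * T := by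
    rw [NExp.eval, eval_trialsExp (s := s1) (show s1.nats 1 0 = T from hT) hle, NExp.eval]
  rw [he] at hloop
  set s2 := (Prog.loop 6 (.mul (.const 8) trialsExp) levelProg).exec I ω s1
  have e5 : s2.nats 5 0 = t := by
    rw [← ht]
    exact congrFun (Prog.exec_nats_of_notMem I ω _
      (by simp [Prog.natWrites, levelProg, countProg, centerProg]) s1) 0
  have e5' : s2.reals 5 0 = s.reals 5 0 := by
    refine (congrFun (Prog.exec_reals_of_notMem I ω _
      (by simp [Prog.realWrites, levelProg, countProg, centerProg]) s1) 0).trans ?_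
    simp [hs1, State.setReal]
  rw [hex, Prog.exec]
  simp only [BExp.holds, NExp.eval, RExp.eval, e5, e5', hloop.2, not_lt, Prog.exec]
  rw [trialEstimate]
  split_ifs with h1 h2 h2
  · rw [e5', min_eq_left h1.2]
  · exact absurd h1.1 h2
  · have : ¬ s.reals 5 0 ≤ _ := fun h => h1 ⟨h2, h⟩
    rw [min_eq_right (not_le.1 this).le]
    simp [State.setReal]
  · simp [State.setReal]

theorem treeProg_spec (s : State) (hT : s.nats 1 0 = numTrials I) (q : ℕ)
    (hq : q < I.numQueries) :
    (treeProg.exec I ω s).reals 0 q = treeAnswer I (s.reals 1)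
      (fun q => logit (s.reals 1 (noiseStart I + q))) q := by
  have hle : numTrials I ≤ 3 * I.numQueries := min_le_left _ _
  have := Prog.exec_loop_induction I ω 4 .numQueries (.seq (.setReal 5 (.const 0) (nat 0))
    (.seq (.loop 5 trialsExp trialProg) (.setReal 0 (var 4) (.div (rvar 5)
        (.mul (nat 9) (.log (.ofNat (.add .numQueries (.const 1))))))))) s
    (fun j t => ∀ q < j, t.reals 0 q = treeAnswer I (s.reals 1)
      (fun q => logit (s.reals 1 (noiseStart I + q))) q) (by simp) (by
    intro j _ t h1 h2 hQ q hqj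
    have hn : ∀ a, a ∉ [4, 5, 6, 7, 8, 9, 10] → t.nats a = s.nats a := fun a ha => by
      refine h1 a ?_
      simp only [List.mem_cons, List.not_mem_nil, or_false, not_or] at ha
      simp [Prog.natWrites, trialProg, levelProg, countProg, centerProg, ha]
    have hr : t.reals 1 = s.reals 1 := h2 1
      (by simp [Prog.realWrites, trialProg, levelProg, countProg, centerProg])
    set s1 := (t.setNat 4 0 j).setReal 5 0 0 with hs1
    have n1 : s1.nats 1 0 = numTrials I := by
      rw [← hT, ← hn 1 (by simp)]; simp [hs1, State.setNat, State.setReal]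
    have n4 : s1.nats 4 0 = j := by simp [hs1, State.setNat, State.setReal]
    have r1 : s1.reals 1 = s.reals 1 := by
      rw [← hr]; funext q; simp [hs1, State.setNat, State.setReal]
    have hloop := Prog.exec_loop_induction I ω 5 trialsExp trialProg s1
      (fun i t' => t'.reals 5 0 = minUpTo (trialEstimate I (s.reals 1) (numTrials I)
        (fun q => logit (s.reals 1 (noiseStart I + q))) j) i)
      (by simp [hs1, State.setReal, minUpTo]) (by
        intro i _ t' h1' h2' hq'
        have hn' : ∀ a, a ∉ [5, 6, 7, 8, 9, 10] → (t'.setNat 5 0 i).nats a = s1.nats a :=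
          fun a ha => by
            simp only [List.mem_cons, List.not_mem_nil, or_false, not_or] at ha
            rw [← h1' a (by simp [Prog.natWrites, trialProg, levelProg, countProg, centerProg, ha])]
            simp [State.setNat, ha]
        have hr' : (t'.setNat 5 0 i).reals 1 = s.reals 1 := by
          rw [← r1]
          exact h2' 1 (by simp [Prog.realWrites, trialProg, levelProg, countProg, centerProg])
        rw [trialProg_spec (T := numTrials I) (t := i) (j := j) _ (by rw [hn' 1 (by simp), n1]) hle
          (by simp [State.setNat]) (by rw [hn' 4 (by simp), n4]), hr', minUpTo, ← hq']
        rfl)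
    rw [eval_trialsExp n1 hle] at hloop
    set s2 := (Prog.loop 5 trialsExp trialProg).exec I ω s1 with hs2
    have e4 : s2.nats 4 0 = j := by
      rw [← n4]
      exact congrFun (Prog.exec_nats_of_notMem I ω _
        (by simp [Prog.natWrites, trialProg, levelProg, countProg, centerProg]) s1) 0
    have e0 : s2.reals 0 = t.reals 0 := by
      refine (Prog.exec_reals_of_notMem I ω _
        (by simp [Prog.realWrites, trialProg, levelProg, countProg, centerProg]) s1).trans ?_
      funext q; simp [hs1, State.setReal, State.setNat]
    have hex : (Prog.setReal 5 (.const 0) (nat 0)).exec I ω (t.setNat 4 0 j) = s1 := by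
      simp [Prog.exec, hs1, RExp.eval, NExp.eval]
    rw [Prog.exec, hex, Prog.exec, ← hs2]
    simp only [Prog.exec, State.setReal, NExp.eval, RExp.eval, e4, hloop]
    by_cases hqj' : q = j
    · subst hqj'
      simp [treeAnswer]
    · have : q < j := by omega
      simp [hqj', e0, hQ q this])
  exact this q hq

theorem naiveProg_spec (s : State) (q : ℕ) (hq : q < I.numQueries) :
    (naiveProg.exec I ω s).reals 0 q = naiveAnswer I (fun q => logit (s.reals 1 q)) q := by
  have := Prog.exec_loop_induction I ω 4 .numQueries (.seq (.setReal 3 (.const 0) (nat 0))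
    (.seq (.loop 7 .numData (.setReal 3 (.const 0)
        (.add (rvar 3) (.oracle (var 7) (.add .numData (var 4))))))
      (.setReal 0 (var 4) (.div (.add (rvar 3)
        (.mul (.div (.mul (.ofNat .numQueries) .diam) .eps) (noiseExp (var 4))))
        (.ofNat .numData))))) s
    (fun j t => ∀ q < j, t.reals 0 q = naiveAnswer I (fun q => logit (s.reals 1 q)) q)
    (by simp) (by
    intro j _ t h1 h2 hQ q hqj
    have hr : t.reals 1 = s.reals 1 := h2 1 (by simp [Prog.realWrites])
    set s1 := (t.setNat 4 0 j).setReal 3 0 0 with hs1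
    have n4 : s1.nats 4 0 = j := by simp [hs1, State.setNat, State.setReal]
    have r1 : s1.reals 1 = s.reals 1 := by
      rw [← hr]; funext q; simp [hs1, State.setNat, State.setReal]
    have hloop := Prog.exec_loop_induction I ω 7 .numData (.setReal 3 (.const 0)
        (.add (rvar 3) (.oracle (var 7) (.add .numData (var 4))))) s1
      (fun i t' => t'.reals 3 0 = ∑ x ∈ Finset.range i, I.oracle x (I.numData + j))
      (by simp [hs1, State.setReal]) (by
        intro i _ t' h1' _ hq'
        have e4 : t'.nats 4 0 = j := by rw [h1' 4 (by simp [Prog.natWrites]), n4]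
        rw [Finset.sum_range_succ, ← hq']
        simp [Prog.exec, State.setReal, State.setNat, RExp.eval, NExp.eval, e4])
    set s2 := (Prog.loop 7 .numData (.setReal 3 (.const 0)
        (.add (rvar 3) (.oracle (var 7) (.add .numData (var 4)))))).exec I ω s1 with hs2
    have e4 : s2.nats 4 0 = j := by
      rw [← n4]
      exact congrFun (Prog.exec_nats_of_notMem I ω _ (by simp [Prog.natWrites]) s1) 0
    have e0 : s2.reals 0 = t.reals 0 := by
      refine (Prog.exec_reals_of_notMem I ω _ (by simp [Prog.realWrites]) s1).trans ?_
      funext q; simp [hs1, State.setReal, State.setNat]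
    have e1 : s2.reals 1 = s.reals 1 :=
      (Prog.exec_reals_of_notMem I ω _ (by simp [Prog.realWrites]) s1).trans r1
    have hex : (Prog.setReal 3 (.const 0) (nat 0)).exec I ω (t.setNat 4 0 j) = s1 := by
      simp [Prog.exec, hs1, RExp.eval, NExp.eval]
    have e3 : s2.reals 3 0 = ∑ x ∈ Finset.range I.numData, I.oracle x (I.numData + j) := hloop
    rw [Prog.exec, hex, Prog.exec, ← hs2]
    simp only [Prog.exec, State.setReal, NExp.eval, RExp.eval, e4, e3, e1]
    by_cases hqj' : q = j
    · subst hqj'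
      simp [naiveAnswer, logit]
    · have : q < j := by omega
      simp [hqj', e0, hQ q this])
  exact this q hq

theorem drawProg_spec (s : State) (hs : s.pos = 0) (q : ℕ) (hq : q < drawsExp.eval I s) :
    (drawProg.exec I ω s).reals 1 q = ω q := by
  have := Prog.exec_loop_induction I ω 2 drawsExp (.draw 1 (var 2)) s
    (fun i t => t.pos = i ∧ ∀ q < i, t.reals 1 q = ω q) ⟨hs, by simp⟩ (by
      rintro i _ t - - ⟨h1, h2⟩
      refine ⟨by simp [Prog.exec, State.setNat, h1], fun q hq => ?_⟩
      by_cases hqi : q = i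
      · subst hqi; simp [Prog.exec, State.setNat, State.setReal, NExp.eval, h1]
      · have : q < i := by omega
        simp [Prog.exec, State.setNat, State.setReal, NExp.eval, hqi, h2 q this])
  exact this.2 q hq

/-- The loop invariant is the minimum of the counter and the ceiling, since `i < ⌈a⌉₊` holds exactly
when `i < a`. -/
theorem trialsProg_spec (s : State) (hs : s.nats 1 0 = 0) :
    (trialsProg.exec I ω s).nats 1 0 = numTrials I := by
  refine Prog.exec_loop_induction I ω 3 (.mul (.const 3) .numQueries) _ s
    (fun i t => t.nats 1 0 = min i ⌈Real.log (2 * I.numQueries / I.beta)⌉₊) (by simpa using hs) ?_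
  intro i _ t _ _ hq
  have e3 : (t.setNat 3 0 i).nats 3 0 = i := by simp [State.setNat]
  have hiff := Nat.lt_ceil (n := i) (a := Real.log (2 * I.numQueries / I.beta))
  rw [Prog.exec]
  simp only [BExp.holds, RExp.eval, NExp.eval, e3, Nat.cast_ofNat]
  split_ifs with h
  · have := hiff.2 h
    simp [Prog.exec, NExp.eval, State.setNat]
    omega
  · have h4 : ¬ i < ⌈Real.log (2 * I.numQueries / I.beta)⌉₊ := fun h5 => h (hiff.1 h5)
    simp [Prog.exec, State.setNat, hq]
    omega

/-- The answers computed by the program, in terms of a tape that agrees with `ω` on the cells that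
are drawn. -/
theorem prog_spec (ω : ℕ → unitInterval) : ∃ u : ℕ → ℝ,
    (∀ q < noiseStart I + 72 * (I.numQueries * I.numQueries) * (I.numQueries + 1), u q = ω q) ∧
    ∀ q < I.numQueries, (prog.exec I ω State.init).reals 0 q =
      if I.numData * I.eps < 1 then 0 else
      if I.numData * I.eps < (I.numQueries : ℝ) ^ 5 ∧ Real.log (1 / I.beta) < I.numQueries then
        treeAnswer I u (fun q => logit (u (noiseStart I + q))) q
      else naiveAnswer I (fun q => logit (u q)) q := by
  classical
  set s1 := drawProg.exec I ω State.init with hs1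
  set s2 := trialsProg.exec I ω s1 with hs2
  have r2 : s2.reals = s1.reals := by
    funext a
    exact Prog.exec_reals_of_notMem I ω _ (by simp [Prog.realWrites, trialsProg]) s1
  have n1 : s1.nats 1 0 = 0 := congrFun (Prog.exec_nats_of_notMem I ω drawProg
    (by simp [Prog.natWrites, drawProg]) State.init) 0
  have r0 : s1.reals 0 = fun _ => 0 := Prog.exec_reals_of_notMem I ω drawProg
    (by simp [Prog.realWrites, drawProg]) State.init
  refine ⟨s2.reals 1, fun q hq => ?_, fun q hq => ?_⟩
  · rw [r2]
    exact drawProg_spec (I := I) State.init rfl q (by simpa [NExp.eval, noiseStart] using hq)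
  · have e : ((I.numQueries * I.numQueries * (I.numQueries * (I.numQueries * I.numQueries)) : ℕ) : ℝ)
        = (I.numQueries : ℝ) ^ 5 := by push_cast; ring
    rw [prog, Prog.exec, Prog.exec, ← hs1, ← hs2]
    simp only [Prog.exec, BExp.holds, RExp.eval, NExp.eval, e, Nat.cast_one]
    split_ifs
    · rw [r2, r0]
    · exact treeProg_spec s2 (trialsProg_spec s1 n1) q hq
    · exact naiveProg_spec s2 q hq

end Semantics

end DistanceProgram

/-! ## The mechanism in terms of the metric space -/

/-- At most one row differs, so each difference of sums collapses to the contribution of that row.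
-/
theorem sum_abs_sub_le_of_adjacent {X : Type u} {n : ℕ} {D D' : Fin n → X} (h : Adjacent D D') (f : X → ℕ → ℝ)
    (s : Finset ℕ) {B : ℝ} (hB0 : 0 ≤ B) (hB : ∀ x y, ∑ q ∈ s, |f x q - f y q| ≤ B) :
    ∑ q ∈ s, |∑ i, f (D i) q - ∑ i, f (D' i) q| ≤ B := by
  classical
  simp only [← Finset.sum_sub_distrib]
  by_cases hD : D = D'
  · subst hD; simpa using hB0
  · obtain ⟨i, hi⟩ := Function.ne_iff.1 hD
    have hone : ∀ i', i' ≠ i → D i' = D' i' := by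
      intro i' hne
      by_contra hi'
      exact hne ((Set.ncard_le_one (Set.toFinite _)).1 h i' hi' i hi)
    have : ∀ q, ∑ i', (f (D i') q - f (D' i') q) = f (D i) q - f (D' i) q := fun q =>
      Finset.sum_eq_single i (fun i' _ hne => by rw [hone i' hne, sub_self]) (by simp)
    simp only [this]
    exact hB _ _

section Mechanism

variable {X : Type u} [MetricSpace X] {n k : ℕ}

theorem distOracle_data_query (D : Fin n → X) (Q : Fin k → X) (i : Fin n) (j : Fin k) :
    distOracle D Q i (n + j) = dist (D i) (Q j) := by
  have h : (i : ℕ) < n + k ∧ n + (j : ℕ) < n + k := ⟨by omega, by omega⟩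
  rw [distOracle, dif_pos h]
  have h1 : (⟨i, h.1⟩ : Fin (n + k)) = Fin.castAdd k i := rfl
  have h2 : (⟨n + j, h.2⟩ : Fin (n + k)) = Fin.natAdd n j := rfl
  rw [h1, h2, Fin.append_left, Fin.append_right]

theorem distOracle_query_query (D : Fin n → X) (Q : Fin k → X) (i j : Fin k) :
    distOracle D Q (n + i) (n + j) = dist (Q i) (Q j) := by
  have h : n + (i : ℕ) < n + k ∧ n + (j : ℕ) < n + k := ⟨by omega, by omega⟩
  rw [distOracle, dif_pos h]
  have h1 : (⟨n + i, h.1⟩ : Fin (n + k)) = Fin.natAdd n i := rfl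
  have h2 : (⟨n + j, h.2⟩ : Fin (n + k)) = Fin.natAdd n j := rfl
  rw [h1, h2, Fin.append_right, Fin.append_right]

/-- The distances of `x` from the queries. -/
noncomputable def distProfile (Q : Fin k → X) (x : X) (w : ℕ) : ℝ :=
  if h : w < k then dist x (Q ⟨w, h⟩) else 0

theorem distProfile_of_lt (Q : Fin k → X) (x : X) {w : ℕ} (h : w < k) :
    distProfile Q x w = dist x (Q ⟨w, h⟩) := dif_pos h

/-- The value `k` means that no center has been found, and the test `centerUpTo … < k` shields the
comparison from `pri k`, which on the tape is the radius cell of the trial. -/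
theorem centerUpTo_congr {g g' pri pri' : ℕ → ℝ} {r : ℝ} {k : ℕ} (hg : ∀ w < k, g w = g' w)
    (hp : ∀ w < k, pri w = pri' w) {m : ℕ} (hm : m ≤ k) :
    centerUpTo g pri r k m = centerUpTo g' pri' r k m := by
  induction m with
  | zero => rfl
  | succ m ih =>
    rw [centerUpTo, centerUpTo, ih (by omega), hg m (by omega), hp m (by omega)]
    by_cases hc : centerUpTo g' pri' r k m < k
    · simp only [hp _ hc]
    · simp only [hc, false_and]

theorem center_congr {g g' pri pri' : ℕ → ℝ} {r : ℝ} {k : ℕ} (hg : ∀ w < k, g w = g' w)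
    (hp : ∀ w < k, pri w = pri' w) : center g pri r k = center g' pri' r k :=
  centerUpTo_congr hg hp le_rfl

/-- The cluster of the point `x` in trial `t` on level `i`. -/
noncomputable def tapeCluster (Q : Fin k → X) (Δ : ℝ) (u : ℕ → ℝ) (t i : ℕ) (x : X) : ℕ :=
  center (distProfile Q x) (fun w => u (t * (k + 1) + w)) ((1 + u (t * (k + 1) + k)) * (Δ / 2 ^ i)) k

theorem tapeCluster_le (Q : Fin k → X) (Δ : ℝ) (u : ℕ → ℝ) (t i : ℕ) (x : X) :
    tapeCluster Q Δ u t i x ≤ k := center_le _ _ _ _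

theorem trial_pos_lt {T t w : ℕ} (ht : t < T) (hw : w ≤ k) : t * (k + 1) + w < T * (k + 1) := by
  calc t * (k + 1) + w < (t + 1) * (k + 1) := by rw [add_mul]; omega
    _ ≤ T * (k + 1) := Nat.mul_le_mul_right _ ht

theorem tapeCluster_congr {Q : Fin k → X} {Δ : ℝ} {u u' : ℕ → ℝ} {T t : ℕ}
    (hu : ∀ q < T * (k + 1), u q = u' q) (ht : t < T) (i : ℕ) (x : X) :
    tapeCluster Q Δ u t i x = tapeCluster Q Δ u' t i x := by
  rw [tapeCluster, tapeCluster, hu _ (trial_pos_lt ht le_rfl)]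
  exact center_congr (fun _ _ => rfl) fun w hw => hu _ (trial_pos_lt ht hw.le)

/-- Post-processing of the noisy cluster sizes. -/
noncomputable def treePost (Q : Fin k → X) (Δ : ℝ) (n T : ℕ) (u v : ℕ → ℝ) (j : Fin k) : ℝ :=
  DistanceProgram.minUpTo (fun t => ∑ i ∈ Finset.range (8 * T), Δ / 2 ^ i *
    (1 - v ((t * (8 * T) + i) * (k + 1) + tapeCluster Q Δ u t i (Q j)) / n)) T /
    (9 * Real.log (k + 1))

/-- The contribution of the point `x` to the cluster sizes. -/
noncomputable def treeStat (Q : Fin k → X) (Δ : ℝ) (T : ℕ) (u : ℕ → ℝ) (x : X) (q : ℕ) : ℝ :=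
  if q < T * (8 * T) * (k + 1) ∧ tapeCluster Q Δ u (q / (k + 1) / (8 * T)) (q / (k + 1) % (8 * T)) x
    = q % (k + 1) then 1 else 0

theorem cell_pos_lt {T t i c : ℕ} (ht : t < T) (hi : i < 8 * T) (hc : c ≤ k) :
    (t * (8 * T) + i) * (k + 1) + c < T * (8 * T) * (k + 1) := by
  refine trial_pos_lt ?_ hc
  calc t * (8 * T) + i < (t + 1) * (8 * T) := by rw [add_mul]; omega
    _ ≤ T * (8 * T) := Nat.mul_le_mul_right _ ht

theorem treeStat_cell (Q : Fin k → X) (Δ : ℝ) (u : ℕ → ℝ) (x : X) {T t i c : ℕ} (ht : t < T)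
    (hi : i < 8 * T) (hc : c ≤ k) :
    treeStat Q Δ T u x ((t * (8 * T) + i) * (k + 1) + c) =
      if tapeCluster Q Δ u t i x = c then 1 else 0 := by
  have hT : 0 < 8 * T := by omega
  have e1 : ((t * (8 * T) + i) * (k + 1) + c) / (k + 1) = t * (8 * T) + i := by
    rw [mul_comm, Nat.mul_add_div (by omega), Nat.div_eq_of_lt (by omega), add_zero]
  have e2 : ((t * (8 * T) + i) * (k + 1) + c) % (k + 1) = c := by
    rw [Nat.mul_comm, Nat.mul_add_mod, Nat.mod_eq_of_lt (by omega)]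
  have e3 : (t * (8 * T) + i) / (8 * T) = t := by
    rw [mul_comm t, Nat.mul_add_div hT, Nat.div_eq_of_lt hi, add_zero]
  have e4 : (t * (8 * T) + i) % (8 * T) = i := by
    rw [Nat.mul_comm t, Nat.mul_add_mod, Nat.mod_eq_of_lt hi]
  simp only [treeStat, e1, e2, e3, e4, cell_pos_lt ht hi hc, true_and]

theorem sum_range_mul (f : ℕ → ℝ) (M K : ℕ) :
    ∑ q ∈ Finset.range (M * K), f q =
      ∑ m ∈ Finset.range M, ∑ w ∈ Finset.range K, f (m * K + w) := by
  induction M with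
  | zero => simp
  | succ M ih => rw [add_mul, one_mul, Finset.sum_range_add, ih, Finset.sum_range_succ]

/-- In each trial and level a point occupies exactly one of `k + 1` cells, the last being for points
without a center. Two points thus differ by at most `2` there, and there are `T * (8 * T)` such
pairs. -/
theorem sum_abs_treeStat_sub_le (Q : Fin k → X) (Δ : ℝ) (T : ℕ) (u : ℕ → ℝ) (x y : X) :
    ∑ q ∈ Finset.range (T * (8 * T) * (k + 1)), |treeStat Q Δ T u x q - treeStat Q Δ T u y q| ≤
      ((16 * (T * T) : ℕ) : ℝ) := by
  rw [sum_range_mul, sum_range_mul]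
  have h : ∀ t ∈ Finset.range T, ∀ i ∈ Finset.range (8 * T), ∑ c ∈ Finset.range (k + 1),
      |treeStat Q Δ T u x ((t * (8 * T) + i) * (k + 1) + c) -
        treeStat Q Δ T u y ((t * (8 * T) + i) * (k + 1) + c)| ≤ 2 := by
    intro t ht i hi
    rw [Finset.mem_range] at ht hi
    calc _ ≤ ∑ c ∈ Finset.range (k + 1), ((if tapeCluster Q Δ u t i x = c then (1 : ℝ) else 0) +
          (if tapeCluster Q Δ u t i y = c then (1 : ℝ) else 0)) := by
          refine Finset.sum_le_sum fun c hc => ?_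
          rw [Finset.mem_range] at hc
          rw [treeStat_cell Q Δ u x ht hi (by omega), treeStat_cell Q Δ u y ht hi (by omega)]
          split_ifs <;> norm_num
      _ ≤ 2 := by
          rw [Finset.sum_add_distrib, Finset.sum_ite_eq, Finset.sum_ite_eq]
          split_ifs <;> norm_num
  refine (Finset.sum_le_sum fun t ht => Finset.sum_le_card_nsmul _ _ _ (h t ht)).trans ?_
  simp only [Finset.sum_const, Finset.card_range, nsmul_eq_mul]
  push_cast
  nlinarith

theorem minUpTo_congr {f g : ℕ → ℝ} {m : ℕ} (h : ∀ t < m, f t = g t) :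
    DistanceProgram.minUpTo f m = DistanceProgram.minUpTo g m := by
  induction m with
  | zero => rfl
  | succ m ih =>
    rw [DistanceProgram.minUpTo, DistanceProgram.minUpTo, ih fun t ht => h t (by omega),
      h m (by omega)]

/-- The number of trials. -/
noncomputable def trials (k : ℕ) (β : ℝ) : ℕ := min (3 * k) ⌈Real.log (2 * k / β)⌉₊

/-- The sequence of random reals on the tape. -/
def realTape (ω : ℕ → unitInterval) (q : ℕ) : ℝ := ω q

noncomputable def treeMechanism (Δ ε : ℝ) (T : ℕ) (D : Fin n → X) (Q : Fin k → X)
    (ω : ℕ → unitInterval) : Fin k → ℝ :=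
  noisyOutput (3 * k * (k + 1)) (((16 * (T * T) : ℕ) : ℝ) / ε)
    (fun ω => treePost Q Δ n T (realTape ω))
    (fun ω q => ∑ i, treeStat Q Δ T (realTape ω) (D i) q) ω

noncomputable def naiveMechanism (Δ ε : ℝ) (D : Fin n → X) (Q : Fin k → X)
    (ω : ℕ → unitInterval) : Fin k → ℝ :=
  noisyOutput 0 (k * Δ / ε) (fun _ v (j : Fin k) => v j / n)
    (fun _ q => ∑ i, distProfile Q (D i) q) ω

theorem cluster_mkInput {ε δ β Δ : ℝ} {D : Fin n → X} {Q : Fin k → X} {u : ℕ → ℝ} {t i : ℕ}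
    {p : ℕ} {x : X} (hp : ∀ j : Fin k, distOracle D Q p (n + j) = dist x (Q j)) :
    DistanceProgram.cluster (mkInput ε δ β Δ D Q) u t (Δ / 2 ^ i) p = tapeCluster Q Δ u t i x :=
  center_congr (fun w hw => by rw [distProfile_of_lt Q x hw]; exact hp ⟨w, hw⟩) fun _ _ => rfl

theorem treeAnswer_mkInput {ε δ β Δ : ℝ} (D : Fin n → X) (Q : Fin k → X) {u : ℕ → ℝ}
    {ω : ℕ → unitInterval}
    (hu : ∀ q < 3 * k * (k + 1) + 72 * (k * k) * (k + 1), u q = ω q) (j : Fin k) :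
    DistanceProgram.treeAnswer (mkInput ε δ β Δ D Q) u
      (fun q => logit (u (3 * k * (k + 1) + q))) j = treeMechanism Δ ε (trials k β) D Q ω j := by
  have hT : DistanceProgram.numTrials (mkInput ε δ β Δ D Q) = trials k β := rfl
  have hle : trials k β ≤ 3 * k := min_le_left _ _
  generalize trials k β = T at hT hle
  rw [DistanceProgram.treeAnswer, treeMechanism, noisyOutput, treePost, hT]
  congr 1
  rotate_left
  · simp [mkInput]
  refine minUpTo_congr fun t ht => ?_
  rw [DistanceProgram.trialEstimate]
  refine Finset.sum_congr rfl fun i hi => ?_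
  rw [Finset.mem_range] at hi
  have hu' : ∀ q < T * (k + 1), u q = realTape ω q := fun q hq =>
    hu q (hq.trans_le ((Nat.mul_le_mul_right _ hle).trans (Nat.le_add_right _ _)))
  have hc : ∀ {p x}, (∀ j : Fin k, distOracle D Q p (n + j) = dist x (Q j)) →
      DistanceProgram.cluster (mkInput ε δ β Δ D Q) u t (Δ / 2 ^ i) p =
        tapeCluster Q Δ (realTape ω) t i x := fun hp =>
    (cluster_mkInput hp).trans (tapeCluster_congr hu' ht i _)
  have e1 := hc (distOracle_query_query D Q j)
  have hpos := cell_pos_lt ht hi (tapeCluster_le Q Δ (realTape ω) t i (Q j))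
  -- With `T ≤ 3 * k` there are at most `72 * k ^ 2` pairs of trial and level, so every noise cell
  -- in use has been drawn.
  have hpos2 : T * (8 * T) * (k + 1) ≤ 72 * (k * k) * (k + 1) :=
    Nat.mul_le_mul_right _ (by nlinarith)
  have e2 := hu (3 * k * (k + 1) + ((t * (8 * T) + i) * (k + 1) +
    tapeCluster Q Δ (realTape ω) t i (Q j))) (by omega)
  have e3 : DistanceProgram.clusterCount (mkInput ε δ β Δ D Q) u t (Δ / 2 ^ i)
      (tapeCluster Q Δ (realTape ω) t i (Q j)) = ∑ x, treeStat Q Δ T (realTape ω) (D x)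
        ((t * (8 * T) + i) * (k + 1) + tapeCluster Q Δ (realTape ω) t i (Q j)) := by
    rw [DistanceProgram.clusterCount]
    refine (Finset.sum_range _).trans (Finset.sum_congr rfl fun x _ => ?_)
    rw [treeStat_cell Q Δ _ _ ht hi (tapeCluster_le _ _ _ _ _ _),
      hc (distOracle_data_query D Q x)]
  rw [DistanceProgram.levelEstimate]
  change Δ / 2 ^ i * (1 - (DistanceProgram.clusterCount (mkInput ε δ β Δ D Q) u t (Δ / 2 ^ i)
    (DistanceProgram.cluster (mkInput ε δ β Δ D Q) u t (Δ / 2 ^ i) (n + j)) +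
    ((16 * (T * T) : ℕ) : ℝ) / ε * logit (u (3 * k * (k + 1) + ((t * (8 * T) + i) * (k + 1) +
      DistanceProgram.cluster (mkInput ε δ β Δ D Q) u t (Δ / 2 ^ i) (n + j))))) / n) = _
  rw [e1, e2, e3]

theorem naiveAnswer_mkInput {ε δ β Δ : ℝ} (D : Fin n → X) (Q : Fin k → X) {u : ℕ → ℝ}
    {ω : ℕ → unitInterval} (hu : ∀ q < k, u q = ω q) (j : Fin k) :
    DistanceProgram.naiveAnswer (mkInput ε δ β Δ D Q) (fun q => logit (u q)) j =
      naiveMechanism Δ ε D Q ω j := by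
  rw [DistanceProgram.naiveAnswer, naiveMechanism, noisyOutput, hu j j.2]
  change (∑ x ∈ Finset.range n, distOracle D Q x (n + j) + k * Δ / ε * logit (ω j)) / n =
    (∑ i, distProfile Q (D i) j + k * Δ / ε * logit (ω (0 + j))) / n
  rw [Finset.sum_range, zero_add]
  congr 3
  funext x
  rw [distOracle_data_query, distProfile_of_lt Q _ j.2]

theorem mechanism_prog (ε δ β Δ : ℝ) (D : Fin n → X) (Q : Fin k → X) (ω : ℕ → unitInterval) :
    DistanceProgram.prog.mechanism ε δ β Δ D Q ω =
      if n * ε < 1 then 0 else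
      if n * ε < (k : ℝ) ^ 5 ∧ Real.log (1 / β) < k then treeMechanism Δ ε (trials k β) D Q ω
      else naiveMechanism Δ ε D Q ω := by
  obtain ⟨u, hu, hout⟩ := DistanceProgram.prog_spec (I := mkInput ε δ β Δ D Q) ω
  funext j
  rw [Prog.mechanism, hout j j.2]
  change (if n * ε < 1 then 0 else if n * ε < (k : ℝ) ^ 5 ∧ Real.log (1 / β) < k then
    DistanceProgram.treeAnswer (mkInput ε δ β Δ D Q) u
      (fun q => logit (u (3 * k * (k + 1) + q))) j else
    DistanceProgram.naiveAnswer (mkInput ε δ β Δ D Q) (fun q => logit (u q)) j) = _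
  rw [treeAnswer_mkInput D Q hu, naiveAnswer_mkInput D Q fun q hq => hu q ?_]
  · split_ifs <;> rfl
  · change q < 3 * k * (k + 1) + 72 * (k * k) * (k + 1)
    nlinarith [Nat.zero_le (72 * (k * k) * (k + 1)), Nat.zero_le (k * k)]

end Mechanism

/-! ## Privacy -/

section Privacy

/-- Needed because the noise cell that is read depends on the random cluster of the query. -/
theorem measurable_eval_nat {Ω : Type*} [MeasurableSpace Ω] {f : Ω → ℕ → ℝ} {c : Ω → ℕ}
    (hf : Measurable f) (hc : Measurable c) : Measurable fun ω => f ω (c ω) := by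
  have : Measurable fun p : (ℕ → ℝ) × ℕ => p.1 p.2 :=
    measurable_from_prod_countable_left fun i => measurable_pi_apply i
  exact this.comp (hf.prodMk hc)

theorem measurable_centerUpTo {Ω : Type*} [MeasurableSpace Ω] (g : ℕ → ℝ) {pri : Ω → ℕ → ℝ}
    {r : Ω → ℝ} (hp : Measurable pri) (hr : Measurable r) (k m : ℕ) :
    Measurable fun ω => centerUpTo g (pri ω) (r ω) k m := by
  induction m with
  | zero => exact measurable_const
  | succ m ih =>
    have h1 : MeasurableSet {ω | g m ≤ r ω ∧ ¬ (centerUpTo g (pri ω) (r ω) k m < k ∧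
        ¬ pri ω m < pri ω (centerUpTo g (pri ω) (r ω) k m))} := by
      refine (measurableSet_le measurable_const hr).inter
        (((measurableSet_lt ih measurable_const).inter (MeasurableSet.compl ?_)).compl)
      exact measurableSet_lt (measurable_pi_iff.1 hp m) (measurable_eval_nat hp ih)
    simp only [centerUpTo]
    exact Measurable.ite h1 measurable_const ih

theorem measurable_realTape : Measurable realTape :=
  measurable_pi_lambda _ fun q => measurable_subtype_coe.comp (measurable_pi_apply q)

theorem measurable_minUpTo {Ω : Type*} [MeasurableSpace Ω] {f : Ω → ℕ → ℝ} (hf : Measurable f)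
    (m : ℕ) : Measurable fun ω => DistanceProgram.minUpTo (f ω) m := by
  induction m with
  | zero => exact measurable_const
  | succ m ih =>
    simp only [DistanceProgram.minUpTo]
    split_ifs
    · exact ih.min (measurable_pi_iff.1 hf m)
    · exact measurable_pi_iff.1 hf m

variable {X : Type u} [MetricSpace X] {n k : ℕ}

theorem measurable_tapeCluster (Q : Fin k → X) (Δ : ℝ) (t i : ℕ) (x : X) :
    Measurable fun u : ℕ → ℝ => tapeCluster Q Δ u t i x :=
  measurable_centerUpTo _ (measurable_pi_lambda _ fun _ => measurable_pi_apply _)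
    ((measurable_const.add (measurable_pi_apply _)).mul_const _) k k

theorem measurable_treeStat (Q : Fin k → X) (Δ : ℝ) (T : ℕ) (x : X) :
    Measurable fun u : ℕ → ℝ => treeStat Q Δ T u x := by
  refine measurable_pi_lambda _ fun q => ?_
  refine Measurable.ite ?_ measurable_const measurable_const
  exact (MeasurableSet.const _).inter
    (measurableSet_eq_fun (measurable_tapeCluster Q Δ _ _ x) measurable_const)

theorem measurable_treePost {Ω : Type*} [MeasurableSpace Ω] (Q : Fin k → X) (Δ : ℝ) (n T : ℕ)
    {u v : Ω → ℕ → ℝ} (hu : Measurable u) (hv : Measurable v) :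
    Measurable fun ω => treePost Q Δ n T (u ω) (v ω) := by
  refine measurable_pi_lambda _ fun j => ?_
  refine Measurable.div_const (measurable_minUpTo (measurable_pi_lambda _ fun t => ?_) T) _
  refine Finset.measurable_fun_sum _ fun i _ => ?_
  refine measurable_const.mul (measurable_const.sub (Measurable.div_const ?_ _))
  exact measurable_eval_nat hv
    (measurable_const.add ((measurable_tapeCluster Q Δ t i (Q j)).comp hu))

theorem treePost_congr {Q : Fin k → X} {Δ : ℝ} {n T : ℕ} {u u' : ℕ → ℝ}
    (hu : ∀ q < T * (k + 1), u q = u' q) : treePost Q Δ n T u = treePost Q Δ n T u' := by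
  funext v j
  rw [treePost, treePost]
  congr 1
  refine minUpTo_congr fun t ht => Finset.sum_congr rfl fun i _ => ?_
  rw [tapeCluster_congr hu ht]

theorem treeStat_congr {Q : Fin k → X} {Δ : ℝ} {T : ℕ} {u u' : ℕ → ℝ}
    (hu : ∀ q < T * (k + 1), u q = u' q) (x : X) : treeStat Q Δ T u x = treeStat Q Δ T u' x := by
  funext q
  rw [treeStat, treeStat]
  by_cases hq : q < T * (8 * T) * (k + 1)
  · have ht : q / (k + 1) / (8 * T) < T := by
      rw [Nat.div_div_eq_div_mul]
      refine Nat.div_lt_of_lt_mul (hq.trans_le (le_of_eq (by ring)))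
    rw [tapeCluster_congr hu ht]
  · simp [hq]

theorem realTape_update_of_lt {N q : ℕ} (ω : ℕ → unitInterval) (v : unitInterval) {p : ℕ}
    (hp : p < N) : realTape (Function.update ω (N + q) v) p = realTape ω p := by
  rw [realTape, realTape, Function.update_of_ne (by omega)]

/-- Since `T ≤ 3 * k`, the partition cells all precede the noise cells, so clusters and
post-processing are unaffected by resampling noise. The noise scale is the sensitivity `16 * T ^ 2`
over `ε`. -/
theorem isDP_treeMechanism (Δ : ℝ) {ε : ℝ} (hε : 0 < ε) {T : ℕ} (hT0 : 0 < T) (hT : T ≤ 3 * k) :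
    IsDP (treeMechanism Δ ε T : Mechanism X n k) ε 0 := by
  intro D D' h Q S hS
  have hN : ∀ {ω q v}, ∀ p < T * (k + 1),
      realTape (Function.update ω (3 * k * (k + 1) + q) v) p = realTape ω p := fun p hp =>
    realTape_update_of_lt _ _ (hp.trans_le (Nat.mul_le_mul_right _ hT))
  have hstat : ∀ D : Fin n → X,
      Measurable fun ω q => ∑ i, treeStat Q Δ T (realTape ω) (D i) q := fun D =>
    measurable_pi_lambda _ fun q => Finset.measurable_fun_sum _ fun i _ =>
      (measurable_pi_iff.1 (measurable_treeStat Q Δ T (D i)) q).comp measurable_realTape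
  have hpost : Measurable fun p : (ℕ → unitInterval) × (ℕ → ℝ) =>
      treePost Q Δ n T (realTape p.1) p.2 :=
    measurable_treePost Q Δ n T (measurable_realTape.comp measurable_fst) measurable_snd
  have hau : ∀ (D : Fin n → X) (ω : ℕ → unitInterval) (q : ℕ) (v : unitInterval),
      (fun q' => ∑ i, treeStat Q Δ T (realTape (Function.update ω (3 * k * (k + 1) + q) v)) (D i) q')
        = fun q' => ∑ i, treeStat Q Δ T (realTape ω) (D i) q' := fun D ω q v =>
    funext fun q' => Finset.sum_congr rfl fun i _ => congrFun (treeStat_congr hN (D i)) q'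
  have hb : (0 : ℝ) < ((16 * (T * T) : ℕ) : ℝ) / ε := by positivity
  have := tapeLaw_noisyOutput_le (N := 3 * k * (k + 1)) (b := ((16 * (T * T) : ℕ) : ℝ) / ε)
    (post := fun ω => treePost Q Δ n T (realTape ω)) hb (T * (8 * T) * (k + 1)) (ε := ε)
    hpost (hstat D) (hstat D')
    (fun ω q v => treePost_congr hN) (hau D) (hau D')
    (fun ω q hq => by simp only [treeStat, not_lt.2 hq, false_and])
    (fun ω => by
      rw [mul_div_cancel₀ _ hε.ne']
      exact sum_abs_sub_le_of_adjacent h _ _ (by positivity)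
        (sum_abs_treeStat_sub_le Q Δ T (realTape ω))) hS
  rw [ENNReal.ofReal_zero, add_zero]
  exact this

theorem isDP_naiveMechanism {Δ ε : ℝ} (hε : 0 < ε) (hΔ : 0 < Δ) (hk : 0 < k)
    (hX : ∀ x y : X, dist x y ≤ Δ) :
    IsDP (naiveMechanism Δ ε : Mechanism X n k) ε 0 := by
  intro D D' h Q S hS
  have hk' : (0 : ℝ) < k := by exact_mod_cast hk
  have hb : (0 : ℝ) < k * Δ / ε := by positivity
  have hprof : ∀ x q, 0 ≤ distProfile Q x q ∧ distProfile Q x q ≤ Δ := by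
    intro x q
    rw [distProfile]
    split_ifs
    exacts [⟨dist_nonneg, hX _ _⟩, ⟨le_rfl, hΔ.le⟩]
  have := tapeLaw_noisyOutput_le (N := 0) (b := k * Δ / ε)
    (post := fun _ v (j : Fin k) => v j / n) hb k (ε := ε)
    (a := fun _ q => ∑ i, distProfile Q (D i) q) (a' := fun _ q => ∑ i, distProfile Q (D' i) q)
    (measurable_pi_lambda _ fun j =>
      ((measurable_pi_apply _).comp measurable_snd).div_const _) measurable_const measurable_const
    (fun _ _ _ => rfl) (fun _ _ _ => rfl) (fun _ _ _ => rfl)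
    (fun ω q hq => by simp only [distProfile, not_lt.2 hq, dite_false])
    (fun ω => by
      rw [mul_div_cancel₀ _ hε.ne']
      refine sum_abs_sub_le_of_adjacent h (distProfile Q) _ (by positivity) fun x y => ?_
      refine (Finset.sum_le_card_nsmul _ _ Δ fun q _ => ?_).trans (by simp)
      have h1 := hprof x q
      have h2 := hprof y q
      rw [abs_le]
      constructor <;> linarith) hS
  rw [ENNReal.ofReal_zero, add_zero]
  exact this

theorem trials_pos {β : ℝ} (hk : 1 ≤ k) (hβ0 : 0 < β) (hβ1 : β < 1) : 0 < trials k β := by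
  have hk' : (1 : ℝ) ≤ k := by exact_mod_cast hk
  refine lt_min (by omega) (Nat.ceil_pos.2 (Real.log_pos ?_))
  rw [lt_div_iff₀ hβ0]
  linarith

/-- The branch is the same for both databases, so it suffices to treat each branch separately. -/
theorem isDP_prog {ε β Δ : ℝ} (δ : ℝ) (hk : 1 ≤ k) (hε : 0 < ε) (hβ0 : 0 < β) (hβ1 : β < 1)
    (hΔ : 0 < Δ) (hX : ∀ x y : X, dist x y ≤ Δ) :
    IsDP (DistanceProgram.prog.mechanism ε δ β Δ : Mechanism X n k) ε 0 := by
  intro D D' h Q S hS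
  simp only [mechanism_prog]
  split_ifs
  · refine le_add_right ?_
    calc _ = 1 * _ := (one_mul _).symm
      _ ≤ _ := mul_le_mul' (ENNReal.one_le_ofReal.2 (Real.one_le_exp hε.le)) le_rfl
  · exact isDP_treeMechanism Δ hε (trials_pos hk hβ0 hβ1) (min_le_left _ _) D D' h Q S hS
  · exact isDP_naiveMechanism hε hΔ hk hX D D' h Q S hS

end Privacy

/-! ## Accuracy of the random partitions -/

section Accuracy

variable {X : Type u} [MetricSpace X] {n k : ℕ}

/-- The total weight of the levels on which trial `t` separates `x` from `y`. -/
noncomputable def sepCost (Q : Fin k → X) (Δ : ℝ) (L : ℕ) (u : ℕ → ℝ) (t : ℕ) (x y : X) : ℝ :=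
  ∑ i ∈ Finset.range L,
    Δ / 2 ^ i * (if tapeCluster Q Δ u t i x ≠ tapeCluster Q Δ u t i y then 1 else 0)

/-- Two points sharing a center on scale `s` are both within `2 * s` of it, so their distance is at
most `4 * s`. This holds for every outcome of the randomness. -/
theorem dist_div_le_sepCost {Q : Fin k → X} {Δ : ℝ} (hΔ : 0 < Δ) (hX : ∀ x y : X, dist x y ≤ Δ)
    (L : ℕ) (ω : ℕ → unitInterval) (t : ℕ) (x : X) (j : Fin k) :
    dist x (Q j) / 8 ≤ sepCost Q Δ L (realTape ω) t x (Q j) + Δ / 2 ^ L := by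
  refine le_sum_scales (hX _ _) hΔ.le _ L fun i _ hd heq => ?_
  set r := (1 + realTape ω (t * (k + 1) + k)) * (Δ / 2 ^ i) with hr
  have hs : 0 < Δ / 2 ^ i := by positivity
  have h0 : 0 ≤ realTape ω (t * (k + 1) + k) := (ω _).2.1
  have h1 : realTape ω (t * (k + 1) + k) ≤ 1 := (ω _).2.2
  have hr0 : 0 ≤ r := by positivity
  have hr1 : r ≤ 2 * (Δ / 2 ^ i) := mul_le_mul_of_nonneg_right (by linarith) hs.le
  -- A query captures itself at distance `0`, so it never gets the dummy cluster `k`, whose members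
  -- need not be close to each other.
  have hlt : tapeCluster Q Δ (realTape ω) t i (Q j) < k :=
    center_lt_of_le j.2 (by rw [distProfile_of_lt Q _ j.2, dist_self]; exact hr0)
  have hy : distProfile Q (Q j) (tapeCluster Q Δ (realTape ω) t i (Q j)) ≤ r :=
    apply_center_le hlt
  have hx : distProfile Q x (tapeCluster Q Δ (realTape ω) t i x) ≤ r :=
    apply_center_le (show tapeCluster Q Δ (realTape ω) t i x < k by rwa [heq])
  rw [heq] at hx
  rw [distProfile_of_lt Q _ hlt] at hx hy
  have := dist_triangle_right x (Q j) (Q ⟨_, hlt⟩)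
  linarith

/-- The event that candidate `w` separates `x` from `y` on level `i` of trial `t`. -/
def sepEvent (Q : Fin k → X) (Δ : ℝ) (t i : ℕ) (x y : X) (w : ℕ) : Set (ℕ → unitInterval) :=
  {ω | ω (t * (k + 1) + k) ∈ {v : unitInterval |
      min (distProfile Q x w) (distProfile Q y w) ≤ (1 + v) * (Δ / 2 ^ i) ∧
      (1 + v) * (Δ / 2 ^ i) < max (distProfile Q x w) (distProfile Q y w)}} ∩
  {ω | ∀ q ∈ (((Finset.range k).filter fun w' => min (distProfile Q x w') (distProfile Q y w') ≤
      min (distProfile Q x w) (distProfile Q y w)).erase w).map (addLeftEmbedding (t * (k + 1))),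
    ω (t * (k + 1) + w) ≤ ω q}

theorem measurableSet_dilation (a b s : ℝ) :
    MeasurableSet {v : unitInterval | a ≤ (1 + v) * s ∧ (1 + v) * s < b} := by
  have : Measurable fun v : unitInterval => (1 + (v : ℝ)) * s :=
    (measurable_const.add measurable_subtype_coe).mul_const s
  exact (measurableSet_le measurable_const this).inter (measurableSet_lt this measurable_const)

theorem measurableSet_coord_dilation (p : ℕ) (a b s : ℝ) :
    MeasurableSet {ω : ℕ → unitInterval | ω p ∈
      {v : unitInterval | a ≤ (1 + v) * s ∧ (1 + v) * s < b}} :=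
  measurable_pi_apply p (measurableSet_dilation a b s)

theorem measurableSet_sepEvent (Q : Fin k → X) (Δ : ℝ) (t i : ℕ) (x y : X) (w : ℕ) :
    MeasurableSet (sepEvent Q Δ t i x y w) :=
  (measurableSet_coord_dilation _ _ _ _).inter (measurableSet_forall_coord_le _ _)

/-- The radius sits in cell `k` of the trial's block and the priorities in cells below `k`, so the
two conditions are independent. The second has probability one over the rank of `w`. -/
theorem tapeLaw_sepEvent_le (Q : Fin k → X) (Δ : ℝ) (t i : ℕ) (x y : X) {w : ℕ} (hw : w < k) :
    tapeLaw (sepEvent Q Δ t i x y w) ≤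
      volume {v : unitInterval |
        min (distProfile Q x w) (distProfile Q y w) ≤ (1 + v) * (Δ / 2 ^ i) ∧
        (1 + v) * (Δ / 2 ^ i) < max (distProfile Q x w) (distProfile Q y w)} *
      ENNReal.ofReal (1 / ((Finset.range k).filter fun w' =>
        min (distProfile Q x w') (distProfile Q y w') ≤
          min (distProfile Q x w) (distProfile Q y w)).card) := by
  set s := (Finset.range k).filter fun w' => min (distProfile Q x w') (distProfile Q y w') ≤
          min (distProfile Q x w) (distProfile Q y w) with hs
  have hws : w ∈ s := by simp [hs, hw]
  have hlt : ∀ w' ∈ s, w' < k := fun w' h => Finset.mem_range.1 (Finset.mem_filter.1 h).1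
  rw [sepEvent, tapeLaw_inter_eq_mul {t * (k + 1) + k}
    (measurableSet_coord_dilation _ _ _ _) (measurableSet_forall_coord_le _ _),
    tapeLaw_coord_mem _ (measurableSet_dilation _ _ _)]
  · refine mul_le_mul' le_rfl ((tapeLaw_coord_le_forall _ _ ?_).trans (le_of_eq ?_))
    · simp
    · rw [Finset.card_map, Finset.card_erase_of_mem hws,
        Nat.cast_sub (Finset.card_pos.2 ⟨w, hws⟩)]
      simp
  · intro ω ω' h hω
    simp only [Set.mem_singleton_iff, forall_eq] at h
    rwa [Set.mem_ofPred_eq, ← h]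
  · intro ω ω' h hω q hq
    rw [← h, ← h]
    · exact hω q hq
    · obtain ⟨w', hw', rfl⟩ := Finset.mem_map.1 hq
      have := hlt w' (Finset.mem_erase.1 hw').2
      simp only [addLeftEmbedding_apply, Set.mem_singleton_iff]
      omega
    · simp only [Set.mem_singleton_iff]
      omega

/-- A measurable upper bound for `sepCost`. -/
noncomputable def sepBound (Q : Fin k → X) (Δ : ℝ) (L t : ℕ) (x y : X) (ω : ℕ → unitInterval) :
    ENNReal :=
  ∑ i ∈ Finset.range L, ENNReal.ofReal (Δ / 2 ^ i) *
    ∑ w ∈ Finset.range k, (sepEvent Q Δ t i x y w).indicator 1 ω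

theorem measurable_sepBound (Q : Fin k → X) (Δ : ℝ) (L t : ℕ) (x y : X) :
    Measurable (sepBound Q Δ L t x y) :=
  Finset.measurable_fun_sum _ fun i _ => measurable_const.mul
    (Finset.measurable_fun_sum _ fun w _ =>
      measurable_one.indicator (measurableSet_sepEvent Q Δ t i x y w))

/-- A union bound over the possible witnesses of a separation. -/
theorem ofReal_sepCost_le {Q : Fin k → X} {Δ : ℝ} (hΔ : 0 < Δ) (L t : ℕ) (x y : X)
    (ω : ℕ → unitInterval) :
    ENNReal.ofReal (sepCost Q Δ L (realTape ω) t x y) ≤ sepBound Q Δ L t x y ω := by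
  rw [sepCost, ENNReal.ofReal_sum_of_nonneg fun i _ => by positivity]
  refine Finset.sum_le_sum fun i _ => ?_
  rw [ENNReal.ofReal_mul (by positivity)]
  refine mul_le_mul' le_rfl ?_
  split_ifs with h
  · obtain ⟨w, hw, h1, h2, h3⟩ := exists_witness_of_center_ne h
    refine le_trans ?_ (Finset.single_le_sum (f := fun w =>
      (sepEvent Q Δ t i x y w).indicator (1 : (ℕ → unitInterval) → ENNReal) ω)
      (fun _ _ => zero_le) (Finset.mem_range.2 hw))
    have hmem : ω ∈ sepEvent Q Δ t i x y w := by
      refine ⟨⟨h1, h2⟩, fun q hq => ?_⟩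
      obtain ⟨w', hw', rfl⟩ := Finset.mem_map.1 hq
      have hw'' := Finset.mem_filter.1 (Finset.mem_erase.1 hw').2
      exact h3 w' (Finset.mem_range.1 hw''.1) hw''.2
    simp [Set.indicator_of_mem hmem]
  · simp

/-- The rank of a candidate does not depend on the level, so the sums can be exchanged. For fixed
`w` the scales together contribute at most `|dist x w - dist y w| ≤ dist x y`, and what remains is
the sum of reciprocal ranks. -/
theorem lintegral_sepBound_le {Q : Fin k → X} {Δ : ℝ} (hΔ : 0 < Δ) (L t : ℕ) (x y : X) :
    ∫⁻ ω, sepBound Q Δ L t x y ω ∂tapeLaw ≤ ENNReal.ofReal ((1 + Real.log k) * dist x y) := by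
  have hlog : (0 : ℝ) ≤ Real.log k := Real.log_natCast_nonneg k
  set a : ℕ → ℝ := fun w => min (distProfile Q x w) (distProfile Q y w) with ha
  set b : ℕ → ℝ := fun w => max (distProfile Q x w) (distProfile Q y w) with hb
  have hab : ∀ w ∈ Finset.range k, b w - a w ≤ dist x y := by
    intro w hw
    rw [Finset.mem_range] at hw
    simp only [ha, hb]
    rw [max_sub_min_eq_abs', distProfile_of_lt Q _ hw, distProfile_of_lt Q _ hw]
    exact abs_dist_sub_le _ _ _
  calc ∫⁻ ω, sepBound Q Δ L t x y ω ∂tapeLaw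
      = ∑ i ∈ Finset.range L, ENNReal.ofReal (Δ / 2 ^ i) *
          ∑ w ∈ Finset.range k, tapeLaw (sepEvent Q Δ t i x y w) := by
        have hm : ∀ i w, Measurable fun ω =>
            (sepEvent Q Δ t i x y w).indicator (1 : (ℕ → unitInterval) → ENNReal) ω :=
          fun i w => measurable_one.indicator (measurableSet_sepEvent Q Δ t i x y w)
        have hms : ∀ i, Measurable fun ω => ∑ w ∈ Finset.range k,
            (sepEvent Q Δ t i x y w).indicator (1 : (ℕ → unitInterval) → ENNReal) ω :=
          fun i => Finset.measurable_fun_sum _ fun w _ => hm i w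
        have hmt : ∀ i, Measurable fun ω => ENNReal.ofReal (Δ / 2 ^ i) * ∑ w ∈ Finset.range k,
            (sepEvent Q Δ t i x y w).indicator (1 : (ℕ → unitInterval) → ENNReal) ω :=
          fun i => (hms i).const_mul _
        simp only [sepBound]
        rw [lintegral_finsetSum _ fun i _ => hmt i]
        refine Finset.sum_congr rfl fun i _ => ?_
        rw [lintegral_const_mul _ (hms i), lintegral_finsetSum _ fun w _ => hm i w]
        congr 1
        exact Finset.sum_congr rfl fun w _ =>
          lintegral_indicator_one (measurableSet_sepEvent Q Δ t i x y w)
    _ ≤ ∑ i ∈ Finset.range L, ENNReal.ofReal (Δ / 2 ^ i) * ∑ w ∈ Finset.range k,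
          (volume {v : unitInterval | a w ≤ (1 + v) * (Δ / 2 ^ i) ∧ (1 + v) * (Δ / 2 ^ i) < b w} *
          ENNReal.ofReal (1 / ((Finset.range k).filter fun w' => a w' ≤ a w).card)) :=
        Finset.sum_le_sum fun i _ => mul_le_mul' le_rfl (Finset.sum_le_sum fun w hw =>
          tapeLaw_sepEvent_le Q Δ t i x y (Finset.mem_range.1 hw))
    _ = ∑ w ∈ Finset.range k, (∑ i ∈ Finset.range L, ENNReal.ofReal (Δ / 2 ^ i) *
          volume {v : unitInterval | a w ≤ (1 + v) * (Δ / 2 ^ i) ∧ (1 + v) * (Δ / 2 ^ i) < b w}) *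
          ENNReal.ofReal (1 / ((Finset.range k).filter fun w' => a w' ≤ a w).card) := by
        simp only [Finset.mul_sum, Finset.sum_mul, mul_assoc]
        exact Finset.sum_comm
    _ ≤ ∑ w ∈ Finset.range k, ENNReal.ofReal (dist x y) *
          ENNReal.ofReal (1 / ((Finset.range k).filter fun w' => a w' ≤ a w).card) :=
        Finset.sum_le_sum fun w hw => mul_le_mul' ((sum_dilation_le hΔ min_le_max L).trans
          (ENNReal.ofReal_le_ofReal (hab w hw))) le_rfl
    _ = ENNReal.ofReal (dist x y) * ENNReal.ofReal (∑ w ∈ Finset.range k,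
          1 / (((Finset.range k).filter fun w' => a w' ≤ a w).card : ℝ)) := by
        rw [← Finset.mul_sum, ENNReal.ofReal_sum_of_nonneg fun w _ => by positivity]
    _ ≤ _ := by
        rw [← ENNReal.ofReal_mul dist_nonneg, mul_comm]
        refine ENNReal.ofReal_le_ofReal (mul_le_mul_of_nonneg_right ?_ dist_nonneg)
        have h1 := sum_inv_card_filter_le_harmonic a (Finset.range k)
        rw [Finset.card_range] at h1
        exact h1.trans (sum_one_div_succ_le k)

theorem sepBound_congr {Q : Fin k → X} {Δ : ℝ} {L t : ℕ} {x y : X} {ω ω' : ℕ → unitInterval}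
    (h : ∀ w ≤ k, ω (t * (k + 1) + w) = ω' (t * (k + 1) + w)) :
    sepBound Q Δ L t x y ω = sepBound Q Δ L t x y ω' := by
  classical
  refine Finset.sum_congr rfl fun i _ => ?_
  congr 1
  refine Finset.sum_congr rfl fun w hw => ?_
  rw [Finset.mem_range] at hw
  have : ω ∈ sepEvent Q Δ t i x y w ↔ ω' ∈ sepEvent Q Δ t i x y w := by
    rw [sepEvent, Set.mem_inter_iff, Set.mem_inter_iff, Set.mem_ofPred_eq, Set.mem_ofPred_eq,
      Set.mem_ofPred_eq, Set.mem_ofPred_eq, h k le_rfl]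
    refine and_congr_right fun _ => forall₂_congr fun q hq => ?_
    obtain ⟨w', hw', rfl⟩ := Finset.mem_map.1 hq
    have hw'' := Finset.mem_range.1 (Finset.mem_filter.1 (Finset.mem_erase.1 hw').2).1
    rw [addLeftEmbedding_apply, h w hw.le, h w' hw''.le]
  simp only [Set.indicator, this, Pi.one_apply]

/-- The event that trial `t` badly overestimates the answer to the query `y`. -/
def failEvent (Q : Fin k → X) (Δ η : ℝ) (L : ℕ) (D : Fin n → X) (y : X) (t : ℕ) :
    Set (ℕ → unitInterval) :=
  {ω | ENNReal.ofReal (3 * ((1 + Real.log k) * ∑ i, dist (D i) y + η)) ≤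
    ∑ i, sepBound Q Δ L t (D i) y ω}

theorem measurableSet_failEvent (Q : Fin k → X) (Δ η : ℝ) (L : ℕ) (D : Fin n → X) (y : X)
    (t : ℕ) : MeasurableSet (failEvent Q Δ η L D y t) :=
  measurableSet_le measurable_const
    (Finset.measurable_fun_sum _ fun i _ => measurable_sepBound Q Δ L t (D i) y)

/-- Markov's inequality. The slack `η > 0` keeps the threshold positive, hence cancellable, even if
all distances vanish. -/
theorem tapeLaw_failEvent_le {Q : Fin k → X} {Δ η : ℝ} (hΔ : 0 < Δ) (hη : 0 < η) (L : ℕ)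
    (D : Fin n → X) (y : X) (t : ℕ) :
    tapeLaw (failEvent Q Δ η L D y t) ≤ ENNReal.ofReal (1 / 3) := by
  have hlog : (0 : ℝ) ≤ Real.log k := Real.log_natCast_nonneg k
  set B : ℝ := (1 + Real.log k) * ∑ i, dist (D i) y + η with hB
  have hBpos : 0 < B := by
    have : 0 ≤ (1 + Real.log k) * ∑ i, dist (D i) y :=
      mul_nonneg (by linarith) (Finset.sum_nonneg fun _ _ => dist_nonneg)
    linarith
  have hint : ∫⁻ ω, ∑ i, sepBound Q Δ L t (D i) y ω ∂tapeLaw ≤ ENNReal.ofReal B := by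
    rw [lintegral_finsetSum _ fun i _ => measurable_sepBound Q Δ L t (D i) y]
    refine (Finset.sum_le_sum fun i _ => lintegral_sepBound_le hΔ L t (D i) y).trans ?_
    rw [← ENNReal.ofReal_sum_of_nonneg fun i _ => mul_nonneg (by linarith) dist_nonneg,
      ← Finset.mul_sum]
    exact ENNReal.ofReal_le_ofReal (by linarith)
  have hmk := (mul_meas_ge_le_lintegral (μ := tapeLaw)
    (Finset.measurable_fun_sum Finset.univ fun i _ => measurable_sepBound Q Δ L t (D i) y)
    (ENNReal.ofReal (3 * B))).trans hint
  have h3 : ENNReal.ofReal B = ENNReal.ofReal (3 * B) * ENNReal.ofReal (1 / 3) := by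
    rw [← ENNReal.ofReal_mul (by positivity)]
    congr 1; ring
  rw [h3] at hmk
  exact (ENNReal.mul_le_mul_iff_right (by simpa using hBpos) ENNReal.ofReal_ne_top).1 hmk

/-- All trials fail with a probability that is exponentially small. -/
theorem tapeLaw_forall_failEvent_le {Q : Fin k → X} {Δ η : ℝ} (hΔ : 0 < Δ) (hη : 0 < η) (L : ℕ)
    (D : Fin n → X) (y : X) (T : ℕ) :
    tapeLaw {ω | ∀ t < T, ω ∈ failEvent Q Δ η L D y t} ≤ ENNReal.ofReal (1 / 3) ^ T := by
  have hmeas : ∀ T, MeasurableSet {ω | ∀ t < T, ω ∈ failEvent Q Δ η L D y t} := by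
    intro T
    have : {ω | ∀ t < T, ω ∈ failEvent Q Δ η L D y t} =
        ⋂ t ∈ Finset.range T, failEvent Q Δ η L D y t := by ext; simp
    rw [this]
    exact Finset.measurableSet_biInter _ fun t _ => measurableSet_failEvent Q Δ η L D y t
  have hcongr : ∀ t (ω ω' : ℕ → unitInterval),
      (∀ w ≤ k, ω (t * (k + 1) + w) = ω' (t * (k + 1) + w)) →
      ω ∈ failEvent Q Δ η L D y t → ω' ∈ failEvent Q Δ η L D y t := by
    intro t ω ω' h hω
    rw [failEvent, Set.mem_ofPred_eq] at hω ⊢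
    simpa only [sepBound_congr h] using hω
  induction T with
  | zero => simp
  | succ T ih =>
    have : {ω | ∀ t < T + 1, ω ∈ failEvent Q Δ η L D y t} =
        {ω | ∀ t < T, ω ∈ failEvent Q Δ η L D y t} ∩ failEvent Q Δ η L D y T := by
      ext ω
      simp only [Set.mem_ofPred_eq, Set.mem_inter_iff, Nat.forall_lt_succ_right]
    -- Trials use disjoint blocks of `k + 1` cells, so trial `T` is independent of the earlier ones.
    rw [this, tapeLaw_inter_eq_mul {q | q < T * (k + 1)} (hmeas T)
      (measurableSet_failEvent Q Δ η L D y T), pow_succ]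
    · exact mul_le_mul' ih (tapeLaw_failEvent_le hΔ hη L D y T)
    · intro ω ω' h hω t ht
      exact hcongr t ω ω' (fun w hw => h _ (trial_pos_lt ht hw)) (hω t ht)
    · intro ω ω' h hω
      refine hcongr T ω ω' (fun w hw => h _ ?_) hω
      simp

theorem tapeLaw_noise_tail_le (N m : ℕ) (τ : ℝ) :
    tapeLaw {ω | ∃ q < m, τ < |logit (ω (N + q))|} ≤
      ENNReal.ofReal (m * (2 * Real.exp (-τ))) := by
  have : {ω : ℕ → unitInterval | ∃ q < m, τ < |logit (ω (N + q))|} ⊆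
      ⋃ q ∈ Finset.range m, {ω | τ < |logit (ω (N + q))|} := by
    intro ω h; simpa using h
  refine (measure_mono this).trans ((measure_biUnion_finset_le _ _).trans ?_)
  refine (Finset.sum_le_card_nsmul _ _ _ fun q _ => tapeLaw_logit_tail (N + q) τ).trans ?_
  rw [Finset.card_range, nsmul_eq_mul, ENNReal.ofReal_mul (p := (m : ℝ)) (by positivity), ENNReal.ofReal_natCast]

theorem ofReal_one_sub_le_tapeLaw {β : ℝ} (hβ : 0 ≤ β) {B G : Set (ℕ → unitInterval)}
    (hB : tapeLaw B ≤ ENNReal.ofReal β) (h : ∀ ω ∉ B, ω ∈ G) :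
    ENNReal.ofReal (1 - β) ≤ tapeLaw G := by
  rw [ENNReal.ofReal_sub _ hβ, ENNReal.ofReal_one, tsub_le_iff_right]
  calc (1 : ENNReal) = tapeLaw Set.univ := measure_univ.symm
    _ ≤ tapeLaw (G ∪ B) := measure_mono fun ω _ => by
        by_cases hω : ω ∈ B
        exacts [Or.inr hω, Or.inl (h ω hω)]
    _ ≤ tapeLaw G + tapeLaw B := measure_union_le _ _
    _ ≤ _ := by gcongr

end Accuracy

/-! ## Accuracy of the mechanism -/

theorem minUpTo_le {f : ℕ → ℝ} {m t : ℕ} (ht : t < m) : DistanceProgram.minUpTo f m ≤ f t := by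
  induction m with
  | zero => omega
  | succ m ih =>
    rw [DistanceProgram.minUpTo]
    split_ifs with h
    · rcases Nat.lt_succ_iff_lt_or_eq.1 ht with h1 | rfl
      · exact (min_le_left _ _).trans (ih h1)
      · exact min_le_right _ _
    · obtain rfl : t = m := by omega
      exact le_rfl

theorem le_minUpTo {f : ℕ → ℝ} {m : ℕ} {a : ℝ} (hm : 0 < m) (h : ∀ t < m, a ≤ f t) :
    a ≤ DistanceProgram.minUpTo f m := by
  induction m with
  | zero => omega
  | succ m ih =>
    rw [DistanceProgram.minUpTo]
    split_ifs with h0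
    · exact le_min (ih h0 fun t ht => h t (by omega)) (h m (by omega))
    · exact h m (by omega)

theorem one_le_log_inv_failure {n k : ℕ} {β : ℝ} (hn : 1 ≤ n) (hk : 1 ≤ k) (hβ0 : 0 < β)
    (hβ1 : β < 1) : 1 ≤ Real.log (4 * n * k / β) ∧
      Real.exp (-Real.log (4 * n * k / β)) = β / (4 * n * k) := by
  have hn' : (1 : ℝ) ≤ n := by exact_mod_cast hn
  have hk' : (1 : ℝ) ≤ k := by exact_mod_cast hk
  have hnk : (1 : ℝ) ≤ n * k := by nlinarith
  have harg : 4 ≤ 4 * n * k / β := by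
    rw [le_div_iff₀ hβ0]; nlinarith
  constructor
  · rw [Real.le_log_iff_exp_le (by linarith)]
    linarith [Real.exp_one_lt_d9]
  · rw [Real.exp_neg, Real.exp_log (by linarith), inv_div]

section Accuracy

variable {X : Type u} [MetricSpace X] {n k : ℕ}

theorem abs_naiveMechanism_sub_le {Δ ε τ : ℝ} (hε : 0 < ε) (hΔ : 0 < Δ) (D : Fin n → X)
    (Q : Fin k → X) {ω : ℕ → unitInterval} (hω : ∀ q < k, |logit (ω (0 + q))| ≤ τ) (j : Fin k) :
    |naiveMechanism Δ ε D Q ω j - avgDist D (Q j)| ≤ k * Δ * τ / (n * ε) := by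
  have e : naiveMechanism Δ ε D Q ω j - avgDist D (Q j) =
      k * Δ / (n * ε) * logit (ω (0 + j)) := by
    simp only [naiveMechanism, noisyOutput, avgDist, distProfile_of_lt Q _ j.2, Fin.eta]
    rcases eq_or_ne (n : ℝ) 0 with h | h
    · simp [h]
    · field_simp; ring
  rw [e, abs_mul, abs_of_nonneg (by positivity),
    show k * Δ * τ / (n * ε) = k * Δ / (n * ε) * τ by ring]
  exact mul_le_mul_of_nonneg_left (hω j j.2) (by positivity)

/-- One minus the fraction of data in the query's cluster is the fraction separated from it, so
without noise the estimate is exactly the mean separation cost. The level weights sum to at most `2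
* Δ`, which turns the noise scale `16 * T ^ 2 / ε` into the constant `32`. -/
theorem abs_treeEstimate_sub_le {Δ ε τ : ℝ} (hn : 0 < n) (hε : 0 < ε) (hΔ : 0 < Δ) {T t : ℕ}
    (D : Fin n → X) (Q : Fin k → X) {ω : ℕ → unitInterval} (ht : t < T)
    (hω : ∀ q < T * (8 * T) * (k + 1), |logit (ω (3 * k * (k + 1) + q))| ≤ τ) (j : Fin k) :
    |∑ i ∈ Finset.range (8 * T), Δ / 2 ^ i * (1 - (∑ x, treeStat Q Δ T (realTape ω) (D x)
        ((t * (8 * T) + i) * (k + 1) + tapeCluster Q Δ (realTape ω) t i (Q j)) +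
        ((16 * (T * T) : ℕ) : ℝ) / ε * logit (ω (3 * k * (k + 1) + ((t * (8 * T) + i) * (k + 1) +
          tapeCluster Q Δ (realTape ω) t i (Q j))))) / n) -
      (∑ x, sepCost Q Δ (8 * T) (realTape ω) t (D x) (Q j)) / n| ≤
      32 * (T : ℝ) ^ 2 * τ * (Δ / (n * ε)) := by
  have hn' : (0 : ℝ) < n := by exact_mod_cast hn
  have hτ : 0 ≤ τ := (abs_nonneg _).trans (hω 0 (by
    have := Nat.pos_of_ne_zero (show T ≠ 0 by omega); positivity))
  have e : ∀ i ∈ Finset.range (8 * T), Δ / 2 ^ i * (1 - (∑ x, treeStat Q Δ T (realTape ω) (D x)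
        ((t * (8 * T) + i) * (k + 1) + tapeCluster Q Δ (realTape ω) t i (Q j)) +
        ((16 * (T * T) : ℕ) : ℝ) / ε * logit (ω (3 * k * (k + 1) + ((t * (8 * T) + i) * (k + 1) +
          tapeCluster Q Δ (realTape ω) t i (Q j))))) / n) =
      (∑ x, Δ / 2 ^ i * (if tapeCluster Q Δ (realTape ω) t i (D x) ≠
        tapeCluster Q Δ (realTape ω) t i (Q j) then (1 : ℝ) else 0)) / n -
      Δ / 2 ^ i * (16 * (T : ℝ) ^ 2 / (n * ε) *
        logit (ω (3 * k * (k + 1) + ((t * (8 * T) + i) * (k + 1) +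
          tapeCluster Q Δ (realTape ω) t i (Q j))))) := by
    intro i hi
    rw [Finset.mem_range] at hi
    have h1 : ∀ x, treeStat Q Δ T (realTape ω) (D x)
        ((t * (8 * T) + i) * (k + 1) + tapeCluster Q Δ (realTape ω) t i (Q j)) =
        1 - (if tapeCluster Q Δ (realTape ω) t i (D x) ≠
          tapeCluster Q Δ (realTape ω) t i (Q j) then (1 : ℝ) else 0) := by
      intro x
      rw [treeStat_cell Q Δ _ _ ht hi (tapeCluster_le _ _ _ _ _ _)]
      by_cases h : tapeCluster Q Δ (realTape ω) t i (D x) =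
        tapeCluster Q Δ (realTape ω) t i (Q j) <;> simp [h]
    simp only [h1]
    rw [Finset.sum_sub_distrib, Finset.sum_const, Finset.card_univ, Fintype.card_fin, nsmul_eq_mul,
      ← Finset.mul_sum]
    push_cast
    field_simp
    ring
  rw [Finset.sum_congr rfl e, Finset.sum_sub_distrib, ← Finset.sum_div, Finset.sum_comm]
  simp only [sepCost]
  rw [sub_sub_cancel_left, abs_neg]
  refine (Finset.abs_sum_le_sum_abs _ _).trans ?_
  have h2 : ∀ i ∈ Finset.range (8 * T), |Δ / 2 ^ i * (16 * (T : ℝ) ^ 2 / (n * ε) *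
        logit (ω (3 * k * (k + 1) + ((t * (8 * T) + i) * (k + 1) +
          tapeCluster Q Δ (realTape ω) t i (Q j)))))| ≤
      Δ / 2 ^ i * (16 * (T : ℝ) ^ 2 / (n * ε) * τ) := by
    intro i hi
    rw [Finset.mem_range] at hi
    rw [abs_mul, abs_mul, abs_of_nonneg (show 0 ≤ Δ / 2 ^ i by positivity),
      abs_of_nonneg (show 0 ≤ 16 * (T : ℝ) ^ 2 / (n * ε) by positivity)]
    gcongr
    exact hω _ (cell_pos_lt ht hi (tapeCluster_le _ _ _ _ _ _))
  refine (Finset.sum_le_sum h2).trans ?_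
  rw [← Finset.sum_mul]
  refine (mul_le_mul_of_nonneg_right (sum_scales_le hΔ.le _) (by positivity)).trans (le_of_eq ?_)
  field_simp
  ring

/-- The lower bound holds in every trial and so survives the minimum; the upper bound needs a single
trial that does not fail. The slack `Δ / ε` in the failure event becomes `3 * (Δ / (n * ε))` after
averaging. -/
theorem treeMechanism_bounds {Δ ε τ : ℝ} (hn : 0 < n) (hk : 0 < k) (hε : 0 < ε) (hΔ : 0 < Δ)
    (hX : ∀ x y : X, dist x y ≤ Δ) {T : ℕ} (hT : 0 < T) (D : Fin n → X) (Q : Fin k → X)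
    {ω : ℕ → unitInterval}
    (hω : ∀ q < T * (8 * T) * (k + 1), |logit (ω (3 * k * (k + 1) + q))| ≤ τ) (j : Fin k)
    (hfail : ∃ t < T, ω ∉ failEvent Q Δ (Δ / ε) (8 * T) D (Q j) t) :
    1 / 72 / Real.log (k + 1) * avgDist D (Q j) -
        (Δ / 2 ^ (8 * T) + 32 * (T : ℝ) ^ 2 * τ * (Δ / (n * ε))) ≤ treeMechanism Δ ε T D Q ω j ∧
    treeMechanism Δ ε T D Q ω j ≤
      avgDist D (Q j) + (3 * (Δ / (n * ε)) + 32 * (T : ℝ) ^ 2 * τ * (Δ / (n * ε))) := by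
  have hn' : (0 : ℝ) < n := by exact_mod_cast hn
  have hk' : (1 : ℝ) ≤ k := by exact_mod_cast hk
  have hτ : 0 ≤ τ := (abs_nonneg _).trans (hω 0 (by positivity))
  set l := Real.log (k + 1) with hl
  have hl2 : 2 / 3 ≤ l := by
    have h2 : Real.log 2 ≤ l := Real.log_le_log (by norm_num) (by linarith)
    have := Real.log_two_gt_d9
    linarith
  have hlk : 1 + Real.log k ≤ 3 * l := by
    have : Real.log k ≤ l := Real.log_le_log (by linarith) (by linarith)
    linarith
  have hlogk : 0 ≤ Real.log k := Real.log_nonneg hk'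
  set A := avgDist D (Q j) with hA
  have hAS : ∑ x, dist (D x) (Q j) = n * A := by
    rw [hA, avgDist]; field_simp
  have hA0 : 0 ≤ A := by
    rw [hA, avgDist]; exact mul_nonneg (by positivity) (Finset.sum_nonneg fun _ _ => dist_nonneg)
  set E := 32 * (T : ℝ) ^ 2 * τ * (Δ / (n * ε)) with hE
  have hE0 : 0 ≤ E := by positivity
  have hest := fun t ht => abs_treeEstimate_sub_le hn hε hΔ D Q (T := T) (t := t) ht hω j
  have hlow : A / 8 - Δ / 2 ^ (8 * T) - E ≤ 9 * l * treeMechanism Δ ε T D Q ω j := by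
    rw [treeMechanism, noisyOutput, treePost, mul_div_cancel₀ _ (by positivity)]
    refine le_minUpTo hT fun t ht => ?_
    have h1 := (abs_le.1 (hest t ht)).1
    have h2 : A / 8 - Δ / 2 ^ (8 * T) ≤
        (∑ x, sepCost Q Δ (8 * T) (realTape ω) t (D x) (Q j)) / n := by
      rw [le_div_iff₀ hn']
      have h3 : ∑ x, dist (D x) (Q j) / 8 ≤
          ∑ x, (sepCost Q Δ (8 * T) (realTape ω) t (D x) (Q j) + Δ / 2 ^ (8 * T)) :=
        Finset.sum_le_sum fun x _ => dist_div_le_sepCost hΔ hX (8 * T) ω t (D x) j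
      rw [Finset.sum_add_distrib, Finset.sum_const, Finset.card_univ, Fintype.card_fin,
        nsmul_eq_mul, ← Finset.sum_div, hAS] at h3
      linarith
    linarith
  have hup : 9 * l * treeMechanism Δ ε T D Q ω j ≤ 9 * l * A + 3 * (Δ / (n * ε)) + E := by
    rw [treeMechanism, noisyOutput, treePost, mul_div_cancel₀ _ (by positivity)]
    obtain ⟨t, ht, hft⟩ := hfail
    refine (minUpTo_le ht).trans ?_
    have h1 := (abs_le.1 (hest t ht)).2
    have h2 : (∑ x, sepCost Q Δ (8 * T) (realTape ω) t (D x) (Q j)) / n ≤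
        9 * l * A + 3 * (Δ / (n * ε)) := by
      rw [failEvent, Set.mem_ofPred_eq, not_le] at hft
      have h3 : ENNReal.ofReal (∑ x, sepCost Q Δ (8 * T) (realTape ω) t (D x) (Q j)) ≤
          ∑ x, sepBound Q Δ (8 * T) t (D x) (Q j) ω := by
        rw [ENNReal.ofReal_sum_of_nonneg fun x _ => by unfold sepCost; positivity]
        exact Finset.sum_le_sum fun x _ => ofReal_sepCost_le hΔ _ _ _ _ _
      have h4 := (ENNReal.ofReal_lt_ofReal_iff_of_nonneg
        (Finset.sum_nonneg fun x _ => by unfold sepCost; positivity)).1 (h3.trans_lt hft)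
      rw [div_le_iff₀ hn']
      rw [hAS] at h4
      have h5 : (1 + Real.log k) * (n * A) ≤ 3 * l * (n * A) :=
        mul_le_mul_of_nonneg_right hlk (by positivity)
      have h6 : Δ / (n * ε) * n = Δ / ε := by field_simp
      nlinarith
    linarith
  have hl0 : 0 < l := by linarith
  have h9 : 1 ≤ 9 * l := by linarith
  generalize treeMechanism Δ ε T D Q ω j = M at hlow hup
  have hP : 0 < Δ / 2 ^ (8 * T) := by positivity
  have hR : 0 < Δ / (n * ε) := by positivity
  constructor
  · refine le_of_mul_le_mul_left (le_trans ?_ hlow) (show 0 < 9 * l by linarith)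
    -- The constant `1 / 72` combines the deterministic loss of `8` with the divisor `9`.
    have : 9 * l * (1 / 72 / l * A) = A / 8 := by field_simp; ring
    rw [mul_sub, this]
    nlinarith
  · refine le_of_mul_le_mul_left (hup.trans ?_) (show 0 < 9 * l by linarith)
    nlinarith

/-- The trial count must be logarithmic, large enough for the union bound over queries, and such
that `8 * T` levels reach below `Δ / k ^ 5`. The last follows from `k ≤ exp T` and `exp 5 ≤ 2 ^ 8`.
-/
theorem trials_bounds {n k : ℕ} {β : ℝ} (hn : 1 ≤ n) (hk : 1 ≤ k) (hβ0 : 0 < β) (hβ1 : β < 1)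
    (hlog : Real.log (1 / β) < k) :
    (trials k β : ℝ) ≤ 2 * Real.log (4 * n * k / β) ∧
      2 * k / β ≤ Real.exp (trials k β) ∧ (k : ℝ) ^ 5 ≤ 2 ^ (8 * trials k β) := by
  have hn' : (1 : ℝ) ≤ n := by exact_mod_cast hn
  have hk' : (1 : ℝ) ≤ k := by exact_mod_cast hk
  have hnk : (1 : ℝ) ≤ n * k := by nlinarith
  have hΛ1 := (one_le_log_inv_failure hn hk hβ0 hβ1).1
  set Λ := Real.log (4 * n * k / β) with hΛ
  set T := trials k β with hT
  have hlog2 : Real.log (2 * k / β) ≤ Λ := by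
    refine Real.log_le_log (by positivity) ?_
    rw [div_le_div_iff_of_pos_right hβ0]
    nlinarith
  have hT2 : (T : ℝ) ≤ 2 * Λ := by
    have h1 : (T : ℝ) ≤ (⌈Real.log (2 * k / β)⌉₊ : ℝ) := by
      rw [hT, trials]; exact Nat.cast_le.2 (min_le_right _ _)
    have h2 := Nat.ceil_lt_add_one (a := Real.log (2 * k / β)) (Real.log_nonneg (by
      rw [le_div_iff₀ hβ0]; linarith))
    linarith
  have hTlog : Real.log (2 * k / β) ≤ T := by
    -- The cap `3 * k` is inactive here, because `log (2 * k) ≤ 2 * k - 1` and `log (1 / β) < k`.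
    have h1 : ⌈Real.log (2 * k / β)⌉₊ ≤ 3 * k := by
      rw [Nat.ceil_le, show 2 * k / β = 2 * k * (1 / β) by ring,
        Real.log_mul (by positivity) (by positivity)]
      have := Real.log_le_sub_one_of_pos (show (0 : ℝ) < 2 * k by positivity)
      push_cast
      linarith [hlog]
    rw [hT, trials, min_eq_right h1]
    exact Nat.le_ceil _
  have hTexp : 2 * k / β ≤ Real.exp T := (Real.log_le_iff_le_exp (by positivity)).1 hTlog
  have hkexp : (k : ℝ) ≤ Real.exp T := by
    refine le_trans ?_ hTexp
    rw [le_div_iff₀ hβ0]; nlinarith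
  refine ⟨hT2, hTexp, ?_⟩
  calc (k : ℝ) ^ 5 ≤ Real.exp T ^ 5 := pow_le_pow_left₀ (by positivity) hkexp 5
      _ = (Real.exp 1 ^ 5) ^ T := by
        rw [← Real.exp_nat_mul, ← Real.exp_nat_mul, ← Real.exp_nat_mul]
        congr 1; push_cast; ring
      _ ≤ (2 ^ 8) ^ T := by
        refine pow_le_pow_left₀ (by positivity) ?_ T
        calc Real.exp 1 ^ 5 ≤ 2.72 ^ 5 :=
              pow_le_pow_left₀ (Real.exp_pos 1).le (by linarith [Real.exp_one_lt_d9]) 5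
          _ ≤ 2 ^ 8 := by norm_num
      _ = 2 ^ (8 * T) := (pow_mul 2 8 T).symm

theorem tapeLaw_treeMechanism_ge {Δ ε β : ℝ} (hn : 1 ≤ n) (hk : 1 ≤ k) (hε : 0 < ε) (hβ0 : 0 < β)
    (hβ1 : β < 1) (hΔ : 0 < Δ) (hX : ∀ x y : X, dist x y ≤ Δ) (hx5 : n * ε < (k : ℝ) ^ 5)
    (hlog : Real.log (1 / β) < k) (D : Fin n → X) (Q : Fin k → X) :
    ENNReal.ofReal (1 - β) ≤ tapeLaw {ω | ∀ j,
      1 / 72 / Real.log (k + 1) * avgDist D (Q j) -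
          1000 * Real.log (4 * n * k / β) ^ 3 * (Δ / (n * ε)) ≤
        treeMechanism Δ ε (trials k β) D Q ω j ∧
      treeMechanism Δ ε (trials k β) D Q ω j ≤ avgDist D (Q j) +
        1000 * Real.log (4 * n * k / β) ^ 3 * (Δ / (n * ε))} := by
  have hn' : (1 : ℝ) ≤ n := by exact_mod_cast hn
  have hk' : (1 : ℝ) ≤ k := by exact_mod_cast hk
  have hnk : (1 : ℝ) ≤ n * k := by nlinarith
  obtain ⟨hΛ1, hexp⟩ := one_le_log_inv_failure hn hk hβ0 hβ1
  obtain ⟨hT2, hTexp, hT5⟩ := trials_bounds hn hk hβ0 hβ1 hlog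
  have hT0 : 0 < trials k β := trials_pos hk hβ0 hβ1
  have hTk : trials k β ≤ 3 * k := min_le_left _ _
  have hx0 : 0 < n * ε := by positivity
  -- In this branch `n * ε < k ^ 5`, so the truncation error is absorbed by `Δ / (n * ε)`.
  have hscale : Δ / 2 ^ (8 * trials k β) ≤ Δ / (n * ε) :=
    div_le_div_of_nonneg_left hΔ.le hx0 (hx5.le.trans hT5)
  generalize Real.log (4 * n * k / β) = Λ at hΛ1 hexp hT2 ⊢
  generalize trials k β = T at hT0 hTk hT2 hTexp hscale ⊢
  set m := T * (8 * T) * (k + 1) with hm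
  -- The threshold `5 * Λ` makes each tail of order `(β / (4 * n * k)) ^ 5`, enough for a union
  -- bound over the at most `144 * k ^ 3` noise cells.
  set B1 : Set (ℕ → unitInterval) := {ω | ∃ q < m, 5 * Λ < |logit (ω (3 * k * (k + 1) + q))|}
  set B2 : Set (ℕ → unitInterval) := ⋃ j : Fin k,
    {ω | ∀ t < T, ω ∈ failEvent Q Δ (Δ / ε) (8 * T) D (Q j) t}
  have hB1 : tapeLaw B1 ≤ ENNReal.ofReal (β / 2) := by
    refine (tapeLaw_noise_tail_le _ m _).trans (ENNReal.ofReal_le_ofReal ?_)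
    have e5 : Real.exp (-(5 * Λ)) = (β / (4 * n * k)) ^ 5 := by
      rw [← hexp, ← Real.exp_nat_mul]; congr 1; push_cast; ring
    have hTr : (T : ℝ) ≤ 3 * k := by exact_mod_cast hTk
    have h1 : (m : ℝ) ≤ 144 * (k : ℝ) ^ 3 := by
      rw [hm]; push_cast
      calc (T : ℝ) * (8 * T) * (k + 1) ≤ 3 * k * (8 * (3 * k)) * (k + k) := by gcongr
        _ = _ := by ring
    have h2 : β / (4 * n * k) ≤ β / (4 * k) := by
      refine div_le_div_of_nonneg_left hβ0.le (by positivity) ?_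
      nlinarith
    rw [e5]
    calc (m : ℝ) * (2 * (β / (4 * n * k)) ^ 5)
        ≤ 144 * (k : ℝ) ^ 3 * (2 * (β / (4 * k)) ^ 5) := by gcongr
      _ = 9 / 32 * β * (β ^ 4 * (1 / (k : ℝ) ^ 2)) := by field_simp; ring
      _ ≤ 9 / 32 * β * 1 := by
          refine mul_le_mul_of_nonneg_left (mul_le_one₀ (pow_le_one₀ hβ0.le hβ1.le)
            (by positivity) ?_) (by positivity)
          rw [div_le_one (by positivity)]
          exact one_le_pow₀ hk'
      _ ≤ β / 2 := by linarith
  have hB2 : tapeLaw B2 ≤ ENNReal.ofReal (β / 2) := by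
    refine (measure_iUnion_fintype_le _ _).trans ?_
    refine (Finset.sum_le_card_nsmul _ _ _ fun j _ =>
      tapeLaw_forall_failEvent_le hΔ (by positivity) (8 * T) D (Q j) T).trans ?_
    rw [Finset.card_univ, Fintype.card_fin, nsmul_eq_mul, ← ENNReal.ofReal_pow (by norm_num),
      ← ENNReal.ofReal_natCast, ← ENNReal.ofReal_mul (by positivity)]
    refine ENNReal.ofReal_le_ofReal ?_
    -- The failure probability `1/3` is below `1 / e`, so `T ≥ log (2 * k / β)` trials leave at most
    -- `β / (2 * k)` per query.
    have h1 : (1 / 3 : ℝ) ^ T ≤ (Real.exp T)⁻¹ := by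
      rw [one_div, inv_pow]
      refine inv_anti₀ (Real.exp_pos _) ?_
      rw [← Real.exp_one_pow]
      exact pow_le_pow_left₀ (Real.exp_pos 1).le (by linarith [Real.exp_one_lt_d9]) T
    have h2 : (Real.exp T)⁻¹ ≤ β / (2 * k) := by
      rw [← inv_div]
      exact inv_anti₀ (by positivity) hTexp
    calc (k : ℝ) * (1 / 3) ^ T ≤ k * (β / (2 * k)) :=
          mul_le_mul_of_nonneg_left (h1.trans h2) (by positivity)
      _ = β / 2 := by field_simp
  refine ofReal_one_sub_le_tapeLaw hβ0.le (B := B1 ∪ B2) ?_ fun ω hω j => ?_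
  · refine (measure_union_le _ _).trans ((add_le_add hB1 hB2).trans (le_of_eq ?_))
    rw [← ENNReal.ofReal_add (by positivity) (by positivity), add_halves]
  · rw [Set.mem_union, not_or] at hω
    have hω1 : ∀ q < m, |logit (ω (3 * k * (k + 1) + q))| ≤ 5 * Λ := fun q hq =>
      not_lt.1 fun h => hω.1 ⟨q, hq, h⟩
    have hω2 : ∃ t < T, ω ∉ failEvent Q Δ (Δ / ε) (8 * T) D (Q j) t := by
      by_contra! h
      exact hω.2 (Set.mem_iUnion.2 ⟨j, h⟩)
    have hb := treeMechanism_bounds (by omega) (by omega) hε hΔ hX hT0 D Q hω1 j hω2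
    have hnoise : 32 * (T : ℝ) ^ 2 * (5 * Λ) ≤ 640 * Λ ^ 3 := by
      calc 32 * (T : ℝ) ^ 2 * (5 * Λ) ≤ 32 * (2 * Λ) ^ 2 * (5 * Λ) := by gcongr
        _ = _ := by ring
    have hΛ3 : 1 ≤ Λ ^ 3 := one_le_pow₀ hΛ1
    have hxp : 0 < Δ / (n * ε) := by positivity
    have h3 : (3 + 32 * (T : ℝ) ^ 2 * (5 * Λ)) * (Δ / (n * ε)) ≤
        1000 * Λ ^ 3 * (Δ / (n * ε)) :=
      mul_le_mul_of_nonneg_right (by linarith) hxp.le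
    rw [add_mul] at h3
    constructor
    · refine le_trans ?_ hb.1
      linarith
    · refine hb.2.trans ?_
      linarith

theorem tapeLaw_naiveMechanism_ge {Δ ε β : ℝ} (hn : 1 ≤ n) (hk : 1 ≤ k) (hε : 0 < ε)
    (hβ0 : 0 < β) (hβ1 : β < 1) (hΔ : 0 < Δ) (D : Fin n → X) (Q : Fin k → X) :
    ENNReal.ofReal (1 - β) ≤ tapeLaw {ω | ∀ j,
      |naiveMechanism Δ ε D Q ω j - avgDist D (Q j)| ≤
        k * Δ * Real.log (4 * n * k / β) / (n * ε)} := by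
  have hn' : (1 : ℝ) ≤ n := by exact_mod_cast hn
  have hk' : (1 : ℝ) ≤ k := by exact_mod_cast hk
  have hnk : (1 : ℝ) ≤ n * k := by nlinarith
  obtain ⟨-, hexp⟩ := one_le_log_inv_failure hn hk hβ0 hβ1
  generalize Real.log (4 * n * k / β) = Λ at hexp ⊢
  refine ofReal_one_sub_le_tapeLaw hβ0.le
    (B := {ω | ∃ q < k, Λ < |logit (ω (0 + q))|}) ?_ fun ω hω j => ?_
  · refine (tapeLaw_noise_tail_le 0 k Λ).trans (ENNReal.ofReal_le_ofReal ?_)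
    rw [hexp]
    calc (k : ℝ) * (2 * (β / (4 * n * k))) = β * (1 / (2 * n)) := by field_simp; ring
      _ ≤ β * 1 := by
          refine mul_le_mul_of_nonneg_left ?_ hβ0.le
          rw [div_le_one (by positivity)]; linarith
      _ = β := mul_one β
  · have hω1 : ∀ q < k, |logit (ω (0 + q))| ≤ Λ := fun q hq =>
      not_lt.1 fun h => hω ⟨q, hq, h⟩
    exact abs_naiveMechanism_sub_le hε hΔ D Q hω1 j

/-- Every branch meets the error bound for any exponent `s ≤ 4/5`, so the exponents of both parts
are instances. -/
theorem isAccurate_prog {ε δ β Δ s : ℝ} (hn : 1 ≤ n) (hk : 1 ≤ k) (hε : 0 < ε) (hβ0 : 0 < β)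
    (hβ1 : β < 1) (hΔ : 0 < Δ) (hX : ∀ x y : X, dist x y ≤ Δ) (hs0 : 0 ≤ s) (hs1 : s ≤ 4 / 5) :
    IsAccurate (DistanceProgram.prog.mechanism ε δ β Δ : Mechanism X n k)
      (1 / 72 / Real.log (k + 1))
      (1000 * Real.log (4 * n * k / β) ^ 3 * Δ / ((n : ℝ) * ε) ^ s) β := by
  intro D Q
  have hn' : (1 : ℝ) ≤ n := by exact_mod_cast hn
  have hk' : (1 : ℝ) ≤ k := by exact_mod_cast hk
  have hnk : (1 : ℝ) ≤ n * k := by nlinarith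
  set Λ := Real.log (4 * n * k / β) with hΛ
  have hΛ1 : 1 ≤ Λ := (one_le_log_inv_failure hn hk hβ0 hβ1).1
  set l := Real.log (k + 1) with hl
  have hl2 : 2 / 3 ≤ l := by
    have h2 : Real.log 2 ≤ l := Real.log_le_log (by norm_num) (by linarith)
    have := Real.log_two_gt_d9
    linarith
  have hγ1 : 1 / 72 / l ≤ 1 := by
    rw [div_le_one (by linarith)]; linarith
  have hγ0 : 0 ≤ 1 / 72 / l := by positivity
  have hA0 : ∀ j, 0 ≤ avgDist D (Q j) := fun j =>
    mul_nonneg (by positivity) (Finset.sum_nonneg fun _ _ => dist_nonneg)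
  have hAΔ : ∀ j, avgDist D (Q j) ≤ Δ := fun j => by
    rw [avgDist, one_div, inv_mul_le_iff₀ (by linarith)]
    refine (Finset.sum_le_card_nsmul _ _ Δ fun x _ => hX _ _).trans ?_
    simp
  have hγA : ∀ j, 1 / 72 / l * avgDist D (Q j) ≤ avgDist D (Q j) := fun j =>
    mul_le_of_le_one_left (hA0 j) hγ1
  set x : ℝ := n * ε with hx
  have hx0 : 0 < x := by positivity
  have hxs : 0 < x ^ s := Real.rpow_pos_of_pos hx0 s
  have hΛ3 : 1 ≤ Λ ^ 3 := one_le_pow₀ hΛ1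
  set α := 1000 * Λ ^ 3 * Δ / x ^ s with hα
  have hα0 : 0 ≤ α := by positivity
  simp only [mechanism_prog, ← hx]
  by_cases hx1 : x < 1
  · simp only [hx1, if_true]
    refine ofReal_one_sub_le_tapeLaw hβ0.le (B := ∅) (by simp) fun ω _ j => ?_
    have h1 : x ^ s ≤ 1 := Real.rpow_le_one hx0.le hx1.le hs0
    -- For `n * ε < 1` the allowed error exceeds every distance, so `0` is an admissible answer.
    have h2 : Δ ≤ α := by
      rw [hα, le_div_iff₀ hxs]
      nlinarith
    have h3 := hγA j
    have h4 := hAΔ j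
    have h5 := hA0 j
    constructor
    · change _ ≤ (0 : ℝ)
      linarith
    · change (0 : ℝ) ≤ _
      linarith
  simp only [hx1, if_false]
  rw [not_lt] at hx1
  have hpow : ∀ {y : ℝ}, 0 ≤ y → y ≤ 1000 * Λ ^ 3 → y * (Δ / x) ≤ α := by
    intro y hy0 hy
    have h1 : x ^ s ≤ x := by
      calc x ^ s ≤ x ^ (1 : ℝ) := Real.rpow_le_rpow_of_exponent_le hx1 (by linarith)
        _ = x := Real.rpow_one x
    rw [hα, mul_div_assoc]
    exact mul_le_mul hy (div_le_div_of_nonneg_left hΔ.le hxs h1) (by positivity) (by positivity)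
  by_cases hcase : x < (k : ℝ) ^ 5 ∧ Real.log (1 / β) < k
  · simp only [hcase.1, hcase.2, and_self, if_true]
    refine (tapeLaw_treeMechanism_ge hn hk hε hβ0 hβ1 hΔ hX hcase.1 hcase.2 D Q).trans
      (measure_mono fun ω hω j => ?_)
    have h1 := hω j
    have h2 := hpow (y := 1000 * Λ ^ 3) (by positivity) le_rfl
    rw [← hΛ, ← hx] at h1
    constructor <;> linarith [h1.1, h1.2]
  · simp only [hcase, if_false]
    have hkα : k * Δ * Λ / x ≤ α := by
      by_cases hlogβ : Real.log (1 / β) < k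
      · have hxk : (k : ℝ) ^ 5 ≤ x := not_lt.1 fun h => hcase ⟨h, hlogβ⟩
        -- This is where the exponent `4/5` is tight: `k / x ≤ x ^ (1/5 - 1)`.
        have hkx : (k : ℝ) ≤ x ^ (1 / 5 : ℝ) := by
          have := Real.rpow_le_rpow (by positivity) hxk (show (0 : ℝ) ≤ 1 / 5 by norm_num)
          rwa [← Real.rpow_natCast, ← Real.rpow_mul (by positivity),
            show ((5 : ℕ) : ℝ) * (1 / 5) = 1 by norm_num, Real.rpow_one] at this
        have h1 : k * x ^ s ≤ x := by
          calc k * x ^ s ≤ x ^ (1 / 5 : ℝ) * x ^ (4 / 5 : ℝ) :=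
                mul_le_mul hkx (Real.rpow_le_rpow_of_exponent_le hx1 hs1) hxs.le (by positivity)
            _ = x := by
                rw [← Real.rpow_add hx0]; norm_num
        have hΛΛ : Λ ≤ 1000 * Λ ^ 3 := by nlinarith [sq_nonneg Λ]
        rw [hα, div_le_div_iff₀ hx0 hxs]
        calc k * Δ * Λ * x ^ s = (Δ * Λ) * (k * x ^ s) := by ring
          _ ≤ (Δ * (1000 * Λ ^ 3)) * x := by gcongr
          _ = _ := by ring
      -- If `β` is at most `exp (-k)`, the factor `k` is itself bounded by the logarithm in the
      -- error term.
      · have hkΛ : (k : ℝ) ≤ Λ := by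
          refine (not_lt.1 hlogβ).trans (Real.log_le_log (by positivity) ?_)
          rw [div_le_div_iff_of_pos_right hβ0]
          nlinarith
        have := hpow (y := k * Λ) (by positivity) (by
          calc k * Λ ≤ Λ * Λ := by gcongr
            _ ≤ 1000 * Λ ^ 3 := by nlinarith [sq_nonneg Λ])
        calc k * Δ * Λ / x = k * Λ * (Δ / x) := by ring
          _ ≤ α := this
    refine (tapeLaw_naiveMechanism_ge hn hk hε hβ0 hβ1 hΔ D Q).trans
      (measure_mono fun ω hω j => ?_)
    have h1 := abs_le.1 (hω j)
    have h3 := hγA j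
    rw [← hΛ, ← hx] at h1
    constructor <;> linarith [h1.1, h1.2]

theorem IsAccurate.mono {M : Mechanism X n k} {γ α α' β : ℝ} (h : IsAccurate M γ α β)
    (hα : α ≤ α') : IsAccurate M γ α' β := fun D Q =>
  (h D Q).trans (measure_mono fun ω hω j => by
    have := hω j
    constructor <;> linarith [this.1, this.2])

end Accuracy

/-! ### Both parts of the theorem from one purely private program -/

theorem IsDP.mono {X : Type u} {n k : ℕ} {M : Mechanism X n k} {ε δ : ℝ} (h : IsDP M ε 0) : IsDP M ε δ :=
  fun D D' hD Q S hS => (h D D' hD Q S hS).trans (by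
    rw [ENNReal.ofReal_zero, add_zero]; exact le_self_add)

theorem mainTheorem3 :
    (∃ (P : Prog) (c C : ℝ) (p A : ℕ), 0 < c ∧ 0 < C ∧
      ∀ (X : Type u) [MetricSpace X] (n k : ℕ) (ε δ β Δ : ℝ), 1 ≤ n → 1 ≤ k → 0 < ε →
        0 < δ → δ < 1 → 0 < β → β < 1 → 0 < Δ → (∀ x y : X, dist x y ≤ Δ) →
        P.RunsWithin X n k ε δ β Δ (A * (n + k) ^ A) ∧
        IsDP (P.mechanism ε δ β Δ : Mechanism X n k) ε δ ∧
        IsAccurate (P.mechanism ε δ β Δ : Mechanism X n k)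
          (c / Real.log (k + 1))
          (C * Real.log (4 * n * k / (β * δ)) ^ p * Δ / ((n : ℝ) * ε) ^ (4 / 5 : ℝ)) β) ∧
    (∃ (P : Prog) (c C : ℝ) (p A : ℕ), 0 < c ∧ 0 < C ∧
      ∀ (X : Type u) [MetricSpace X] (n k : ℕ) (ε β Δ : ℝ), 1 ≤ n → 1 ≤ k → 0 < ε →
        0 < β → β < 1 → 0 < Δ → (∀ x y : X, dist x y ≤ Δ) →
        P.RunsWithin X n k ε 0 β Δ (A * (n + k) ^ A) ∧
        IsDP (P.mechanism ε 0 β Δ : Mechanism X n k) ε 0 ∧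
        IsAccurate (P.mechanism ε 0 β Δ : Mechanism X n k)
          (c / Real.log (k + 1))
          (C * Real.log (4 * n * k / β) ^ p * Δ / ((n : ℝ) * ε) ^ (2 / 3 : ℝ)) β) := by
  obtain ⟨A, hA⟩ := DistanceProgram.prog.exists_cost_le DistanceProgram.prog_poly
  refine ⟨⟨DistanceProgram.prog, 1 / 72, 1000, 3, A, by norm_num, by norm_num, ?_⟩,
    ⟨DistanceProgram.prog, 1 / 72, 1000, 3, A, by norm_num, by norm_num, ?_⟩⟩
  · intro X _ n k ε δ β Δ hn hk hε hδ0 hδ1 hβ0 hβ1 hΔ hX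
    have hn' : (1 : ℝ) ≤ n := by exact_mod_cast hn
    have hk' : (1 : ℝ) ≤ k := by exact_mod_cast hk
    have hnk : (1 : ℝ) ≤ n * k := by nlinarith
    refine ⟨fun D Q ω => hA (mkInput ε δ β Δ D Q) ω State.init (le_add_right hn),
      (isDP_prog δ hk hε hβ0 hβ1 hΔ hX).mono,
      (isAccurate_prog hn hk hε hβ0 hβ1 hΔ hX (by norm_num) le_rfl).mono ?_⟩
    have h4 : (1 : ℝ) ≤ 4 * n * k / β := by
      rw [le_div_iff₀ hβ0]; nlinarith
    have h0 : 0 ≤ Real.log (4 * n * k / β) := Real.log_nonneg h4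
    -- Dividing by `δ < 1` only enlarges the logarithm, so the pure guarantee implies the
    -- approximate one.
    have h1 : Real.log (4 * n * k / β) ≤ Real.log (4 * n * k / (β * δ)) := by
      refine Real.log_le_log (by linarith) ?_
      exact div_le_div_of_nonneg_left (by positivity) (by positivity)
        (mul_le_of_le_one_right hβ0.le hδ1.le)
    gcongr
  · intro X _ n k ε β Δ hn hk hε hβ0 hβ1 hΔ hX
    exact ⟨fun D Q ω => hA (mkInput ε 0 β Δ D Q) ω State.init (le_add_right hn),
      isDP_prog 0 hk hε hβ0 hβ1 hΔ hX,
      isAccurate_prog hn hk hε hβ0 hβ1 hΔ hX (by norm_num) (by norm_num)⟩
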